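/- Let $n\ge 1$ and let $q,t$ be either indeterminates, or real numbers with $0<q,t<1$; polynomials in $x=(x_1,\dots,x_n)$ have coefficients in a field $K$ of characteristic $0$ containing $q,t$ (for example $\mathbb{Q}(q,t)$; in the real case a field $K\subseteq\mathbb{R}$). *Operators.* Let $s_i$ interchange $x_i$ and $x_{i+1}$, let $(\tau_1f)(x)=f(qx_1,x_2,\dots,x_n)$, and put $$T_i=t+\frac{tx_i-x_{i+1}}{x_i-x_{i+1}}(s_i-1)\ (1\le i\le n-1),\qquad \omega=s_{n-1}\cdots s_1\tau_1,\qquad Y_i=t^{-n+i}\,T_i\cdots T_{n-1}\,\omega\,T_1^{-1}\cdots T_{i-1}^{-1}\ (1\le i\le n).$$ For $\sigma\in S_n$ with reduced word $\sigma=s_{i_1}\cdots s_{i_p}$ put $T_\sigma=T_{i_1}\cdots T_{i_p}$ and $l(\sigma)=\#\{(i,j): i<j,\ \sigma_i>\sigma_j\}$, and let $$U^+=\sum_{\sigma\in S_n}T_\sigma,\qquad U^-=\sum_{\sigma\in S_n}(-t)^{-l(\sigma)}T_\sigma .$$ *Orders.* For a composition $\eta\in\mathbb{Z}_{\ge0}^n$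 let $\eta^+$ be its decreasing rearrangement, $\eta^R$ its increasing rearrangement (the reversal of $\eta^+$), and $f_j=\#\{i:\eta_i=j\}$. For $n$-tuples of the same modulus, $\nu<\eta$ means $\nu\neq\eta$ and $\sum_{i\le p}\nu_i\le\sum_{i\le p}\eta_i$ for all $p$; and $\nu\prec\eta$ means $\nu^+<\eta^+$, or $\nu^+=\eta^+$ and $\nu<\eta$. Put $$t^{\bar\eta_i}:=q^{\eta_i}t^{-l'_\eta(i)},\qquad l'_\eta(i)=\#\{k<i:\eta_k\ge\eta_i\}+\#\{k>i:\eta_k>\eta_i\}.$$ *Polynomials.* The non-symmetric Macdonald polynomial $E_\eta$ is defined by $E_\eta=x^\eta+\sum_{\nu\prec\eta}b_{\eta\nu}x^\nu$ and $Y_iE_\eta=t^{\bar\eta_i}E_\eta$ for $1\le i\le n$. For a partition $\kappa$ with $n$ parts (zeros allowed), the symmetric Macdonald polynomial $P_\kappa$ is defined by $P_\kappa=m_\kappa+\sum_{\mu<\kappa}u_{\kappa\mu}m_\mu$ ($\mu$ partitions, $m_\mu$ the monomial symmetric polynomials) and $\big(\sum_iY_i\big)P_\kappa=\big(\sum_it^{\bar\kappa_i}\big)P_\kappa$.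 For a partition $\kappa$ with non-repeating parts, the $q$-antisymmetric Macdonald polynomial $S_\kappa$ is defined by $S_\kappa=m'_\kappa+\sum_{\mu<\kappa}v_{\kappa\mu}m'_\mu$ ($\mu$ partitions with non-repeating parts, $m'_\mu=U^-x^\mu$) and the same eigenvalue equation. Finally $[k]_u!=\prod_{i=1}^k\frac{1-u^i}{1-u}$. **Lemma.** Let $\eta\in\mathbb{Z}_{\ge0}^n$. (a) The conditions above determine unique polynomials $E_{\eta^R}$ and $P_{\eta^+}$, and $$P_{\eta^+}(x;q,t)=t^{-n(n-1)/2}\prod_{j=0}^{\eta^+_1}\frac{1}{[f_j]_{t^{-1}}!}\;U^+E_{\eta^R}(x;q,t).$$ (b) If the parts of $\eta$ are pairwise distinct, then the conditions above also determine a unique polynomial $S_{\eta^+}$, and $$S_{\eta^+}(x;q,t)=(-1)^{n(n-1)/2}\,U^-E_{\eta^R}(x;q,t).$$ -/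

import Mathlib

namespace NSMacdonald

open MvPolynomial

noncomputable section

/-! ### Compositions, partitions and orderings -/

/-- A composition with `n` parts (zeros allowed). It is a partition when it is `Antitone`, and a
partition with non-repeating parts when it is `StrictAnti`. -/
abbrev Comp (n : ℕ) : Type := Fin n → ℕ

/-- The reversed tuple `(η_n, …, η_1)`. -/
def rev {n : ℕ} (η : Comp n) : Comp n := fun i => η (Fin.rev i)

/-- `η⁺`: the decreasing rearrangement of `η` (`η ∘ Tuple.sort η` is the increasing one). -/
def plus {n : ℕ} (η : Comp n) : Comp n := rev (η ∘ Tuple.sort η)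

/-- `η^R`: the reversal of `η⁺`, that is, the increasing rearrangement of `η`. -/
def incr {n : ℕ} (η : Comp n) : Comp n := rev (plus η)

/-- `f_j(η)`: the number of parts of `η` equal to `j`. -/
def mult {n : ℕ} (η : Comp n) (j : ℕ) : ℕ := (Finset.univ.filter fun i => η i = j).card

/-- Strict dominance order on `n`-tuples of the same modulus. -/
def DomLT {n : ℕ} (ν η : Comp n) : Prop :=
  ν ≠ η ∧ ∑ i, ν i = ∑ i, η i ∧
    ∀ p : Fin n, ∑ i ∈ Finset.Iic p, ν i ≤ ∑ i ∈ Finset.Iic p, η i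

/-- The partial order `≺` on compositions of the same modulus. -/
def Prec {n : ℕ} (ν η : Comp n) : Prop :=
  DomLT (plus ν) (plus η) ∨ (plus ν = plus η ∧ DomLT ν η)

/-- The leg colength `l'_η(i)`. -/
def legColength {n : ℕ} (η : Comp n) (i : Fin n) : ℕ :=
  (Finset.univ.filter fun k => k < i ∧ η i ≤ η k).card +
    (Finset.univ.filter fun k => i < k ∧ η i < η k).card

section

variable {K : Type*} [Field K] {m n : ℕ}

/-- The value `t^{η̄_i} = q^{η_i} t^{-l'_η(i)}`. -/
def spec (q t : K) (η : Comp n) (i : Fin n) : K := q ^ η i * (t⁻¹) ^ legColength η i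

/-- `[k]_u! = ∏_{i=1}^k (1 - u^i)/(1 - u)`. -/
def qFactorial (u : K) (k : ℕ) : K := ∏ i ∈ Finset.range k, (1 - u ^ (i + 1)) / (1 - u)

/-! ### Demazure-Lustig operators on polynomials in `n = m + 1` variables -/

/-- The simple transposition `s_i`. -/
def simple (i : Fin m) : Equiv.Perm (Fin (m + 1)) := Equiv.swap i.castSucc i.succ

/-- The operator interchanging the two variables with neighbouring indices. -/
def swapOp (i : Fin m) : Module.End K (MvPolynomial (Fin (m + 1)) K) :=
  (rename (simple i)).toLinearMap

theorem swapOp_apply (i : Fin m) (f : MvPolynomial (Fin (m + 1)) K) :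
    swapOp i f = rename (simple i) f := rfl

theorem X_sub_X_ne_zero (i : Fin m) :
    (X i.castSucc - X i.succ : MvPolynomial (Fin (m + 1)) K) ≠ 0 := by
  intro h
  have := X_injective (R := K) (sub_eq_zero.mp h)
  exact absurd this (Fin.castSucc_lt_succ (i := i)).ne

theorem dvd_swapOp_sub (i : Fin m) (f : MvPolynomial (Fin (m + 1)) K) :
    (X i.castSucc - X i.succ) ∣ swapOp i f - f := by
  rw [swapOp_apply]
  induction f using MvPolynomial.induction_on with
  | C a => simp
  | add p r hp hr =>
    have : rename (simple i) (p + r) - (p + r)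
        = (rename (simple i) p - p) + (rename (simple i) r - r) := by
      rw [map_add]; ring
    rw [this]
    exact dvd_add hp hr
  | mul_X p k hp =>
    have : rename (simple i) (p * X k) - p * X k
        = (rename (simple i) p - p) * X (simple i k) + p * (X (simple i k) - X k) := by
      rw [map_mul, rename_X]; ring
    rw [this]
    refine dvd_add (Dvd.dvd.mul_right hp _) (Dvd.dvd.mul_left ?_ _)
    unfold simple
    by_cases h1 : k = i.castSucc
    · subst h1
      rw [Equiv.swap_apply_left]
      exact ⟨-1, by ring⟩
    · by_cases h2 : k = i.succ
      · subst h2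
        rw [Equiv.swap_apply_right]
      · rw [Equiv.swap_apply_of_ne_of_ne h1 h2]; simp

theorem exists_divDiff (i : Fin m) (f : MvPolynomial (Fin (m + 1)) K) :
    ∃ g, (X i.castSucc - X i.succ) * g = swapOp i f - f := by
  obtain ⟨g, hg⟩ := dvd_swapOp_sub i f
  exact ⟨g, hg.symm⟩

/-- The divided difference `f ↦ (s_i f - f)/(x_i - x_{i+1})`. -/
def divDiff (i : Fin m) : Module.End K (MvPolynomial (Fin (m + 1)) K) where
  toFun f := (exists_divDiff i f).choose
  map_add' f g := by
    apply mul_left_cancel₀ (X_sub_X_ne_zero (K := K) i)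
    rw [mul_add, (exists_divDiff i f).choose_spec, (exists_divDiff i g).choose_spec,
      (exists_divDiff i (f + g)).choose_spec, map_add]
    ring
  map_smul' c f := by
    apply mul_left_cancel₀ (X_sub_X_ne_zero (K := K) i)
    rw [RingHom.id_apply, mul_smul_comm, (exists_divDiff i f).choose_spec,
      (exists_divDiff i (c • f)).choose_spec, map_smul, smul_sub]

theorem divDiff_spec (i : Fin m) (f : MvPolynomial (Fin (m + 1)) K) :
    (X i.castSucc - X i.succ) * divDiff i f = swapOp i f - f :=
  (exists_divDiff i f).choose_spec

/-- The Demazure-Lustig operator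
`T_i = t + (t x_i - x_{i+1})/(x_i - x_{i+1}) (s_i - 1)`. -/
def T (t : K) (i : Fin m) : Module.End K (MvPolynomial (Fin (m + 1)) K) :=
  t • 1 + LinearMap.mulLeft K (C t * X i.castSucc - X i.succ) * divDiff i

/-- The inverse `T_i⁻¹ = t⁻¹ - 1 + t⁻¹ T_i`. -/
def Tinv (t : K) (i : Fin m) : Module.End K (MvPolynomial (Fin (m + 1)) K) :=
  (t⁻¹ - 1) • 1 + t⁻¹ • T t i

theorem T_apply (t : K) (i : Fin m) (f : MvPolynomial (Fin (m + 1)) K) :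
    T t i f = C t * f + (C t * X i.castSucc - X i.succ) * divDiff i f := by
  simp [T, MvPolynomial.smul_eq_C_mul]

theorem T_quadratic (t : K) (i : Fin m) : (T t i - t • 1) * (T t i + 1) = 0 := by
  refine LinearMap.ext fun f => ?_
  set g := (T t i + 1) f with hg
  have hsX : swapOp i (X i.castSucc : MvPolynomial (Fin (m + 1)) K) = X i.succ := by
    simp [swapOp_apply, simple]
  have hsY : swapOp i (X i.succ : MvPolynomial (Fin (m + 1)) K) = X i.castSucc := by
    simp [swapOp_apply, simple]
  have hss : swapOp i (swapOp i f) = f := by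
    simp only [swapOp_apply, rename_rename]
    have : (simple i ∘ simple i : Fin (m + 1) → Fin (m + 1)) = id := by
      funext k; simp [simple]
    rw [this, rename_id]; rfl
  have hm : ∀ a b : MvPolynomial (Fin (m + 1)) K, swapOp i (a * b) = swapOp i a * swapOp i b := by
    intro a b; simp [swapOp_apply]
  have hC : swapOp i (C t : MvPolynomial (Fin (m + 1)) K) = C t := by simp [swapOp_apply]
  have h1 : (X i.castSucc - X i.succ) * g
      = (X i.castSucc - C t * X i.succ) * f + (C t * X i.castSucc - X i.succ) * swapOp i f := by
    have := divDiff_spec i f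
    rw [hg, LinearMap.add_apply, T_apply, Module.End.one_apply]
    linear_combination (C t * X i.castSucc - X i.succ) * this
  have h2 : swapOp i g = g := by
    have h := congrArg (swapOp i) h1
    simp only [hm, map_add, map_sub, hsX, hsY, hC, hss] at h
    apply mul_left_cancel₀ (X_sub_X_ne_zero (K := K) i)
    linear_combination -h - h1
  have h3 : divDiff i g = 0 := by
    apply mul_left_cancel₀ (X_sub_X_ne_zero (K := K) i)
    rw [divDiff_spec, h2]; simp
  rw [Module.End.mul_apply, ← hg, LinearMap.sub_apply, T_apply, h3]
  simp [MvPolynomial.smul_eq_C_mul]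

theorem T_mul_Tinv {t : K} (ht : t ≠ 0) (i : Fin m) : T t i * Tinv t i = 1 := by
  refine LinearMap.ext fun f => ?_
  have h0 := LinearMap.congr_fun (T_quadratic t i) f
  have hc : (C t⁻¹ : MvPolynomial (Fin (m + 1)) K) * C t = 1 := by
    rw [← C_mul, inv_mul_cancel₀ ht, C_1]
  simp only [Tinv, Module.End.mul_apply, LinearMap.add_apply, LinearMap.sub_apply,
    LinearMap.smul_apply, Module.End.one_apply, map_add, map_smul, LinearMap.zero_apply] at h0 ⊢
  simp only [MvPolynomial.smul_eq_C_mul, C_sub, C_1] at h0 ⊢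
  linear_combination C t⁻¹ * h0 + (f + T t i f) * hc

/-- The `q`-shift operator `(τ_i f)(x) = f(x_1, …, q x_i, …, x_n)`. -/
def shiftOp (q : K) (i : Fin n) : Module.End K (MvPolynomial (Fin n) K) :=
  (aeval fun j => if j = i then C q * X j else X j :
    MvPolynomial (Fin n) K →ₐ[K] MvPolynomial (Fin n) K).toLinearMap

/-- `ω = s_{n-1} ⋯ s_2 s_1 τ_1`. -/
def omega (m : ℕ) (q : K) : Module.End K (MvPolynomial (Fin (m + 1)) K) :=
  ((List.finRange m).reverse.map swapOp).prod * shiftOp q 0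

/-- The Cherednik operator `Y_i = t^{-n+i} T_i ⋯ T_{n-1} ω T_1⁻¹ ⋯ T_{i-1}⁻¹`
(here `n = m + 1` and indices start at `0`, so the exponent is `i - m`). -/
def Y (q t : K) (i : Fin (m + 1)) : Module.End K (MvPolynomial (Fin (m + 1)) K) :=
  t ^ ((i : ℤ) - (m : ℤ)) •
    ((((List.finRange m).filter fun k => i ≤ k.castSucc).map (T t)).prod * omega m q *
      (((List.finRange m).filter fun k => k.castSucc < i).map (Tinv t)).prod)

/-! ### Symmetrizers -/

/-- `w` is a reduced word of `σ`: `σ = s_{w_1} ⋯ s_{w_p}` with `p` minimal. -/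
def IsReducedWord (w : List (Fin m)) (σ : Equiv.Perm (Fin (m + 1))) : Prop :=
  (w.map simple).prod = σ ∧
    ∀ w' : List (Fin m), (w'.map simple).prod = σ → w.length ≤ w'.length

theorem exists_reducedWord (σ : Equiv.Perm (Fin (m + 1))) :
    ∃ w : List (Fin m), IsReducedWord w σ := by
  have hex : ∃ w : List (Fin m), (w.map simple).prod = σ := by
    have hσ : σ ∈ Submonoid.closure (Set.range fun i : Fin m => simple i) := by
      have := Equiv.Perm.mclosure_swap_castSucc_succ m
      simp only [simple]
      rw [this]
      trivial
    obtain ⟨l, hl, hp⟩ := Submonoid.exists_list_of_mem_closure hσ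
    have hl' : l ∈ Set.range (List.map (simple (m := m))) := by
      rw [Set.range_list_map]
      exact hl
    obtain ⟨w, rfl⟩ := hl'
    exact ⟨w, hp⟩
  classical
  let S : Set (List (Fin m)) := {w | (w.map simple).prod = σ}
  have hS : S.Nonempty := hex
  refine ⟨Function.argminOn List.length S hS, Function.argminOn_mem List.length S hS, ?_⟩
  intro w' hw'
  exact Function.argminOn_le List.length S hw'

/-- `T_σ = T_{i_1} ⋯ T_{i_p}` for a reduced word `σ = s_{i_1} ⋯ s_{i_p}` (by the braid
relations the choice of the reduced word does not matter). -/
def Tperm (t : K) (σ : Equiv.Perm (Fin (m + 1))) :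
    Module.End K (MvPolynomial (Fin (m + 1)) K) :=
  ((exists_reducedWord σ).choose.map (T t)).prod

/-- `l(σ) = #{(i,j) | i < j, σ_i > σ_j}`. -/
def permLength (σ : Equiv.Perm (Fin n)) : ℕ :=
  (Finset.univ.filter fun p : Fin n × Fin n => p.1 < p.2 ∧ σ p.2 < σ p.1).card

/-- `U⁺ = ∑_σ T_σ`. -/
def Uplus (m : ℕ) (t : K) : Module.End K (MvPolynomial (Fin (m + 1)) K) :=
  ∑ σ : Equiv.Perm (Fin (m + 1)), Tperm t σ

/-- `U⁻ = ∑_σ (-t)^{-l(σ)} T_σ`. -/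
def Uminus (m : ℕ) (t : K) : Module.End K (MvPolynomial (Fin (m + 1)) K) :=
  ∑ σ : Equiv.Perm (Fin (m + 1)), ((-t)⁻¹) ^ permLength σ • Tperm t σ

/-! ### Macdonald polynomials -/

/-- The monomial `x^η`. -/
def mono (K : Type*) [Field K] {n : ℕ} (η : Comp n) : MvPolynomial (Fin n) K := ∏ i, X i ^ η i

/-- The monomial symmetric polynomial `m_κ`: the sum of the distinct monomials obtained by
permuting `κ`. -/
def monoSymm (K : Type*) [Field K] {n : ℕ} (κ : Comp n) : MvPolynomial (Fin n) K :=
  ∑ ν ∈ Finset.univ.image (fun σ : Equiv.Perm (Fin n) => κ ∘ σ), mono K ν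

/-- The `q`-antisymmetric monomial `m'_κ = U⁻ x^κ`. -/
def monoAnti (t : K) (κ : Comp (m + 1)) : MvPolynomial (Fin (m + 1)) K := Uminus m t (mono K κ)

/-- The defining conditions of the non-symmetric Macdonald polynomial `E_η`:
`E_η = x^η + ∑_{ν ≺ η} b_ν x^ν` and `Y_i E_η = t^{η̄_i} E_η` for all `i`. -/
def IsNonsym (q t : K) (η : Comp (m + 1)) (f : MvPolynomial (Fin (m + 1)) K) : Prop :=
  f - mono K η ∈ Submodule.span K {g | ∃ ν, Prec ν η ∧ g = mono K ν} ∧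
    ∀ i, Y q t i f = spec q t η i • f

/-- The defining conditions of the symmetric Macdonald polynomial `P_κ`:
`P_κ = m_κ + ∑_{μ < κ} u_μ m_μ` and `(∑ Y_i) P_κ = (∑ t^{κ̄_i}) P_κ`. -/
def IsSym (q t : K) (κ : Comp (m + 1)) (f : MvPolynomial (Fin (m + 1)) K) : Prop :=
  f - monoSymm K κ ∈ Submodule.span K {g | ∃ μ, Antitone μ ∧ DomLT μ κ ∧ g = monoSymm K μ} ∧
    (∑ i, Y q t i) f = (∑ i, spec q t κ i) • f

/-- The defining conditions of the `q`-antisymmetric Macdonald polynomial `S_κ`: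
`S_κ = m'_κ + ∑_{μ < κ} v_μ m'_μ`, where `μ` has non-repeating parts, and
`(∑ Y_i) S_κ = (∑ t^{κ̄_i}) S_κ`. -/
def IsAnti (q t : K) (κ : Comp (m + 1)) (f : MvPolynomial (Fin (m + 1)) K) : Prop :=
  f - monoAnti t κ ∈
      Submodule.span K {g | ∃ μ, StrictAnti μ ∧ DomLT μ κ ∧ g = monoAnti t μ} ∧
    (∑ i, Y q t i) f = (∑ i, spec q t κ i) • f

/-- The non-symmetric Macdonald polynomial `E_η(x;q,t)`. -/
def E (q t : K) (η : Comp (m + 1)) : MvPolynomial (Fin (m + 1)) K :=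
  Classical.epsilon (IsNonsym q t η)

/-- The symmetric Macdonald polynomial `P_κ(x;q,t)` of a partition `κ`. -/
def P (q t : K) (κ : Comp (m + 1)) : MvPolynomial (Fin (m + 1)) K :=
  Classical.epsilon (IsSym q t κ)

/-- The `q`-antisymmetric Macdonald polynomial `S_κ(x;q,t)` of a partition `κ` with non-repeating
parts. -/
def S (q t : K) (κ : Comp (m + 1)) : MvPolynomial (Fin (m + 1)) K :=
  Classical.epsilon (IsAnti q t κ)

end

/-- The admissible parameters: either `q, t` are indeterminates (algebraically independent over
`ℚ`), or they are real parameters in the open interval `(0,1)` (the coefficient field being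
embedded in `ℝ`). -/
def Admissible {K : Type*} [Field K] [CharZero K] (q t : K) : Prop :=
  AlgebraicIndependent ℚ ![q, t] ∨
    ∃ φ : K →+* ℝ, (0 < φ q ∧ φ q < 1) ∧ (0 < φ t ∧ φ t < 1)

end

end NSMacdonald

/-! Everything is carried by the single operator `Z = ∑ Y_i`. It commutes with every `T_i` and with
every `Y_i`; the full commutativity of the `Y_i` is not needed. On monomials it is triangular: `Z
x^ν` is `eigen (ν⁺) x^ν` plus monomials whose sorted exponents lie strictly below `ν⁺`
(`sum_Y_mono`). For admissible parameters the eigenvalues are distinct along strict dominance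
(`Admissible.eigen_ne`). Hence a `Z`-eigenvector with eigenvalue `eigen κ` inside the span `lower κ`
of monomials below `κ` is zero (`Admissible.eq_zero_of_sum_Y_eq`). This gives every uniqueness
assertion, since two candidates differ by such a vector.

For existence of `E_{η^R}`, note that the increasing rearrangement is minimal in its orbit, so `ν ≺
η^R` just means `ν⁺ < η⁺` (`prec_incr_iff`). Solving `(Z - eigen η⁺) r = p` in `lower η⁺` corrects
`x^{η^R}` to a `Z`-eigenvector `f`. The defect `Y_i f - t^{η̄_i} f` is again a `Z`-eigenvector in
`lower η⁺`, hence zero.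

The symmetrizers commute with `Z`, so `U⁺ E` and `U⁻ E` have the right eigenvalue, and only their
leading coefficients remain. Because `T_i U⁺ = t U⁺`, the polynomial `U⁺ E` is symmetric, a multiple
of `m_κ` plus lower `m_μ`. The multiple is found with the functional `Λ(p) = ∑ t^{-inv ν} [x^ν] p`,
summed over rearrangements `ν` of `κ`: it kills lower terms and satisfies `Λ T_i = t Λ`. So `Λ(U⁺ E)
= ∑ t^{l(σ)} = t^{n(n-1)/2} [n]_{1/t}!`, while `Λ(m_κ)` is the multinomial `[n]_{1/t}! / ∏
[f_j]_{1/t}!`; the quotient is the constant of the theorem.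

Because `U⁻ T_i = -U⁻`, sorting an exponent under `U⁻` costs a sign per exchange, and exponents with
a repeated part give zero. Sorting the increasing `η^R` with distinct parts takes `n(n-1)/2`
exchanges. -/

namespace NSMacdonald

noncomputable section

/-! ### Inversions and reduced words -/

section Inversions

variable {m n : ℕ} {α : Type*} [LinearOrder α]

/-- The number of inversions of a tuple. -/
def invCount (ν : Fin n → α) : ℕ :=
  (Finset.univ.filter fun p : Fin n × Fin n => p.1 < p.2 ∧ ν p.2 < ν p.1).card

theorem permLength_eq_invCount (σ : Equiv.Perm (Fin n)) : permLength σ = invCount σ := rfl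

theorem simple_val (i : Fin m) (a : Fin (m + 1)) :
    (simple i a : ℕ) =
      if (a : ℕ) = i then (i : ℕ) + 1 else if (a : ℕ) = (i : ℕ) + 1 then (i : ℕ) else (a : ℕ) := by
  unfold simple
  rw [Equiv.swap_apply_def]
  simp only [Fin.ext_iff, Fin.val_castSucc, Fin.val_succ]
  split_ifs <;> simp

@[simp] theorem simple_simple (i : Fin m) (a : Fin (m + 1)) : simple i (simple i a) = a := by
  simp [simple]

@[simp] theorem simple_mul_self (i : Fin m) : simple i * simple i = 1 := by
  simp [simple]

@[simp] theorem simple_inv (i : Fin m) : (simple i)⁻¹ = simple i := by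
  simp [simple]

@[simp] theorem simple_symm (i : Fin m) : (simple i).symm = simple i := by
  simp [simple]

@[simp] theorem simple_castSucc (i : Fin m) : simple i i.castSucc = i.succ := by
  simp [simple]

@[simp] theorem simple_succ (i : Fin m) : simple i i.succ = i.castSucc := by
  simp [simple]

theorem comp_simple_comp_simple {β : Type*} (ν : Fin (m + 1) → β) (i : Fin m) :
    (ν ∘ simple i) ∘ simple i = ν := by
  funext a; simp

theorem simple_lt_simple {i : Fin m} {a b : Fin (m + 1)} (h : a < b)
    (h' : ¬ (a = i.castSucc ∧ b = i.succ)) : simple i a < simple i b := by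
  rw [Fin.lt_def] at *
  simp only [Fin.ext_iff, Fin.val_castSucc, Fin.val_succ] at h'
  rw [simple_val, simple_val]
  split_ifs <;> omega

/-- The transposition preserves the order of every pair of positions except `(i, i+1)`, so the old
inversions are carried bijectively to inversions and exactly that pair is new. -/
theorem invCount_comp_simple {ν : Fin (m + 1) → α} {i : Fin m}
    (h : ν i.castSucc < ν i.succ) : invCount (ν ∘ simple i) = invCount ν + 1 := by
  have hc : invCount ν = ((Finset.univ.filter fun p : Fin (m + 1) × Fin (m + 1) =>
      p.1 < p.2 ∧ ν p.2 < ν p.1).map (Equiv.prodCongr (simple i) (simple i)).toEmbedding).card := by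
    rw [Finset.card_map]; rfl
  rw [hc, invCount, ← Finset.card_insert_of_notMem (a := (i.castSucc, i.succ))]
  · congr 1
    ext ⟨a, b⟩
    simp only [Finset.mem_filter, Finset.mem_univ, true_and, Function.comp, Finset.mem_insert,
      Finset.mem_map_equiv, Equiv.prodCongr_symm, Equiv.prodCongr_apply, Prod.map,
      simple_symm, Prod.mk.injEq]
    constructor
    · rintro ⟨h1, h2⟩
      by_cases h3 : a = i.castSucc ∧ b = i.succ
      · exact Or.inl h3
      · exact Or.inr ⟨simple_lt_simple h1 h3, h2⟩
    · rintro (⟨rfl, rfl⟩ | ⟨h1, h2⟩)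
      · exact ⟨Fin.castSucc_lt_succ, by simpa using h⟩
      · refine ⟨?_, h2⟩
        have := simple_lt_simple (i := i) h1 (by
          rintro ⟨h3, h4⟩
          rw [h3, h4] at h2
          exact lt_asymm h h2)
        simpa using this
  · simp only [Finset.mem_map_equiv, Equiv.prodCongr_symm, Equiv.prodCongr_apply, Prod.map,
      simple_symm, Finset.mem_filter, simple_castSucc, simple_succ]
    rintro ⟨-, h1, -⟩
    exact absurd h1 (not_lt.mpr Fin.castSucc_lt_succ.le)

theorem invCount_comp_simple' {ν : Fin (m + 1) → α} {i : Fin m}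
    (h : ν i.succ < ν i.castSucc) : invCount (ν ∘ simple i) + 1 = invCount ν := by
  have := invCount_comp_simple (ν := ν ∘ simple i) (i := i) (by simpa using h)
  rw [comp_simple_comp_simple] at this
  exact this.symm

theorem monotone_of_castSucc_le {ν : Fin (m + 1) → α}
    (h : ∀ i : Fin m, ν i.castSucc ≤ ν i.succ) : Monotone ν :=
  Fin.monotone_iff_le_succ.mpr h

theorem invCount_eq_zero_of_monotone {ν : Fin n → α} (h : Monotone ν) : invCount ν = 0 := by
  unfold invCount
  rw [Finset.card_eq_zero, Finset.filter_eq_empty_iff]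
  rintro ⟨a, b⟩ - ⟨h1, h2⟩
  exact absurd h2 (not_lt.mpr (h h1.le))

/-- Induction on tuples from the monotone ones, by exchanging neighbours that are in
increasing order. -/
theorem induction_invCount {motive : (Fin (m + 1) → α) → Prop}
    (mono : ∀ ν, Monotone ν → motive ν)
    (swap : ∀ ν (i : Fin m), ν i.castSucc < ν i.succ → motive ν → motive (ν ∘ simple i))
    (ν : Fin (m + 1) → α) : motive ν := by
  induction h : invCount ν generalizing ν with
  | zero =>
    refine mono ν (monotone_of_castSucc_le fun i => ?_)
    by_contra! hi
    have := invCount_comp_simple' hi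
    omega
  | succ k ih =>
    by_cases hm : Monotone ν
    · exact mono ν hm
    · have : ∃ i : Fin m, ν i.succ < ν i.castSucc := by
        by_contra! hc
        exact hm (monotone_of_castSucc_le hc)
      obtain ⟨i, hi⟩ := this
      have h1 := invCount_comp_simple' hi
      have h2 := swap (ν ∘ simple i) i (by simpa using hi) (ih _ (by omega))
      rwa [comp_simple_comp_simple] at h2

/-! ### Length of a permutation and reduced words -/

theorem permLength_inv (σ : Equiv.Perm (Fin n)) : permLength σ⁻¹ = permLength σ := by
  unfold permLength
  refine Finset.card_bij' (fun p _ => (σ⁻¹ p.2, σ⁻¹ p.1)) (fun p _ => (σ p.2, σ p.1)) ?_ ?_ ?_ ?_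
  · rintro ⟨a, b⟩; simp +contextual
  · rintro ⟨a, b⟩; simp +contextual
  · rintro ⟨a, b⟩; simp
  · rintro ⟨a, b⟩; simp

theorem permLength_mul_simple {σ : Equiv.Perm (Fin (m + 1))} {i : Fin m}
    (h : σ i.castSucc < σ i.succ) : permLength (σ * simple i) = permLength σ + 1 :=
  invCount_comp_simple h

theorem permLength_simple_mul {σ : Equiv.Perm (Fin (m + 1))} {i : Fin m}
    (h : σ⁻¹ i.castSucc < σ⁻¹ i.succ) : permLength (simple i * σ) = permLength σ + 1 := by
  rw [← permLength_inv, mul_inv_rev, simple_inv, permLength_mul_simple h, permLength_inv]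

theorem permLength_simple_mul' {σ : Equiv.Perm (Fin (m + 1))} {i : Fin m}
    (h : σ⁻¹ i.succ < σ⁻¹ i.castSucc) : permLength (simple i * σ) + 1 = permLength σ := by
  have := permLength_simple_mul (σ := simple i * σ) (i := i) (by simpa using h)
  rw [← mul_assoc, simple_mul_self, one_mul] at this
  exact this.symm

theorem inv_castSucc_ne (σ : Equiv.Perm (Fin (m + 1))) (i : Fin m) :
    σ i.castSucc ≠ σ i.succ :=
  fun h => Fin.castSucc_lt_succ.ne (σ.injective h)

theorem permLength_one : permLength (1 : Equiv.Perm (Fin n)) = 0 :=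
  invCount_eq_zero_of_monotone monotone_id

theorem permLength_prod_le (w : List (Fin m)) : permLength (w.map simple).prod ≤ w.length := by
  induction w with
  | nil => simp [permLength_one]
  | cons i w ih =>
    rw [List.map_cons, List.prod_cons, List.length_cons]
    rcases lt_or_gt_of_ne (inv_castSucc_ne (w.map simple).prod⁻¹ i) with h | h
    · rw [permLength_simple_mul h]; omega
    · have := permLength_simple_mul' h; omega

theorem exists_descent {σ : Equiv.Perm (Fin (m + 1))} (h : permLength σ ≠ 0) :
    ∃ i : Fin m, σ⁻¹ i.succ < σ⁻¹ i.castSucc := by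
  by_contra! hc
  refine h ?_
  rw [← permLength_inv]
  exact invCount_eq_zero_of_monotone (monotone_of_castSucc_le hc)

theorem eq_one_of_permLength_eq_zero {σ : Equiv.Perm (Fin (m + 1))} (h : permLength σ = 0) :
    σ = 1 := by
  refine (Equiv.Perm.monotone_iff σ).mp (monotone_of_castSucc_le fun i => ?_)
  by_contra! hi
  have : invCount (σ ∘ simple i) + 1 = invCount σ := invCount_comp_simple' hi
  rw [← permLength_eq_invCount, h] at this
  omega

theorem exists_word_permLength (σ : Equiv.Perm (Fin (m + 1))) :
    ∃ w : List (Fin m), (w.map simple).prod = σ ∧ w.length = permLength σ := by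
  induction h : permLength σ generalizing σ with
  | zero => exact ⟨[], by simp [eq_one_of_permLength_eq_zero h], rfl⟩
  | succ k ih =>
    obtain ⟨i, hi⟩ := exists_descent (σ := σ) (by omega)
    have h1 := permLength_simple_mul' hi
    obtain ⟨w, hw, hl⟩ := ih (simple i * σ) (by omega)
    refine ⟨i :: w, ?_, by simp [hl]⟩
    rw [List.map_cons, List.prod_cons, hw, ← mul_assoc, simple_mul_self, one_mul]

/-- A letter raises the inversion number by at most one, which bounds word lengths from below;
removing descents one at a time attains the bound. This links `T_σ`, defined by minimal words, with
`l(σ)`. -/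
theorem isReducedWord_iff {w : List (Fin m)} {σ : Equiv.Perm (Fin (m + 1))} :
    IsReducedWord w σ ↔ (w.map simple).prod = σ ∧ w.length = permLength σ := by
  constructor
  · rintro ⟨h1, h2⟩
    obtain ⟨w', hw', hl⟩ := exists_word_permLength σ
    have h3 := permLength_prod_le w
    rw [h1] at h3
    have := h2 w' hw'
    exact ⟨h1, by omega⟩
  · rintro ⟨h1, h2⟩
    refine ⟨h1, fun w' hw' => ?_⟩
    rw [h2, ← hw']
    exact permLength_prod_le w'

/-- Stripping the first letter must lower the inversion number, which happens exactly at a descent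
of `σ⁻¹`. This makes induction on reduced words possible. -/
theorem isReducedWord_cons {w : List (Fin m)} {σ : Equiv.Perm (Fin (m + 1))} {i : Fin m} :
    IsReducedWord (i :: w) σ ↔
      IsReducedWord w (simple i * σ) ∧ σ⁻¹ i.succ < σ⁻¹ i.castSucc := by
  simp only [isReducedWord_iff, List.map_cons, List.prod_cons, List.length_cons]
  have e : simple i * (w.map simple).prod = σ ↔ (w.map simple).prod = simple i * σ := by
    constructor
    · rintro rfl; rw [← mul_assoc, simple_mul_self, one_mul]
    · intro h; rw [h, ← mul_assoc, simple_mul_self, one_mul]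
  rw [e]
  constructor
  · rintro ⟨h1, h2⟩
    have h3 := permLength_prod_le w
    rw [h1] at h3
    rcases lt_or_gt_of_ne (inv_castSucc_ne σ⁻¹ i) with h | h
    · have := permLength_simple_mul h; omega
    · have := permLength_simple_mul' h
      exact ⟨⟨h1, by omega⟩, h⟩
  · rintro ⟨⟨h1, h2⟩, h⟩
    have := permLength_simple_mul' h
    exact ⟨h1, by omega⟩

theorem simple_apply_of_ne {i : Fin m} {a : Fin (m + 1)} (h1 : (a : ℕ) ≠ i)
    (h2 : (a : ℕ) ≠ i + 1) : simple i a = a := by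
  rw [Fin.ext_iff, simple_val, if_neg h1, if_neg h2]

theorem simple_comm {i j : Fin m} (h : (i : ℕ) + 1 < j) :
    simple i * simple j = simple j * simple i := by
  rw [simple, simple, Equiv.mul_swap_eq_swap_mul, ← simple, simple_apply_of_ne,
    simple_apply_of_ne] <;> simp only [Fin.val_castSucc, Fin.val_succ] <;> omega

theorem simple_braid {i j : Fin m} (h : (i : ℕ) + 1 = j) :
    simple i * simple j * simple i = simple j * simple i * simple j := by
  have e0 : i.succ = j.castSucc := by
    rw [Fin.ext_iff, Fin.val_succ, Fin.val_castSucc]; exact h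
  have e1 : simple i j.castSucc = i.castSucc := by rw [← e0, simple_succ]
  have e2 : simple j i.succ = j.succ := by rw [e0, simple_castSucc]
  have e3 : simple i j.succ = j.succ := by
    apply simple_apply_of_ne <;> simp only [Fin.val_succ] <;> omega
  have e4 : simple j i.castSucc = i.castSucc := by
    apply simple_apply_of_ne <;> simp only [Fin.val_castSucc] <;> omega
  have h1 : simple i * simple j = Equiv.swap i.castSucc j.succ * simple i := by
    conv_lhs => rw [simple.eq_def j]
    rw [Equiv.mul_swap_eq_swap_mul, e1, e3]
  have h2 : simple j * simple i = Equiv.swap i.castSucc j.succ * simple j := by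
    conv_lhs => rw [simple.eq_def i]
    rw [Equiv.mul_swap_eq_swap_mul, e4, e2]
  rw [h1, h2, mul_assoc, mul_assoc, simple_mul_self, simple_mul_self]

/-- **Matsumoto's theorem** for the symmetric group: in a monoid, a family that satisfies the braid
relations takes the same product along any two reduced words of a permutation. -/
theorem prod_map_eq_of_isReducedWord {M : Type*} [Monoid M] (g : Fin m → M)
    (comm : ∀ i j : Fin m, (i : ℕ) + 1 < j → g i * g j = g j * g i)
    (braid : ∀ i j : Fin m, (i : ℕ) + 1 = j → g i * g j * g i = g j * g i * g j)
    {w w' : List (Fin m)} {σ : Equiv.Perm (Fin (m + 1))} (hw : IsReducedWord w σ)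
    (hw' : IsReducedWord w' σ) : (w.map g).prod = (w'.map g).prod := by
  induction hk : w.length using Nat.strong_induction_on generalizing w w' σ with
  | _ k ih =>
  have hlen : w.length = w'.length := by
    rw [(isReducedWord_iff.mp hw).2, (isReducedWord_iff.mp hw').2]
  match w, w', hw, hw', hlen with
  | [], [], _, _, _ => rfl
  | i :: u, j :: v, hw, hw', hlen =>
    simp only [List.length_cons, add_left_inj] at hlen hk
    -- the case of two different first letters, ordered
    have key : ∀ {i j : Fin m} {u v : List (Fin m)} {σ : Equiv.Perm (Fin (m + 1))}, i < j →
        IsReducedWord (i :: u) σ → IsReducedWord (j :: v) σ → u.length + 1 = k →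
        v.length + 1 = k → ((i :: u).map g).prod = ((j :: v).map g).prod := by
      intro i j u v σ hij hw hw' hu hv
      obtain ⟨hu', hi⟩ := isReducedWord_cons.mp hw
      obtain ⟨hv', hj⟩ := isReducedWord_cons.mp hw'
      simp only [List.map_cons, List.prod_cons]
      rcases (Nat.succ_le_of_lt (Fin.lt_def.mp hij)).lt_or_eq with hlt | heq
      -- Distant letters: both are left descents, so `σ` has the reduced words `i j r` and `j i r`
      -- with a common tail. The induction hypothesis compares `u` with `j r` and `v` with `i r`.
      · obtain ⟨r, hr⟩ := exists_reducedWord (simple j * (simple i * σ))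
        have e1 : simple i j.succ = j.succ := by
          apply simple_apply_of_ne <;> simp only [Fin.val_succ] <;> omega
        have e2 : simple i j.castSucc = j.castSucc := by
          apply simple_apply_of_ne <;> simp only [Fin.val_castSucc] <;> omega
        have e3 : simple j i.succ = i.succ := by
          apply simple_apply_of_ne <;> simp only [Fin.val_succ] <;> omega
        have e4 : simple j i.castSucc = i.castSucc := by
          apply simple_apply_of_ne <;> simp only [Fin.val_castSucc] <;> omega
        have h1 : IsReducedWord (j :: r) (simple i * σ) :=
          isReducedWord_cons.mpr ⟨hr, by
            simpa only [mul_inv_rev, simple_inv, Equiv.Perm.mul_apply, e1, e2] using hj⟩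
        have h2 : IsReducedWord (i :: r) (simple j * σ) :=
          isReducedWord_cons.mpr ⟨by rwa [← mul_assoc, simple_comm hlt, mul_assoc], by
            simpa only [mul_inv_rev, simple_inv, Equiv.Perm.mul_apply, e3, e4] using hi⟩
        rw [ih u.length (by omega) hu' h1 rfl, ih v.length (by omega) hv' h2 rfl,
          List.map_cons, List.prod_cons, List.map_cons, List.prod_cons, ← mul_assoc, ← mul_assoc,
          comm i j hlt]
      -- Adjacent letters: the two descents together say that `σ⁻¹` reverses three consecutive
      -- positions, so `σ` has the reduced words `i j i r` and `j i j r` with a common tail.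
      · obtain ⟨r, hr⟩ := exists_reducedWord (simple i * (simple j * (simple i * σ)))
        have e0 : i.succ = j.castSucc := by
          rw [Fin.ext_iff, Fin.val_succ, Fin.val_castSucc]; exact heq
        have e1 : simple i j.succ = j.succ := by
          apply simple_apply_of_ne <;> simp only [Fin.val_succ] <;> omega
        have e2 : simple i j.castSucc = i.castSucc := by rw [← e0, simple_succ]
        have e3 : simple j i.succ = j.succ := by rw [e0, simple_castSucc]
        have e4 : simple j i.castSucc = i.castSucc := by
          apply simple_apply_of_ne <;> simp only [Fin.val_castSucc] <;> omega
        have e5 : simple i i.castSucc = j.castSucc := by rw [simple_castSucc, e0]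
        have e6 : simple j j.castSucc = j.succ := simple_castSucc j
        have hij' : σ⁻¹ j.succ < σ⁻¹ i.castSucc := by
          rw [e0] at hi; exact hj.trans hi
        have h1 : IsReducedWord (j :: i :: r) (simple i * σ) := by
          refine isReducedWord_cons.mpr ⟨isReducedWord_cons.mpr ⟨hr, ?_⟩, ?_⟩
          · simpa only [mul_inv_rev, simple_inv, Equiv.Perm.mul_apply, e3, e4, e1, e5] using hj
          · simpa only [mul_inv_rev, simple_inv, Equiv.Perm.mul_apply, e1, e2] using hij'
        have h2 : IsReducedWord (i :: j :: r) (simple j * σ) := by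
          refine isReducedWord_cons.mpr ⟨isReducedWord_cons.mpr ⟨?_, ?_⟩, ?_⟩
          · have := simple_braid heq
            rw [← mul_assoc, ← mul_assoc] at hr ⊢
            rwa [← this]
          · rw [e0] at hi
            simpa only [mul_inv_rev, simple_inv, Equiv.Perm.mul_apply, e1, e2, e6, e4,
              simple_succ] using hi
          · simpa only [mul_inv_rev, simple_inv, Equiv.Perm.mul_apply, e3, e4] using hij'
        rw [ih u.length (by omega) hu' h1 rfl, ih v.length (by omega) hv' h2 rfl]
        simp only [List.map_cons, List.prod_cons, ← mul_assoc]
        rw [braid i j heq]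
    rcases lt_trichotomy i j with hij | rfl | hij
    · exact key hij hw hw' hk (by omega)
    · rw [List.map_cons, List.prod_cons, List.map_cons, List.prod_cons,
        ih u.length (by omega) (isReducedWord_cons.mp hw).1 (isReducedWord_cons.mp hw').1 rfl]
    · exact (key hij hw' hw (by omega) hk).symm

end Inversions

end

end NSMacdonald

namespace NSMacdonald

open MvPolynomial

noncomputable section

/-! ### Relations between the Demazure-Lustig operators and `ω` -/

section Operators

variable {K : Type*} [Field K] {m : ℕ}

theorem swapOp_mul (i : Fin m) (f g : MvPolynomial (Fin (m + 1)) K) :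
    swapOp i (f * g) = swapOp i f * swapOp i g := by
  simp [swapOp_apply]

theorem swapOp_C (i : Fin m) (c : K) :
    swapOp i (C c : MvPolynomial (Fin (m + 1)) K) = C c := by
  simp [swapOp_apply]

theorem swapOp_X (i : Fin m) (a : Fin (m + 1)) :
    swapOp i (X a : MvPolynomial (Fin (m + 1)) K) = X (simple i a) := by
  simp [swapOp_apply]

theorem swapOp_swapOp (i : Fin m) (f : MvPolynomial (Fin (m + 1)) K) :
    swapOp i (swapOp i f) = f := by
  rw [swapOp_apply, swapOp_apply, rename_rename]
  have : (simple i ∘ simple i : Fin (m + 1) → Fin (m + 1)) = id := by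
    funext k; simp
  rw [this, rename_id]; rfl

/-- The denominator-free form of `T_i`. Since the polynomial ring is a domain it determines `T_i f`,
and identities between the operators become polynomial identities. -/
theorem X_sub_X_mul_T (t : K) (i : Fin m) (f : MvPolynomial (Fin (m + 1)) K) :
    (X i.castSucc - X i.succ) * T t i f =
      (1 - C t) * X i.succ * f + (C t * X i.castSucc - X i.succ) * swapOp i f := by
  rw [T_apply]
  linear_combination (C t * X i.castSucc - X i.succ) * divDiff_spec i f

theorem eq_T_of_mul_eq {t : K} {i : Fin m} {f g : MvPolynomial (Fin (m + 1)) K}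
    (h : (X i.castSucc - X i.succ) * g =
      (1 - C t) * X i.succ * f + (C t * X i.castSucc - X i.succ) * swapOp i f) :
    T t i f = g := by
  apply mul_left_cancel₀ (X_sub_X_ne_zero (K := K) i)
  rw [X_sub_X_mul_T, h]

theorem T_mul_of_swapOp_eq {t : K} {i : Fin m} {p : MvPolynomial (Fin (m + 1)) K}
    (hp : swapOp i p = p) (f : MvPolynomial (Fin (m + 1)) K) :
    T t i (p * f) = p * T t i f := by
  apply eq_T_of_mul_eq
  rw [swapOp_mul, hp]
  linear_combination p * X_sub_X_mul_T t i f

/-- The common scalar of the two variables is a factor of both numerator and denominator of `(t x_i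
- x_{i+1})/(x_i - x_{i+1})` and cancels. Serves for permutations of the variables, for `ω` and for
`ω²`. -/
theorem map_T_of_map_X {t : K} {i j : Fin m}
    (φ : MvPolynomial (Fin (m + 1)) K →ₐ[K] MvPolynomial (Fin (m + 1)) K)
    (d : Fin (m + 1) → K) (π : Equiv.Perm (Fin (m + 1)))
    (hφ : ∀ a, φ (X a) = C (d a) * X (π a)) (hd : d i.castSucc = d i.succ) (h0 : d i.succ ≠ 0)
    (h1 : π i.castSucc = j.castSucc) (h2 : π i.succ = j.succ)
    (f : MvPolynomial (Fin (m + 1)) K) : φ (T t i f) = T t j (φ f) := by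
  have hs : ∀ f, φ (swapOp i f) = swapOp j (φ f) := by
    intro f
    have hc : π * simple i = simple j * π := by
      rw [simple, Equiv.mul_swap_eq_swap_mul, h1, h2, simple]
    have : φ.comp (rename (simple i)) = (rename (simple j)).comp φ := by
      refine MvPolynomial.algHom_ext fun a => ?_
      have e : π (simple i a) = simple j (π a) := congrArg (fun σ => σ a) hc
      have e' : d (simple i a) = d a := by
        unfold simple
        rw [Equiv.swap_apply_def]
        split_ifs with h3 h4
        · rw [h3, hd]
        · rw [h4, hd]
        · rfl
      simp [hφ, e, e']
    exact DFunLike.congr_fun this f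
  symm
  apply eq_T_of_mul_eq
  have hC : ∀ c : K, φ (C c) = C c := fun c => φ.commutes c
  have h := congrArg φ (X_sub_X_mul_T t i f)
  simp only [map_mul, map_add, map_sub, map_one, hφ, hd, h1, h2, hC, hs] at h
  apply mul_left_cancel₀ (C_ne_zero.mpr h0 : (C (d i.succ) : MvPolynomial (Fin (m + 1)) K) ≠ 0)
  linear_combination h

/-- All coefficients in the relation that characterises `T_j` are fixed by `s_i`, so `T_i` passes
through that relation. -/
theorem T_comm {t : K} {i j : Fin m} (h : (i : ℕ) + 1 < j) : T t i * T t j = T t j * T t i := by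
  refine LinearMap.ext fun f => ?_
  have e1 : simple j i.castSucc = i.castSucc := by
    apply simple_apply_of_ne <;> simp only [Fin.val_castSucc] <;> omega
  have e2 : simple j i.succ = i.succ := by
    apply simple_apply_of_ne <;> simp only [Fin.val_succ] <;> omega
  have e3 : simple i j.castSucc = j.castSucc := by
    apply simple_apply_of_ne <;> simp only [Fin.val_castSucc] <;> omega
  have e4 : simple i j.succ = j.succ := by
    apply simple_apply_of_ne <;> simp only [Fin.val_succ] <;> omega
  have hs : ∀ g, swapOp j (T t i g) = T t i (swapOp j g) := fun g =>
    map_T_of_map_X (rename (simple j)) (fun _ => 1) (simple j) (fun a => by simp) rfl one_ne_zero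
      e1 e2 g
  rw [Module.End.mul_apply, Module.End.mul_apply]
  symm
  apply eq_T_of_mul_eq
  have f1 : swapOp i (X j.castSucc - X j.succ : MvPolynomial (Fin (m + 1)) K)
      = X j.castSucc - X j.succ := by
    rw [map_sub, swapOp_X, swapOp_X, e3, e4]
  have f2 : swapOp i ((1 - C t) * X j.succ : MvPolynomial (Fin (m + 1)) K)
      = (1 - C t) * X j.succ := by
    rw [← C_1, ← C_sub, swapOp_mul, swapOp_C, swapOp_X, e4]
  have f3 : swapOp i (C t * X j.castSucc - X j.succ : MvPolynomial (Fin (m + 1)) K)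
      = C t * X j.castSucc - X j.succ := by
    rw [map_sub, swapOp_mul, swapOp_C, swapOp_X, swapOp_X, e3, e4]
  rw [hs, ← T_mul_of_swapOp_eq f1, ← T_mul_of_swapOp_eq f2, ← T_mul_of_swapOp_eq f3, ← map_add,
    X_sub_X_mul_T]

/-- Both sides are combinations of the six permuted copies of `f` under `s_i` and `s_j`. With
denominators cleared, the relation is a polynomial identity in the three variables and `t`, once
`s_i s_j s_i f = s_j s_i s_j f` is used. -/
theorem T_braid {t : K} {i j : Fin m} (h : (i : ℕ) + 1 = j) :
    T t i * T t j * T t i = T t j * T t i * T t j := by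
  refine LinearMap.ext fun f => ?_
  have e0 : j.castSucc = i.succ := by
    rw [Fin.ext_iff, Fin.val_succ, Fin.val_castSucc]; exact h.symm
  have e3 : simple i j.succ = j.succ := by
    apply simple_apply_of_ne <;> simp only [Fin.val_succ] <;> omega
  have e4 : simple j i.castSucc = i.castSucc := by
    apply simple_apply_of_ne <;> simp only [Fin.val_castSucc] <;> omega
  have hsrs : swapOp j (swapOp i (swapOp j f)) = swapOp i (swapOp j (swapOp i f)) := by
    simp only [swapOp_apply, rename_rename]
    congr 2
    have := congrArg (fun σ : Equiv.Perm (Fin (m + 1)) => (σ : Fin (m + 1) → Fin (m + 1)))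
      (simple_braid h)
    simpa [Equiv.Perm.coe_mul, Function.comp_assoc] using this.symm
  simp only [Module.End.mul_apply]
  have a1 : ∀ g : MvPolynomial (Fin (m + 1)) K, (X i.castSucc - X i.succ) * T t i g =
      (1 - C t) * X i.succ * g + (C t * X i.castSucc - X i.succ) * swapOp i g :=
    X_sub_X_mul_T t i
  have b1 : ∀ g : MvPolynomial (Fin (m + 1)) K, (X i.succ - X j.succ) * T t j g =
      (1 - C t) * X j.succ * g + (C t * X i.succ - X j.succ) * swapOp j g := by
    intro g; rw [← e0]; exact X_sub_X_mul_T t j g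
  have e1 : simple j i.succ = j.succ := by rw [← e0, simple_castSucc]
  have e2 : simple j j.succ = i.succ := by rw [← e0, simple_succ]
  -- images of the defining relations under the permutations of the variables
  have a2 : ∀ g : MvPolynomial (Fin (m + 1)) K,
      (X i.castSucc - X j.succ) * swapOp j (T t i g) =
      (1 - C t) * X j.succ * swapOp j g
        + (C t * X i.castSucc - X j.succ) * swapOp j (swapOp i g) := by
    intro g
    have := congrArg (swapOp j) (a1 g)
    rw [← C_1, ← C_sub] at this
    simp only [swapOp_mul, map_add, map_sub, swapOp_C, swapOp_X, e1, e4] at this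
    rw [C_1] at this
    exact this
  have a3 : ∀ g : MvPolynomial (Fin (m + 1)) K,
      (X i.succ - X i.castSucc) * swapOp i (T t i g) =
      (1 - C t) * X i.castSucc * swapOp i g + (C t * X i.succ - X i.castSucc) * g := by
    intro g
    have := congrArg (swapOp i) (a1 g)
    rw [← C_1, ← C_sub] at this
    simp only [swapOp_mul, map_add, map_sub, swapOp_C, swapOp_X, swapOp_swapOp, simple_castSucc,
      simple_succ] at this
    rw [C_1] at this
    exact this
  have b2 : ∀ g : MvPolynomial (Fin (m + 1)) K,
      (X i.castSucc - X j.succ) * swapOp i (T t j g) =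
      (1 - C t) * X j.succ * swapOp i g
        + (C t * X i.castSucc - X j.succ) * swapOp i (swapOp j g) := by
    intro g
    have := congrArg (swapOp i) (b1 g)
    rw [← C_1, ← C_sub] at this
    simp only [swapOp_mul, map_add, map_sub, swapOp_C, swapOp_X, simple_succ, e3] at this
    rw [C_1] at this
    exact this
  have b3 : ∀ g : MvPolynomial (Fin (m + 1)) K,
      (X j.succ - X i.succ) * swapOp j (T t j g) =
      (1 - C t) * X i.succ * swapOp j g + (C t * X j.succ - X i.succ) * g := by
    intro g
    have := congrArg (swapOp j) (b1 g)
    rw [← C_1, ← C_sub] at this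
    simp only [swapOp_mul, map_add, map_sub, swapOp_C, swapOp_X, swapOp_swapOp, e1, e2] at this
    rw [C_1] at this
    exact this
  have a4 : (X i.succ - X j.succ) * swapOp i (swapOp j (T t i f)) =
      (1 - C t) * X j.succ * swapOp i (swapOp j f)
        + (C t * X i.succ - X j.succ) * swapOp i (swapOp j (swapOp i f)) := by
    have := congrArg (swapOp i) (a2 f)
    rw [← C_1, ← C_sub] at this
    simp only [swapOp_mul, map_add, map_sub, swapOp_C, swapOp_X, simple_castSucc, e3] at this
    rw [C_1] at this
    exact this
  have b4 : (X i.castSucc - X i.succ) * swapOp j (swapOp i (T t j f)) =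
      (1 - C t) * X i.succ * swapOp j (swapOp i f)
        + (C t * X i.castSucc - X i.succ) * swapOp i (swapOp j (swapOp i f)) := by
    have := congrArg (swapOp j) (b2 f)
    rw [← C_1, ← C_sub] at this
    simp only [swapOp_mul, map_add, map_sub, swapOp_C, swapOp_X, hsrs, e2, e4] at this
    rw [C_1] at this
    exact this
  have A1 := a1 f
  have A2 := a2 f
  have A3 := a3 f
  have B1 := b1 f
  have B2 := b2 f
  have B3 := b3 f
  have U := b1 (T t i f)
  have U' := a1 (T t j f)
  have SU := b2 (T t i f)
  have SU' := a2 (T t j f)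
  have V := a1 (T t j (T t i f))
  have V' := b1 (T t i (T t j f))
  -- From here all polynomials are free unknowns in a domain, tied only by the linear relations
  -- collected above; `hU`, `hSU`, `hU'`, `hSU'` eliminate the intermediate ones.
  generalize swapOp i (T t j (T t i f)) = su at *
  generalize swapOp j (T t i (T t j f)) = su' at *
  generalize T t i (T t j (T t i f)) = v at *
  generalize T t j (T t i (T t j f)) = v' at *
  generalize swapOp i (swapOp j (T t i f)) = srp at *
  generalize swapOp j (swapOp i (T t j f)) = srp' at *
  generalize T t j (T t i f) = u at *
  generalize T t i (T t j f) = u' at *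
  generalize swapOp i (T t i f) = sp at *
  generalize swapOp j (T t i f) = rp at *
  generalize swapOp i (T t j f) = sp' at *
  generalize swapOp j (T t j f) = rp' at *
  generalize T t i f = p at *
  generalize T t j f = p' at *
  generalize swapOp i (swapOp j (swapOp i f)) = srsf at *
  generalize swapOp i (swapOp j f) = srf at *
  generalize swapOp j (swapOp i f) = rsf at *
  generalize swapOp i f = sf at *
  generalize swapOp j f = rf at *
  have n1 : (X i.castSucc - X i.succ : MvPolynomial (Fin (m + 1)) K) ≠ 0 := X_sub_X_ne_zero i
  have n2 : (X i.succ - X j.succ : MvPolynomial (Fin (m + 1)) K) ≠ 0 := by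
    rw [← e0]; exact X_sub_X_ne_zero j
  have n3 : (X i.castSucc - X j.succ : MvPolynomial (Fin (m + 1)) K) ≠ 0 := by
    intro hh
    have := X_injective (R := K) (sub_eq_zero.mp hh)
    rw [Fin.ext_iff, Fin.val_castSucc, Fin.val_succ] at this
    omega
  generalize (X i.castSucc : MvPolynomial (Fin (m + 1)) K) = x at *
  generalize (X i.succ : MvPolynomial (Fin (m + 1)) K) = y at *
  generalize (X j.succ : MvPolynomial (Fin (m + 1)) K) = z at *
  generalize (C t : MvPolynomial (Fin (m + 1)) K) = c at *
  have hU : (x - y) * (x - z) * ((y - z) * u) =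
      (1 - c) * z * (x - z) * ((1 - c) * y * f + (c * x - y) * sf)
        + (c * y - z) * (x - y) * ((1 - c) * z * rf + (c * x - z) * rsf) := by
    linear_combination (x - y) * (x - z) * U + (1 - c) * z * (x - z) * A1
      + (c * y - z) * (x - y) * A2
  have hSU : (x - y) * (y - z) * ((x - z) * su) =
      -((1 - c) * z * (y - z) * ((1 - c) * x * sf + (c * y - x) * f))
        + (c * x - z) * (x - y) * ((1 - c) * z * srf + (c * y - z) * srsf) := by
    linear_combination (x - y) * (y - z) * SU - (1 - c) * z * (y - z) * A3
      + (c * x - z) * (x - y) * a4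
  have hU' : (y - z) * (x - z) * ((x - y) * u') =
      (1 - c) * y * (x - z) * ((1 - c) * z * f + (c * y - z) * rf)
        + (c * x - y) * (y - z) * ((1 - c) * z * sf + (c * x - z) * srf) := by
    linear_combination (y - z) * (x - z) * U' + (1 - c) * y * (x - z) * B1
      + (c * x - y) * (y - z) * B2
  have hSU' : (y - z) * (x - y) * ((x - z) * su') =
      -((1 - c) * z * (x - y) * ((1 - c) * y * rf + (c * z - y) * f))
        + (c * x - z) * (y - z) * ((1 - c) * y * rsf + (c * x - y) * srsf) := by
    linear_combination (y - z) * (x - y) * SU' - (1 - c) * z * (x - y) * B3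
      + (c * x - z) * (y - z) * b4
  apply mul_left_cancel₀ (mul_ne_zero (mul_ne_zero (mul_ne_zero n1 n1) (mul_ne_zero n2 n2)) n3)
  linear_combination (x - y) * (y - z) ^ 2 * (x - z) * V
    + (y - z) * ((1 - c) * y * hU + (c * x - y) * hSU)
    - (x - y) ^ 2 * (y - z) * (x - z) * V'
    - (x - y) * ((1 - c) * z * hU' + (c * y - z) * hSU')

end Operators

end

end NSMacdonald

namespace NSMacdonald

noncomputable section

/-! ### The commutation relations of an affine Hecke algebra -/

section AffineHecke

variable {A : Type*} [Ring A] (g : ℕ → Aˣ) (w : A)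

/-- `g_i g_{i+1} ⋯ g_{m-1}`. -/
def upWord (m i : ℕ) : Aˣ := ((List.range' i (m - i)).map g).prod

/-- `g_0⁻¹ g_1⁻¹ ⋯ g_{i-1}⁻¹`. -/
def downWord (i : ℕ) : Aˣ := ((List.range i).map fun k => (g k)⁻¹).prod

/-- `g_i ⋯ g_{m-1} w g_0⁻¹ ⋯ g_{i-1}⁻¹`. -/
def cherednik (m i : ℕ) : A := upWord g m i * w * downWord g i

variable {m : ℕ}

theorem upWord_self : upWord g m m = 1 := by simp [upWord]

theorem upWord_eq {i : ℕ} (h : i < m) : upWord g m i = g i * upWord g m (i + 1) := by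
  unfold upWord
  obtain ⟨k, rfl⟩ : ∃ k, m = i + 1 + k := ⟨m - (i + 1), by omega⟩
  have h1 : i + 1 + k - i = k + 1 := by omega
  have h2 : i + 1 + k - (i + 1) = k := by omega
  rw [h1, h2, List.range'_succ, List.map_cons, List.prod_cons]

theorem downWord_zero : downWord g 0 = 1 := by simp [downWord]

theorem downWord_succ (i : ℕ) : downWord g (i + 1) = downWord g i * (g i)⁻¹ := by
  simp [downWord, List.range_succ]

/-- The recursion behind the downward inductions: whatever commutes with `g_i` and with the element
of index `i + 1` commutes with the element of index `i`. -/
theorem cherednik_eq {i : ℕ} (h : i < m) :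
    cherednik g w m i = g i * cherednik g w m (i + 1) * g i := by
  unfold cherednik
  rw [downWord_succ, upWord_eq g h]
  simp [mul_assoc]

variable {g w} (comm : ∀ i j, i + 1 < j → j < m → Commute (g i) (g j))
  (braid : ∀ i, i + 1 < m → g i * g (i + 1) * g i = g (i + 1) * g i * g (i + 1))

include comm in
theorem commute_upWord {i j : ℕ} (h : i + 1 < j) : Commute (g i) (upWord g m j) := by
  unfold upWord
  refine Commute.list_prod_right _ _ fun x hx => ?_
  obtain ⟨k, hk, rfl⟩ := List.mem_map.mp hx
  rw [List.mem_range'_1] at hk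
  exact comm i k (by omega) (by omega)

include comm in
theorem commute_downWord {i j : ℕ} (h : j < i) (hi : i < m) : Commute (g i) (downWord g j) := by
  unfold downWord
  refine Commute.list_prod_right _ _ fun x hx => ?_
  obtain ⟨k, hk, rfl⟩ := List.mem_map.mp hx
  rw [List.mem_range] at hk
  exact (comm k i (by omega) hi).symm.inv_right

include comm braid in
-- The letter `g_{i+1}` commutes past everything before `g_i g_{i+1}`, where the braid relation
-- turns it into `g_i`, which commutes with the rest.
theorem mul_upWord {i j : ℕ} (h : j ≤ i) (hi : i + 1 < m) :
    g (i + 1) * upWord g m j = upWord g m j * g i := by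
  induction h using Nat.decreasingInduction with
  | self =>
    rw [upWord_eq g (by omega), upWord_eq g hi]
    have h1 := commute_upWord (m := m) comm (i := i) (j := i + 1 + 1) (by omega)
    calc g (i + 1) * (g i * (g (i + 1) * upWord g m (i + 1 + 1)))
        = g (i + 1) * g i * g (i + 1) * upWord g m (i + 1 + 1) := by simp only [mul_assoc]
      _ = g i * g (i + 1) * (g i * upWord g m (i + 1 + 1)) := by
        rw [← braid i hi]; simp only [mul_assoc]
      _ = _ := by rw [h1.eq]; simp only [mul_assoc]
  | of_succ k hk ih =>
    rw [upWord_eq g (show k < m by omega), ← mul_assoc, ← (comm k (i + 1) (by omega) hi).eq,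
      mul_assoc, ih, mul_assoc]

include braid in
theorem mul_inv_mul_inv {i : ℕ} (hi : i + 1 < m) :
    g (i + 1) * ((g i)⁻¹ * (g (i + 1))⁻¹) = (g i)⁻¹ * (g (i + 1))⁻¹ * g i := by
  -- The braid relation, multiplied on the left so that only positive letters have to be exchanged.
  have h : g (i + 1) * g i * (g (i + 1) * ((g i)⁻¹ * (g (i + 1))⁻¹)) = g i := by
    calc _ = g (i + 1) * g i * g (i + 1) * ((g i)⁻¹ * (g (i + 1))⁻¹) := by group
      _ = g i * g (i + 1) * g i * ((g i)⁻¹ * (g (i + 1))⁻¹) := by rw [← braid i hi]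
      _ = g i := by group
  rw [← mul_right_inj (g (i + 1) * g i), h]
  group

include braid in
theorem mul_inv_mul_inv' {i : ℕ} (hi : i + 1 < m) :
    g i * ((g (i + 1))⁻¹ * (g i)⁻¹) = (g (i + 1))⁻¹ * (g i)⁻¹ * g (i + 1) := by
  have h : g i * g (i + 1) * (g i * ((g (i + 1))⁻¹ * (g i)⁻¹)) = g (i + 1) := by
    calc _ = g i * g (i + 1) * g i * ((g (i + 1))⁻¹ * (g i)⁻¹) := by group
      _ = g (i + 1) * g i * g (i + 1) * ((g (i + 1))⁻¹ * (g i)⁻¹) := by rw [← braid i hi]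
      _ = g (i + 1) := by group
  rw [← mul_right_inj (g i * g (i + 1)), h]
  group

include comm braid in
theorem mul_downWord {i j : ℕ} (h : i + 1 < j) (hj : j ≤ m) :
    g (i + 1) * downWord g j = downWord g j * g i := by
  induction j, h using Nat.le_induction with
  | base =>
    rw [downWord_succ, downWord_succ, mul_assoc (downWord g i), ← mul_assoc,
      (commute_downWord comm (show i < i + 1 by omega) (by omega)).eq, mul_assoc,
      mul_inv_mul_inv braid (by omega), mul_assoc (downWord g i)]
  | succ k hk ih =>
    rw [downWord_succ, ← mul_assoc, ih (by omega), mul_assoc, mul_assoc,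
      (comm i k (by omega) (by omega)).inv_right.eq]

variable (shift : ∀ i, i + 1 < m → g i * w = w * g (i + 1))

include comm braid shift in
-- The letter `g_i` becomes `g_{i-1}` on passing the up word, returns to `g_i` on passing `w`, and
-- commutes with every letter of the down word.
theorem commute_cherednik_of_lt {i j : ℕ} (h : j < i) (hi : i < m) :
    Commute (g i : A) (cherednik g w m j) := by
  obtain ⟨i, rfl⟩ : ∃ k, i = k + 1 := ⟨i - 1, by omega⟩
  have h1 := congrArg Units.val (mul_upWord comm braid (Nat.le_of_lt_succ h) hi)
  have h2 := congrArg Units.val (commute_downWord comm h hi).eq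
  push_cast at h1 h2
  unfold Commute SemiconjBy cherednik
  rw [← mul_assoc, ← mul_assoc, h1, mul_assoc _ (g i : A), shift i hi, mul_assoc _ _ (g (i + 1) : A),
    ← h2]
  simp only [mul_assoc]

include comm braid shift in
-- Here `g_i` commutes with the up word, becomes `g_{i+1}` on passing `w`, and the down word turns
-- it back into `g_i`.
theorem commute_cherednik_of_gt {i j : ℕ} (h : i + 1 < j) (hj : j ≤ m) :
    Commute (g i : A) (cherednik g w m j) := by
  have h1 := congrArg Units.val (commute_upWord (m := m) comm h).eq
  have h2 := congrArg Units.val (mul_downWord comm braid h hj)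
  push_cast at h1 h2
  unfold Commute SemiconjBy cherednik
  rw [← mul_assoc, ← mul_assoc, h1, mul_assoc _ (g i : A), shift i (by omega),
    mul_assoc _ _ (g i : A), ← h2]
  simp only [mul_assoc]

include comm braid in
-- With `D` the down word, `(w D)²` equals `w² D' D`, where `D'` is `D` with indices raised by one.
-- The letter `g_k` passes `w²` as `g_0`, and this lemma restores it to `g_k`.
theorem mul_shifted_downWord {k : ℕ} (hk : k < m) :
    g 0 * (((List.range k).map fun i => (g (i + 1))⁻¹).prod * downWord g k) =
      ((List.range k).map fun i => (g (i + 1))⁻¹).prod * downWord g k * g k := by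
  induction k with
  | zero => simp [downWord_zero]
  | succ k ih =>
    have h1 := (commute_downWord comm (show k < k + 1 by omega) hk).inv_left.eq
    -- The new letter of the shifted word commutes with the shorter down word, so the two new
    -- letters can be collected at the right end.
    have e : ((List.range (k + 1)).map fun i => (g (i + 1))⁻¹).prod * downWord g (k + 1) =
        ((List.range k).map fun i => (g (i + 1))⁻¹).prod * downWord g k *
          ((g (k + 1))⁻¹ * (g k)⁻¹) := by
      rw [List.range_succ, List.map_append, List.prod_append, downWord_succ]
      simp only [List.map_cons, List.map_nil, List.prod_cons, List.prod_nil, mul_one]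
      rw [mul_assoc, ← mul_assoc (g (k + 1))⁻¹, h1]
      simp only [mul_assoc]
    rw [e, ← mul_assoc (g 0), ih (by omega), mul_assoc _ (g k), mul_inv_mul_inv' braid hk]
    simp only [mul_assoc]

include shift in
theorem downWord_mul {k : ℕ} (hk : k < m) :
    (downWord g k : A) * w = w * (((List.range k).map fun i => (g (i + 1))⁻¹).prod : Aˣ) := by
  induction k with
  | zero => simp [downWord_zero]
  | succ k ih =>
    rw [downWord_succ, List.range_succ, List.map_append, List.prod_append]
    simp only [List.map_cons, List.map_nil, List.prod_cons, List.prod_nil, mul_one]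
    have h1 : ((g k)⁻¹ : Aˣ) * w = w * ((g (k + 1))⁻¹ : Aˣ) := by
      rw [Units.inv_mul_eq_iff_eq_mul, ← mul_assoc, shift k hk, mul_assoc, Units.mul_inv, mul_one]
    push_cast at ih h1 ⊢
    rw [mul_assoc, h1, ← mul_assoc, ih (by omega), mul_assoc]

variable (shift₂ : 0 < m → (g (m - 1) : A) * (w * w) = w * w * g 0)

include comm braid shift shift₂ in
-- With `Q = w D_k` the two elements are `Q g_k⁻¹` and `g_k Q`. Their products are `Q²` and `g_k Q²
-- g_k⁻¹`, so the claim is that `g_k` commutes with `Q²`.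
theorem commute_cherednik_last_pred {k : ℕ} (hk : k + 1 = m) :
    Commute (cherednik g w m m) (cherednik g w m k) := by
  subst hk
  have e1 : cherednik g w (k + 1) (k + 1) = w * downWord g k * ((g k)⁻¹ : Aˣ) := by
    unfold cherednik
    rw [upWord_self, downWord_succ]
    simp [mul_assoc]
  have e2 : cherednik g w (k + 1) k = g k * (w * downWord g k) := by
    unfold cherednik
    rw [upWord_eq g (by omega), upWord_self]
    simp [mul_assoc]
  have e3 : Commute (g k : A) (w * downWord g k * (w * downWord g k)) := by
    have h1 : w * downWord g k * (w * downWord g k) = w * w *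
        ((((List.range k).map fun i => (g (i + 1))⁻¹).prod * downWord g k : Aˣ) : A) := by
      rw [mul_assoc, ← mul_assoc (downWord g k : A), downWord_mul shift (by omega)]
      simp only [mul_assoc, Units.val_mul]
    have h2 := congrArg Units.val (mul_shifted_downWord comm braid (show k < k + 1 by omega))
    have h3 := shift₂ (by omega)
    rw [Nat.add_sub_cancel] at h3
    unfold Commute SemiconjBy
    rw [h1, ← mul_assoc, h3, mul_assoc, ← Units.val_mul, h2]
    simp only [mul_assoc, Units.val_mul]
  have h4 : w * downWord g k * ((g k)⁻¹ : Aˣ) * (g k * (w * downWord g k)) =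
      w * downWord g k * (w * downWord g k) := by
    rw [← mul_assoc, mul_assoc _ _ (g k : A), Units.inv_mul, mul_one]
  unfold Commute SemiconjBy
  rw [e1, e2, h4]
  calc w * downWord g k * (w * downWord g k)
      = g k * (w * downWord g k * (w * downWord g k)) * ((g k)⁻¹ : Aˣ) := by
        rw [e3.eq, mul_assoc _ (g k : A), Units.mul_inv, mul_one]
    _ = _ := by simp only [mul_assoc]

include comm braid shift shift₂ in
theorem commute_cherednik_last {j : ℕ} (hj : j ≤ m) :
    Commute (cherednik g w m m) (cherednik g w m j) := by
  induction hj using Nat.decreasingInduction with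
  | self => exact Commute.refl _
  | of_succ k hk ih =>
    rcases (Nat.succ_le_of_lt hk).lt_or_eq with h | h
    · have h1 := (commute_cherednik_of_gt comm braid shift h le_rfl).symm
      rw [cherednik_eq g w hk]
      exact (h1.mul_right ih).mul_right h1
    · exact commute_cherednik_last_pred comm braid shift shift₂ h

variable {K : Type*} [Field K] [Algebra K A] {t : K} (ht : t ≠ 0)
  (quad : ∀ i < m, (g i : A) * g i = (t - 1) • (g i : A) + t • 1)

include comm braid shift ht quad in
-- All terms except those of index `k` and `k + 1` commute with `g_k` separately. With `y` the
-- element of index `k + 1`, the other two sum to a multiple of `g_k y g_k + t y`, which commutes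
-- with `g_k` by the quadratic relation.
theorem commute_sum_cherednik {k : ℕ} (hk : k < m) :
    Commute (g k : A) (∑ i ∈ Finset.range (m + 1), t ^ (i : ℤ) • cherednik g w m i) := by
  rw [commute_iff_lie_eq, Ring.lie_def, Finset.mul_sum, Finset.sum_mul, ← Finset.sum_sub_distrib,
    Finset.sum_eq_add k (k + 1) (by omega)]
  · rw [cherednik_eq g w hk]
    generalize cherednik g w m (k + 1) = y
    have h := quad k hk
    generalize (g k : A) = x at *
    have h1 : x * (x * y * x) = (t - 1) • (x * y * x) + t • (y * x) := by
      rw [← mul_assoc, ← mul_assoc, h]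
      simp only [add_mul, smul_mul_assoc, one_mul]
    have h2 : x * y * x * x = (t - 1) • (x * y * x) + t • (x * y) := by
      rw [mul_assoc, h]
      simp only [mul_add, mul_smul_comm, mul_one, mul_assoc]
    rw [mul_smul_comm, smul_mul_assoc, h1, h2, mul_smul_comm, smul_mul_assoc, Nat.cast_add,
      Nat.cast_one, zpow_add₀ ht, zpow_one]
    module
  · intro j hj hne
    rw [Finset.mem_range] at hj
    rw [mul_smul_comm, smul_mul_assoc, sub_eq_zero]
    congr 1
    rcases lt_or_gt_of_ne hne.1 with h | h
    · exact (commute_cherednik_of_lt comm braid shift h hk).eq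
    · exact (commute_cherednik_of_gt comm braid shift (by omega) (by omega)).eq
  · intro h; exact absurd (Finset.mem_range.mpr (by omega)) h
  · intro h; exact absurd (Finset.mem_range.mpr (by omega)) h

include comm braid shift shift₂ ht quad in
-- Only the last element is compared with every summand. The recursion `cherednik_eq` then carries
-- commutation with the whole sum downwards, since the sum also commutes with every `g_k`.
theorem commute_cherednik_sum {j : ℕ} (hj : j ≤ m) :
    Commute (cherednik g w m j)
      (∑ i ∈ Finset.range (m + 1), t ^ (i : ℤ) • cherednik g w m i) := by
  induction hj using Nat.decreasingInduction with
  | self =>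
    refine Commute.sum_right _ _ _ fun i hi => Commute.smul_right ?_ _
    exact commute_cherednik_last comm braid shift shift₂ (by
      rw [Finset.mem_range] at hi; omega)
  | of_succ k hk ih =>
    have h := commute_sum_cherednik comm braid shift ht quad hk
    rw [cherednik_eq g w hk]
    exact (h.mul_left ih).mul_left h

end AffineHecke

end

end NSMacdonald

namespace NSMacdonald

open MvPolynomial

noncomputable section

/-! ### The Cherednik operators and the symmetrizers -/

section Cherednik

variable {K : Type*} [Field K] {m : ℕ}

theorem T_mul_T (t : K) (i : Fin m) : T t i * T t i = (t - 1) • T t i + t • 1 := by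
  have h : T t i * T t i = (T t i - t • 1) * (T t i + 1) + ((t - 1) • T t i + t • 1) := by
    simp only [sub_mul, mul_add, mul_one, smul_mul_assoc, one_mul]
    module
  rw [h, T_quadratic, zero_add]

theorem Tinv_mul_T {t : K} (ht : t ≠ 0) (i : Fin m) : Tinv t i * T t i = 1 := by
  rw [← T_mul_Tinv ht i]
  unfold Tinv
  simp only [add_mul, mul_add, smul_mul_assoc, mul_smul_comm, one_mul, mul_one]

/-- The Demazure-Lustig operator as a unit of the ring of operators. -/
def TUnit {t : K} (ht : t ≠ 0) (i : Fin m) : (Module.End K (MvPolynomial (Fin (m + 1)) K))ˣ where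
  val := T t i
  inv := Tinv t i
  val_inv := T_mul_Tinv ht i
  inv_val := Tinv_mul_T ht i

/-- The Demazure-Lustig operators indexed by the natural numbers, continued by `1`. -/
def TNat (m : ℕ) {t : K} (ht : t ≠ 0) (k : ℕ) : (Module.End K (MvPolynomial (Fin (m + 1)) K))ˣ :=
  if h : k < m then TUnit ht ⟨k, h⟩ else 1

theorem TNat_val {t : K} (ht : t ≠ 0) (i : Fin m) :
    (TNat m ht i : Module.End K (MvPolynomial (Fin (m + 1)) K)) = T t i := by
  simp [TNat, TUnit]

theorem TNat_inv_val {t : K} (ht : t ≠ 0) (i : Fin m) :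
    ((TNat m ht i)⁻¹ : (Module.End K (MvPolynomial (Fin (m + 1)) K))ˣ) = Tinv t i := by
  simp [TNat, TUnit]

theorem map_filter_finRange {M : Type*} (p : ℕ → Prop) [DecidablePred p] (f : Fin m → M)
    (F : ℕ → M) (hF : ∀ i : Fin m, F i = f i) :
    ((List.finRange m).filter fun k : Fin m => p k).map f = ((List.range m).filter fun k => p k).map F := by
  rw [← List.map_coe_finRange_eq_range, List.filter_map, List.map_map]
  exact List.map_congr_left fun i _ => (hF i).symm

theorem range_filter_le (i : ℕ) (h : i ≤ m) :
    ((List.range m).filter fun k => i ≤ k) = List.range' i (m - i) := by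
  obtain ⟨k, rfl⟩ := Nat.exists_eq_add_of_le h
  rw [List.range_add, List.filter_append, List.range'_eq_map_range, Nat.add_sub_cancel_left,
    List.filter_eq_nil_iff.mpr, List.filter_eq_self.mpr, List.nil_append]
  · simp
  · simp

theorem range_filter_lt (i : ℕ) (h : i ≤ m) :
    ((List.range m).filter fun k => k < i) = List.range i := by
  obtain ⟨k, rfl⟩ := Nat.exists_eq_add_of_le h
  rw [List.range_add, List.filter_append, List.filter_eq_self.mpr, List.filter_eq_nil_iff.mpr,
    List.append_nil]
  · simp
  · simp

theorem Y_eq_cherednik (q : K) {t : K} (ht : t ≠ 0) (i : Fin (m + 1)) :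
    Y q t i = t ^ ((i : ℤ) - (m : ℤ)) • cherednik (TNat m ht) (omega m q) m i := by
  have hi : (i : ℕ) ≤ m := Nat.le_of_lt_succ i.2
  have h1 := map_filter_finRange (m := m) (fun k => (i : ℕ) ≤ k) (T t)
    (fun k => (TNat m ht k : Module.End K _)) (TNat_val ht)
  have h2 := map_filter_finRange (m := m) (fun k => k < (i : ℕ)) (Tinv t)
    (fun k => ((TNat m ht k)⁻¹ : (Module.End K (MvPolynomial (Fin (m + 1)) K))ˣ)) (TNat_inv_val ht)
  rw [range_filter_le _ hi] at h1
  rw [range_filter_lt _ hi] at h2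
  unfold Y cherednik upWord downWord
  congr 1
  congr 1
  · congr 1
    rw [← Units.coeHom_apply, map_list_prod, List.map_map]
    exact congrArg List.prod h1
  · rw [← Units.coeHom_apply, map_list_prod, List.map_map]
    exact congrArg List.prod h2

/-- The algebra endomorphism `ω`. -/
def omegaHom (m : ℕ) (q : K) : MvPolynomial (Fin (m + 1)) K →ₐ[K] MvPolynomial (Fin (m + 1)) K :=
  (rename (finRotate (m + 1)).symm).comp
    (aeval fun j => if j = 0 then C q * X j else X j)

theorem prod_map_swapOp (l : List (Fin m)) :
    (l.map swapOp).prod =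
      (rename ((l.map simple).prod : Equiv.Perm (Fin (m + 1))) :
        MvPolynomial (Fin (m + 1)) K →ₐ[K] MvPolynomial (Fin (m + 1)) K).toLinearMap := by
  induction l with
  | nil =>
    refine LinearMap.ext fun f => ?_
    simp
  | cons i l ih =>
    rw [List.map_cons, List.prod_cons, ih, List.map_cons, List.prod_cons]
    refine LinearMap.ext fun f => ?_
    simp [swapOp, rename_rename, Equiv.Perm.coe_mul]

theorem prod_map_simple_finRange :
    ((List.finRange m).map simple).prod = finRotate (m + 1) := by
  induction m with
  | zero => ext a; simp
  | succ m ih =>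
    -- All factors but the last one fix the last position and act on the others as the smaller
    -- cycle.
    have h : ∀ a, ((List.finRange m).map fun i => simple (Fin.castSucc i)).prod (Fin.castSucc a)
        = Fin.castSucc (((List.finRange m).map simple).prod a) := by
      generalize List.finRange m = l
      induction l with
      | nil => simp
      | cons i l ih' =>
        intro a
        simp only [List.map_cons, List.prod_cons, Equiv.Perm.mul_apply, ih']
        ext
        simp [simple_val]
    have h' : ((List.finRange m).map fun i => simple (Fin.castSucc i)).prod (Fin.last (m + 1))
        = Fin.last (m + 1) := by
      generalize List.finRange m = l
      induction l with
      | nil => simp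
      | cons i l ih' =>
        simp only [List.map_cons, List.prod_cons, Equiv.Perm.mul_apply, ih']
        apply simple_apply_of_ne <;> simp <;> omega
    rw [List.finRange_succ_last, List.map_append, List.prod_append, List.map_map]
    ext a
    simp only [List.map_cons, List.map_nil, List.prod_cons, List.prod_nil, mul_one,
      Equiv.Perm.mul_apply]
    change ((((List.finRange m).map fun i => simple (Fin.castSucc i)).prod
      (simple (Fin.last m) a) : Fin (m + 2)) : ℕ) = _
    rcases lt_trichotomy (a : ℕ) m with ha | ha | ha
    · rw [simple_apply_of_ne (by simp; omega) (by simp; omega)]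
      have e : a = Fin.castSucc (⟨a, by omega⟩ : Fin (m + 1)) := rfl
      rw [e, h, ih, Fin.val_castSucc, finRotate_of_lt ha, finRotate_of_lt (by simp; omega)]
      rfl
    · have e : a = Fin.castSucc (Fin.last m) := Fin.ext ha
      rw [e, simple_castSucc, Fin.succ_last, h', ← e, coe_finRotate_of_ne_last]
      · simp [ha]
      · intro h; rw [h] at ha; simp at ha
    · have e : a = Fin.succ (Fin.last m) := Fin.ext (by simp; omega)
      rw [e, simple_succ, h, ih, finRotate_last, Fin.succ_last, finRotate_last]
      simp

theorem omega_apply (q : K) (f : MvPolynomial (Fin (m + 1)) K) :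
    omega m q f = omegaHom m q f := by
  have h : ((List.finRange m).reverse.map simple).prod = (finRotate (m + 1)).symm := by
    rw [← Equiv.Perm.inv_def, ← prod_map_simple_finRange, List.prod_inv_reverse, List.map_map,
      ← List.map_reverse]
    congr 1
  rw [omega, prod_map_swapOp, h, omegaHom, shiftOp]
  rfl

theorem omegaHom_X (q : K) (a : Fin (m + 1)) :
    omegaHom m q (X a) = C (if a = 0 then q else 1) * X ((finRotate (m + 1))⁻¹ a) := by
  rw [omegaHom, AlgHom.comp_apply, aeval_X]
  split_ifs <;> simp [Equiv.Perm.inv_def]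

theorem finRotate_inv_val (a : Fin (m + 1)) :
    (((finRotate (m + 1))⁻¹ a : Fin (m + 1)) : ℕ) = if a = 0 then m else (a : ℕ) - 1 := by
  obtain ⟨b, rfl⟩ := (finRotate (m + 1)).surjective a
  rw [Equiv.Perm.inv_def, Equiv.symm_apply_apply]
  by_cases hb : b = Fin.last m
  · subst hb; simp
  · have h := coe_finRotate_of_ne_last hb
    rw [if_neg]
    · omega
    · intro h'; rw [h'] at h; simp at h

/-- The pair `(j, j+1)` with `j ≥ 1` avoids the `q`-shifted variable, so `ω` merely lowers its
indices by one. -/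
theorem T_mul_omega {q t : K} {i j : Fin m} (h : (i : ℕ) + 1 = j) :
    T t i * omega m q = omega m q * T t j := by
  refine LinearMap.ext fun f => ?_
  rw [Module.End.mul_apply, Module.End.mul_apply, omega_apply, omega_apply]
  symm
  refine map_T_of_map_X (omegaHom m q) _ _ (omegaHom_X q) ?_ ?_ ?_ ?_ f
  · rw [if_neg, if_neg] <;> rw [Fin.ext_iff] <;> simp
    omega
  · rw [if_neg (Fin.succ_ne_zero j)]; exact one_ne_zero
  · rw [Fin.ext_iff, finRotate_inv_val, if_neg] <;> simp [Fin.ext_iff] <;> omega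
  · rw [Fin.ext_iff, finRotate_inv_val, if_neg] <;> simp [Fin.ext_iff]
    omega

/-- Under `ω²` each of the first two variables is `q`-shifted exactly once. Their scalars are
therefore both `q`, and can be cancelled because `q ≠ 0`. -/
theorem T_mul_omega_mul_omega {q t : K} (hq : q ≠ 0) {i j : Fin m} (hi : (i : ℕ) + 1 = m)
    (hj : (j : ℕ) = 0) :
    T t i * (omega m q * omega m q) = omega m q * omega m q * T t j := by
  refine LinearMap.ext fun f => ?_
  simp only [Module.End.mul_apply, omega_apply]
  symm
  have hd : ∀ a : Fin (m + 1), (omegaHom m q).comp (omegaHom m q) (X a) =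
      C ((if a = 0 then q else 1) * if (finRotate (m + 1))⁻¹ a = 0 then q else 1) *
        X (((finRotate (m + 1))⁻¹ * (finRotate (m + 1))⁻¹) a) := by
    intro a
    have hC : ∀ c : K, omegaHom m q (C c) = C c := fun c => (omegaHom m q).commutes c
    rw [AlgHom.comp_apply, omegaHom_X, map_mul, hC, omegaHom_X, C_mul, Equiv.Perm.mul_apply]
    ring
  have e1 : (finRotate (m + 1))⁻¹ j.castSucc = Fin.last m := by
    rw [Fin.ext_iff, finRotate_inv_val, if_pos] <;> simp [Fin.ext_iff, hj]
  have e2 : (finRotate (m + 1))⁻¹ j.succ = 0 := by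
    rw [Fin.ext_iff, finRotate_inv_val, if_neg] <;> simp [Fin.ext_iff, hj]
  have e3 : Fin.last m ≠ 0 := by rw [Ne, Fin.ext_iff]; simp; omega
  have e4 : j.castSucc = 0 := by rw [Fin.ext_iff]; simp [hj]
  refine map_T_of_map_X ((omegaHom m q).comp (omegaHom m q)) _ _ hd ?_ ?_ ?_ ?_ f
  · rw [e1, e2, if_pos e4, if_neg e3, if_neg (Fin.succ_ne_zero j), if_pos rfl]; ring
  · rw [e2, if_neg (Fin.succ_ne_zero j), if_pos rfl]; simpa using hq
  · rw [Equiv.Perm.mul_apply, e1, Fin.ext_iff, finRotate_inv_val, if_neg e3]; simp; omega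
  · rw [Equiv.Perm.mul_apply, e2, Fin.ext_iff, finRotate_inv_val, if_pos rfl]; simp; omega

variable {q t : K} (hq : q ≠ 0) (ht : t ≠ 0)

theorem TNat_eq (ht : t ≠ 0) {k : ℕ} (hk : k < m) :
    (TNat m ht k : Module.End K (MvPolynomial (Fin (m + 1)) K)) = T t ⟨k, hk⟩ :=
  TNat_val ht ⟨k, hk⟩

theorem TNat_comm (i j : ℕ) (hij : i + 1 < j) (hj : j < m) :
    Commute (TNat m ht i) (TNat m ht j) := by
  refine Units.ext ?_
  push_cast
  rw [TNat_eq ht hj, TNat_eq ht (show i < m by omega)]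
  exact T_comm hij

theorem TNat_braid (i : ℕ) (hi : i + 1 < m) :
    TNat m ht i * TNat m ht (i + 1) * TNat m ht i =
      TNat m ht (i + 1) * TNat m ht i * TNat m ht (i + 1) := by
  refine Units.ext ?_
  push_cast
  rw [TNat_eq ht hi, TNat_eq ht (show i < m by omega)]
  exact T_braid rfl

theorem TNat_mul_omega (i : ℕ) (hi : i + 1 < m) :
    (TNat m ht i : Module.End K (MvPolynomial (Fin (m + 1)) K)) * omega m q =
      omega m q * TNat m ht (i + 1) := by
  rw [TNat_eq ht hi, TNat_eq ht (show i < m by omega)]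
  exact T_mul_omega rfl

include hq in
theorem TNat_mul_omega_mul_omega (hm : 0 < m) :
    (TNat m ht (m - 1) : Module.End K (MvPolynomial (Fin (m + 1)) K)) * (omega m q * omega m q) =
      omega m q * omega m q * TNat m ht 0 := by
  rw [TNat_eq ht hm, TNat_eq ht (show m - 1 < m by omega)]
  exact T_mul_omega_mul_omega hq (by simp; omega) rfl

theorem TNat_quad (i : ℕ) (hi : i < m) :
    (TNat m ht i : Module.End K (MvPolynomial (Fin (m + 1)) K)) * TNat m ht i =
      (t - 1) • (TNat m ht i : Module.End K (MvPolynomial (Fin (m + 1)) K)) + t • 1 := by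
  rw [TNat_eq ht hi]
  exact T_mul_T t _

include ht in
theorem sum_Y_eq : ∑ i, Y (m := m) q t i = t ^ (-(m : ℤ)) •
    ∑ i ∈ Finset.range (m + 1), t ^ (i : ℤ) • cherednik (TNat m ht) (omega m q) m i := by
  rw [Finset.sum_range, Finset.smul_sum]
  refine Finset.sum_congr rfl fun i _ => ?_
  rw [Y_eq_cherednik q ht, smul_smul, ← zpow_add₀ ht, neg_add_eq_sub]

include ht in
theorem commute_T_sum_Y (i : Fin m) : Commute (T t i) (∑ j, Y q t j) := by
  rw [sum_Y_eq ht, ← TNat_val ht i]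
  exact (commute_sum_cherednik (TNat_comm ht) (TNat_braid ht) (TNat_mul_omega ht) ht
    (TNat_quad ht) i.2).smul_right _

include hq ht in
theorem commute_Y_sum_Y (i : Fin (m + 1)) : Commute (Y q t i) (∑ j, Y q t j) := by
  rw [sum_Y_eq ht, Y_eq_cherednik q ht i]
  exact ((commute_cherednik_sum (TNat_comm ht) (TNat_braid ht) (TNat_mul_omega ht)
    (TNat_mul_omega_mul_omega hq ht) ht (TNat_quad ht)
    (Nat.le_of_lt_succ i.2)).smul_right _).smul_left _

/-! ### The symmetrizers absorb the Hecke generators -/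

theorem Tperm_eq {w : List (Fin m)} {σ : Equiv.Perm (Fin (m + 1))} (hw : IsReducedWord w σ)
    (t : K) : Tperm t σ = (w.map (T t)).prod :=
  prod_map_eq_of_isReducedWord (T t) (fun _ _ h => T_comm h) (fun _ _ h => T_braid h)
    (exists_reducedWord σ).choose_spec hw

theorem Tperm_simple_mul {σ : Equiv.Perm (Fin (m + 1))} {i : Fin m}
    (h : σ⁻¹ i.castSucc < σ⁻¹ i.succ) (t : K) : Tperm t (simple i * σ) = T t i * Tperm t σ := by
  obtain ⟨w, hw⟩ := exists_reducedWord σ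
  have hw' : IsReducedWord (i :: w) (simple i * σ) := by
    rw [isReducedWord_iff] at hw ⊢
    rw [List.map_cons, List.prod_cons, hw.1, List.length_cons, hw.2, permLength_simple_mul h]
    exact ⟨rfl, rfl⟩
  rw [Tperm_eq hw, Tperm_eq hw', List.map_cons, List.prod_cons]

theorem Tperm_mul_simple {σ : Equiv.Perm (Fin (m + 1))} {i : Fin m}
    (h : σ i.castSucc < σ i.succ) (t : K) : Tperm t (σ * simple i) = Tperm t σ * T t i := by
  obtain ⟨w, hw⟩ := exists_reducedWord σ
  have hw' : IsReducedWord (w ++ [i]) (σ * simple i) := by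
    rw [isReducedWord_iff] at hw ⊢
    rw [List.map_append, List.prod_append, hw.1, List.length_append, hw.2, permLength_mul_simple h]
    simp
  rw [Tperm_eq hw, Tperm_eq hw']
  simp

theorem simple_ne_one (i : Fin m) : simple i ≠ 1 := by
  intro h
  have := congrArg (fun σ : Equiv.Perm _ => σ i.castSucc) h
  simp only [simple_castSucc, Equiv.Perm.one_apply] at this
  exact Fin.castSucc_lt_succ.ne' this

theorem sum_eq_zero_of_simple_mul {M : Type*} [AddCommMonoid M] (i : Fin m)
    (f : Equiv.Perm (Fin (m + 1)) → M)
    (h : ∀ σ, σ⁻¹ i.castSucc < σ⁻¹ i.succ → f σ + f (simple i * σ) = 0) : ∑ σ, f σ = 0 := by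
  refine Finset.sum_involution (fun σ _ => simple i * σ) ?_ ?_ ?_ ?_
  · intro σ _
    rcases lt_or_gt_of_ne (inv_castSucc_ne σ⁻¹ i) with h' | h'
    · exact h σ h'
    · have := h (simple i * σ) (by simpa using h')
      rwa [← mul_assoc, simple_mul_self, one_mul, add_comm] at this
  · intro σ _ _ h
    exact simple_ne_one i (by simpa using h)
  · intro σ _; exact Finset.mem_univ _
  · intro σ _; rw [← mul_assoc, simple_mul_self, one_mul]

theorem sum_eq_zero_of_mul_simple {M : Type*} [AddCommMonoid M] (i : Fin m)
    (f : Equiv.Perm (Fin (m + 1)) → M)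
    (h : ∀ σ, σ i.castSucc < σ i.succ → f σ + f (σ * simple i) = 0) : ∑ σ, f σ = 0 := by
  refine Finset.sum_involution (fun σ _ => σ * simple i) ?_ ?_ ?_ ?_
  · intro σ _
    rcases lt_or_gt_of_ne (inv_castSucc_ne σ i) with h' | h'
    · exact h σ h'
    · have := h (σ * simple i) (by simpa using h')
      rwa [mul_assoc, simple_mul_self, mul_one, add_comm] at this
  · intro σ _ _ h
    exact simple_ne_one i (by simpa using h)
  · intro σ _; exact Finset.mem_univ _
  · intro σ _; rw [mul_assoc, simple_mul_self, mul_one]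

/-- On each pair `σ`, `s_i σ` with the second longer, the claim is `(T_i - t)(1 + T_i) T_σ = 0`. -/
theorem T_mul_Uplus (t : K) (i : Fin m) : T t i * Uplus m t = t • Uplus m t := by
  rw [← sub_eq_zero, Uplus, Finset.mul_sum, Finset.smul_sum, ← Finset.sum_sub_distrib]
  refine sum_eq_zero_of_simple_mul i _ fun σ h => ?_
  rw [Tperm_simple_mul h, ← mul_assoc, T_mul_T]
  simp only [add_mul, smul_mul_assoc, one_mul]
  module

include ht in
-- On each pair `σ`, `σ s_i` the weights differ by `-t⁻¹`, and `T_σ (1 - t⁻¹ T_i)(T_i + 1) = 0`. The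
-- generator stands on the right because `U⁻` is later applied to polynomials of the form `T_i p`.
theorem Uminus_mul_T (i : Fin m) : Uminus m t * T t i = -Uminus m t := by
  rw [← add_eq_zero_iff_eq_neg, Uminus, Finset.sum_mul, ← Finset.sum_add_distrib]
  refine sum_eq_zero_of_mul_simple i _ fun σ h => ?_
  rw [Tperm_mul_simple h, permLength_mul_simple h, smul_mul_assoc, smul_mul_assoc, mul_assoc,
    T_mul_T, pow_succ, inv_neg]
  generalize (-t⁻¹) ^ permLength σ = c
  simp only [mul_add, mul_smul_comm, mul_one, smul_add, smul_smul]
  have e1 : c * -t⁻¹ * t = -c := by field_simp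
  have e2 : c * -t⁻¹ * (t - 1) = -c + c * t⁻¹ := by field_simp; ring
  rw [e1, e2]
  module

theorem commute_Tperm {Z : Module.End K (MvPolynomial (Fin (m + 1)) K)}
    (h : ∀ i, Commute (T t i) Z) (σ : Equiv.Perm (Fin (m + 1))) : Commute (Tperm t σ) Z := by
  unfold Tperm
  refine Commute.list_prod_left _ _ fun x hx => ?_
  obtain ⟨k, _, rfl⟩ := List.mem_map.mp hx
  exact h k

include ht in
theorem commute_Uplus_sum_Y : Commute (Uplus m t) (∑ j, Y q t j) :=
  Commute.sum_left _ _ _ fun σ _ => commute_Tperm (fun i => commute_T_sum_Y ht i) σ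

include ht in
theorem commute_Uminus_sum_Y : Commute (Uminus m t) (∑ j, Y q t j) :=
  Commute.sum_left _ _ _ fun σ _ =>
    (commute_Tperm (fun i => commute_T_sum_Y ht i) σ).smul_left _

end Cherednik

end

end NSMacdonald

namespace NSMacdonald

noncomputable section

/-! ### Rearrangements and the dominance order -/

section Dominance

variable {m n : ℕ}

theorem incr_eq_comp_sort (η : Comp n) : incr η = η ∘ Tuple.sort η := by
  funext i; simp [incr, plus, rev]

theorem monotone_incr (η : Comp n) : Monotone (incr η) := by
  rw [incr_eq_comp_sort]; exact Tuple.monotone_sort η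

theorem plus_eq_comp (η : Comp n) : ∃ σ : Equiv.Perm (Fin n), plus η = η ∘ σ :=
  ⟨Fin.revPerm.trans (Tuple.sort η), by funext i; simp [plus, rev]⟩

theorem incr_eq_comp (η : Comp n) : ∃ σ : Equiv.Perm (Fin n), incr η = η ∘ σ :=
  ⟨_, incr_eq_comp_sort η⟩

theorem antitone_plus (η : Comp n) : Antitone (plus η) := fun _ _ h =>
  Tuple.monotone_sort η (Fin.rev_le_rev.mpr h)

theorem plus_comp (η : Comp n) (σ : Equiv.Perm (Fin n)) : plus (η ∘ σ) = plus η := by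
  unfold plus
  rw [Tuple.comp_perm_comp_sort_eq_comp_sort]

theorem plus_comp_eq_of_antitone {η : Comp n} {σ : Equiv.Perm (Fin n)} (h : Antitone (η ∘ σ)) :
    plus η = η ∘ σ := by
  have h1 : Monotone (η ∘ (Fin.revPerm.trans σ : Equiv.Perm (Fin n))) := fun _ _ hij =>
    h (Fin.rev_le_rev.mpr hij)
  rw [← Tuple.comp_sort_eq_comp_iff_monotone] at h1
  unfold plus
  rw [← h1]
  funext i
  simp [rev]

theorem plus_of_antitone {η : Comp n} (h : Antitone η) : plus η = η :=
  plus_comp_eq_of_antitone (σ := 1) h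

@[simp] theorem plus_plus (η : Comp n) : plus (plus η) = plus η :=
  plus_of_antitone (antitone_plus η)

@[simp] theorem plus_incr (η : Comp n) : plus (incr η) = plus η := by
  obtain ⟨σ, h⟩ := incr_eq_comp η
  rw [h, plus_comp]

theorem exists_comp_of_plus_eq {ν μ : Comp n} (h : plus ν = plus μ) :
    ∃ σ : Equiv.Perm (Fin n), ν = μ ∘ σ := by
  obtain ⟨σ, hσ⟩ := plus_eq_comp ν
  obtain ⟨τ, hτ⟩ := plus_eq_comp μ
  refine ⟨σ⁻¹.trans τ, ?_⟩
  rw [hσ, hτ] at h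
  funext i
  have := congrFun h (σ⁻¹ i)
  simpa using this

theorem sum_plus {M : Type*} [AddCommMonoid M] (η : Comp n) (g : ℕ → M) :
    ∑ i, g (plus η i) = ∑ i, g (η i) := by
  obtain ⟨σ, h⟩ := plus_eq_comp η
  rw [h]
  exact Equiv.sum_comp σ fun i => g (η i)

/-! ### The dominance order -/

theorem eq_of_sum_Iic_eq {ν κ : Comp n}
    (h : ∀ p, ∑ i ∈ Finset.Iic p, ν i = ∑ i ∈ Finset.Iic p, κ i) : ν = κ := by
  funext p
  induction p using WellFoundedLT.induction with
  | _ p ih =>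
    have h1 := h p
    rw [← Finset.Iio_insert, Finset.sum_insert (by simp), Finset.sum_insert (by simp),
      Finset.sum_congr rfl fun i hi => ih i (Finset.mem_Iio.mp hi)] at h1
    exact Nat.add_right_cancel h1

theorem DomLT.trans {μ ν κ : Comp n} (h1 : DomLT μ ν) (h2 : DomLT ν κ) : DomLT μ κ := by
  refine ⟨?_, h1.2.1.trans h2.2.1, fun p => (h1.2.2 p).trans (h2.2.2 p)⟩
  rintro rfl
  exact h1.1 (eq_of_sum_Iic_eq fun p => le_antisymm (h1.2.2 p) (h2.2.2 p))

theorem not_domLT_self (μ : Comp n) : ¬ DomLT μ μ := fun h => h.1 rfl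

theorem DomLT.exists_lt {μ ν : Comp n} (h : DomLT μ ν) :
    ∃ p, ∑ i ∈ Finset.Iic p, μ i < ∑ i ∈ Finset.Iic p, ν i := by
  by_contra! hc
  exact h.1 (eq_of_sum_Iic_eq fun p => le_antisymm (h.2.2 p) (hc p))

/-- The sum of the partial sums, a rank function for the dominance order. -/
def domRank (κ : Comp n) : ℕ := ∑ p, ∑ i ∈ Finset.Iic p, κ i

theorem DomLT.domRank_lt {μ ν : Comp n} (h : DomLT μ ν) : domRank μ < domRank ν := by
  obtain ⟨p, hp⟩ := h.exists_lt
  exact Finset.sum_lt_sum (fun p _ => h.2.2 p) ⟨p, Finset.mem_univ p, hp⟩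

/-- A dominance test that needs no sorting: for every `c`, a sum of `p` parts is at most `∑ (ν_i -
c)⁺ + p c`, with equality for the largest parts of `κ` when `c` is the smallest of these. Truncated
subtraction supplies the positive part. -/
theorem domLT_plus_of_sum_tsub_le {ν κ : Comp n} (hs : ∑ i, ν i = ∑ i, κ i)
    (h : ∀ c, ∑ i, (ν i - c) ≤ ∑ i, (κ i - c)) (hne : plus ν ≠ plus κ) :
    DomLT (plus ν) (plus κ) := by
  refine ⟨hne, ?_, fun p => ?_⟩
  · rw [sum_plus ν fun x => x, sum_plus κ fun x => x, hs]
  set c := plus κ p with hc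
  have h1 : ∑ i ∈ Finset.Iic p, plus ν i ≤ ∑ i, (plus ν i - c) + ∑ _i ∈ Finset.Iic p, c := by
    refine le_trans ?_ (Nat.add_le_add_right
      (Finset.sum_le_sum_of_subset (Finset.subset_univ (Finset.Iic p))) _)
    rw [← Finset.sum_add_distrib]
    exact Finset.sum_le_sum fun i _ => le_tsub_add
  have h2 : ∑ i, (plus κ i - c) = ∑ i ∈ Finset.Iic p, (plus κ i - c) := by
    symm
    refine Finset.sum_subset (Finset.subset_univ _) fun i _ hi => ?_
    rw [Finset.mem_Iic, not_le] at hi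
    exact Nat.sub_eq_zero_of_le (antitone_plus κ hi.le)
  have h3 : ∑ i ∈ Finset.Iic p, (plus κ i - c) + ∑ _i ∈ Finset.Iic p, c =
      ∑ i ∈ Finset.Iic p, plus κ i := by
    rw [← Finset.sum_add_distrib]
    refine Finset.sum_congr rfl fun i hi => ?_
    exact Nat.sub_add_cancel (antitone_plus κ (Finset.mem_Iic.mp hi))
  have h4 := h c
  rw [← sum_plus ν fun x => x - c, ← sum_plus κ fun x => x - c, h2] at h4
  omega

theorem sum_eq_add_add_sum_erase {ι M : Type*} [Fintype ι] [DecidableEq ι] [AddCommMonoid M]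
    {a b : ι} (hab : a ≠ b) (f : ι → M) :
    ∑ i, f i = f a + (f b + ∑ i ∈ (Finset.univ.erase a).erase b, f i) := by
  rw [Finset.add_sum_erase _ _ (Finset.mem_erase.mpr ⟨hab.symm, Finset.mem_univ b⟩),
    Finset.add_sum_erase _ _ (Finset.mem_univ a)]

/-- The pair `x + d - k`, `x + k` is less spread out than `x + d`, `x`, and `(· - c)⁺` is convex. -/
theorem domLT_plus_add_single {ν : Comp n} {a b : Fin n} (hab : a ≠ b) (hν : ν a = ν b) {k d : ℕ}
    (hk : 0 < k) (hkd : k < d) :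
    DomLT (plus (ν + Pi.single a (d - k) + Pi.single b k)) (plus (ν + Pi.single a d)) := by
  have key : ∀ g : ℕ → ℕ, ∃ R, ∑ i, g ((ν + Pi.single a (d - k) + Pi.single b k : Comp n) i) =
      g (ν a + (d - k)) + (g (ν a + k) + R) ∧
      ∑ i, g ((ν + Pi.single a d : Comp n) i) = g (ν a + d) + (g (ν a) + R) := by
    intro g
    refine ⟨∑ i ∈ (Finset.univ.erase a).erase b, g (ν i), ?_, ?_⟩
    · rw [sum_eq_add_add_sum_erase hab]
      have : ∀ i ∈ (Finset.univ.erase a).erase b,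
          g ((ν + Pi.single a (d - k) + Pi.single b k : Comp n) i) = g (ν i) := by
        intro i hi
        simp only [Finset.mem_erase, Finset.mem_univ, and_true] at hi
        simp [Pi.single_eq_of_ne hi.1, Pi.single_eq_of_ne hi.2]
      rw [Finset.sum_congr rfl this]
      simp [Pi.single_eq_of_ne hab, Pi.single_eq_of_ne hab.symm, hν]
    · rw [sum_eq_add_add_sum_erase hab]
      have : ∀ i ∈ (Finset.univ.erase a).erase b,
          g ((ν + Pi.single a d : Comp n) i) = g (ν i) := by
        intro i hi
        simp only [Finset.mem_erase, Finset.mem_univ, and_true] at hi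
        simp [Pi.single_eq_of_ne hi.2]
      rw [Finset.sum_congr rfl this]
      simp [Pi.single_eq_of_ne hab.symm, hν]
  refine domLT_plus_of_sum_tsub_le ?_ (fun c => ?_) fun h => ?_
  · obtain ⟨R, h1, h2⟩ := key fun x => x
    rw [h1, h2]; omega
  · obtain ⟨R, h1, h2⟩ := key fun x => x - c
    rw [h1, h2]; omega
  -- Strictness: of the four entries that differ, only `ν a + d` exceeds the threshold `ν a + d -
  -- 1`.
  · obtain ⟨R, h1, h2⟩ := key fun x => x - (ν a + d - 1)
    rw [← sum_plus _ fun x => x - (ν a + d - 1), h, sum_plus _ fun x => x - (ν a + d - 1), h2] at h1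
    omega

/-- By the rearrangement inequality against the indicator of an initial segment, an increasing tuple
has the smallest partial sums in its orbit. -/
theorem not_domLT_of_monotone {ν μ : Comp n} (hμ : Monotone μ) (h : plus ν = plus μ) :
    ¬ DomLT ν μ := by
  intro hd
  obtain ⟨σ, rfl⟩ := exists_comp_of_plus_eq h
  refine hd.1 (eq_of_sum_Iic_eq fun p => le_antisymm (hd.2.2 p) ?_)
  have hp : Antitone fun i : Fin n => if i ≤ p then 1 else 0 := by
    intro i j hij
    dsimp only
    split_ifs with h1 h2
    · exact le_rfl
    · exact absurd (hij.trans h1) h2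
    · exact zero_le_one
    · exact le_rfl
  have := (hμ.antivary hp).sum_mul_le_sum_comp_perm_mul (σ := σ)
  have e : ∀ f : Fin n → ℕ, ∑ i, f i * (if i ≤ p then 1 else 0) = ∑ i ∈ Finset.Iic p, f i := by
    intro f
    simp only [mul_ite, mul_one, mul_zero, ← Finset.sum_filter]
    congr 1
    ext i; simp
  rw [e μ, e fun i => μ (σ i)] at this
  exact this

/-- The reason for working with `η^R`: the second alternative of `≺` is void there, so no other
exponent of the same orbit enters `E_{η^R}`. -/
theorem prec_incr_iff {ν η : Comp n} : Prec ν (incr η) ↔ DomLT (plus ν) (plus η) := by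
  unfold Prec
  rw [plus_incr]
  constructor
  · rintro (h | ⟨h1, h2⟩)
    · exact h
    · exact absurd h2 (not_domLT_of_monotone (monotone_incr η) (by rw [h1, plus_incr]))
  · exact Or.inl

theorem exists_eq_castSucc_succ {μ : Comp (m + 1)} (h : Antitone μ) (hs : ¬ StrictAnti μ) :
    ∃ i : Fin m, μ i.castSucc = μ i.succ := by
  by_contra! hc
  exact hs (Fin.strictAnti_iff_succ_lt.mpr fun i =>
    lt_of_le_of_ne (h Fin.castSucc_lt_succ.le) (hc i).symm)

end Dominance

end

end NSMacdonald

namespace NSMacdonald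

open MvPolynomial

noncomputable section

/-! ### Triangularity -/

section Spectrum

variable {n : ℕ}

/-- The total order of the positions of `η` behind the leg colength. -/
def legLT (η : Comp n) (k i : Fin n) : Prop := (k < i ∧ η i ≤ η k) ∨ (i < k ∧ η i < η k)

instance (η : Comp n) (k i : Fin n) : Decidable (legLT η k i) := by unfold legLT; infer_instance

theorem legColength_eq_card (η : Comp n) (i : Fin n) :
    legColength η i = (Finset.univ.filter fun k => legLT η k i).card := by
  unfold legColength legLT
  rw [Finset.filter_or, Finset.card_union_of_disjoint]
  rw [Finset.disjoint_filter]
  rintro k - ⟨h1, -⟩ ⟨h2, -⟩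
  exact lt_asymm h1 h2

theorem legColength_lt_of_legLT {η : Comp n} {a b : Fin n} (h : legLT η a b) :
    legColength η a < legColength η b := by
  rw [legColength_eq_card, legColength_eq_card]
  refine Finset.card_lt_card ((Finset.ssubset_iff_of_subset fun k hk => ?_).mpr ⟨a, ?_, ?_⟩)
  · simp only [Finset.mem_filter, Finset.mem_univ, true_and] at hk ⊢
    unfold legLT at *
    rcases lt_trichotomy k b with h1 | h1 | h1
    · left; omega
    · subst h1; omega
    · right; omega
  · simpa using h
  · intro h'
    have := (Finset.mem_filter.mp h').2
    unfold legLT at this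
    omega

theorem legLT_or {η : Comp n} {a b : Fin n} (h : a ≠ b) : legLT η a b ∨ legLT η b a := by
  unfold legLT
  omega

theorem legColength_lt (η : Comp n) (i : Fin n) : legColength η i < n := by
  rw [legColength_eq_card]
  calc _ < (Finset.univ : Finset (Fin n)).card :=
        Finset.card_lt_card (Finset.filter_ssubset.mpr ⟨i, Finset.mem_univ i, by simp [legLT]⟩)
    _ = n := by simp

/-- The leg colengths are a permutation that sorts the composition. -/
theorem exists_perm_legColength (η : Comp n) :
    ∃ σ : Equiv.Perm (Fin n), (∀ i, (σ i : ℕ) = legColength η i) ∧ plus η = η ∘ ⇑σ⁻¹ := by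
  have hinj : Function.Injective fun i => (⟨legColength η i, legColength_lt η i⟩ : Fin n) := by
    intro a b h
    by_contra hne
    have h' : legColength η a = legColength η b := congrArg Fin.val h
    rcases legLT_or (η := η) hne with h1 | h1 <;> have := legColength_lt_of_legLT h1 <;> omega
  set σ := Equiv.ofBijective _ (Finite.injective_iff_bijective.mp hinj) with hσ
  have hv : ∀ i, (σ i : ℕ) = legColength η i := fun i => rfl
  refine ⟨σ, hv, plus_comp_eq_of_antitone fun x y hxy => ?_⟩
  obtain ⟨a, rfl⟩ := σ.surjective x
  obtain ⟨b, rfl⟩ := σ.surjective y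
  simp only [Function.comp, Equiv.Perm.inv_def, Equiv.symm_apply_apply]
  rcases eq_or_ne a b with rfl | hne
  · exact le_rfl
  rw [Fin.le_def, hv, hv] at hxy
  rcases legLT_or (η := η) hne with h1 | h1
  · unfold legLT at h1; omega
  · have := legColength_lt_of_legLT h1; omega

variable {K : Type*} [Field K]

/-- The eigenvalue of `∑ Y_i` that belongs to a partition. -/
def eigen (q t : K) (κ : Comp n) : K := ∑ i, q ^ κ i * t⁻¹ ^ (i : ℕ)

/-- The leg colength of an entry is its position in the sorted tuple, so the eigenvalue of the sum
depends only on the orbit. -/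
theorem sum_spec (q t : K) (η : Comp n) : ∑ i, spec q t η i = eigen q t (plus η) := by
  obtain ⟨σ, h1, h2⟩ := exists_perm_legColength η
  unfold eigen
  rw [← Equiv.sum_comp σ fun i => q ^ plus η i * t⁻¹ ^ (i : ℕ)]
  refine Finset.sum_congr rfl fun i _ => ?_
  rw [h2, Function.comp, Equiv.Perm.inv_def, Equiv.symm_apply_apply, h1, spec]

end Spectrum

/-! ### The action of the operators on monomials -/

section Triangular

variable {K : Type*} [Field K] {m n : ℕ}

theorem mono_add (ν μ : Comp n) : mono K (ν + μ) = mono K ν * mono K μ := by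
  simp only [mono, Pi.add_apply, pow_add, Finset.prod_mul_distrib]

theorem mono_single (a : Fin n) (k : ℕ) : mono K (Pi.single a k) = X a ^ k := by
  unfold mono
  rw [Finset.prod_eq_single a]
  · simp
  · intro b _ hb; rw [Pi.single_eq_of_ne hb, pow_zero]
  · simp

theorem rename_mono (σ : Equiv.Perm (Fin n)) (ν : Comp n) :
    rename σ (mono K ν) = mono K (ν ∘ ⇑σ⁻¹) := by
  unfold mono
  rw [map_prod, ← Equiv.prod_comp σ (fun i => (X i : MvPolynomial (Fin n) K) ^ _)]
  simp [Equiv.Perm.inv_def]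

theorem swapOp_mono (i : Fin m) (ν : Comp (m + 1)) :
    swapOp i (mono K ν) = mono K (ν ∘ simple i) := by
  rw [swapOp_apply, rename_mono, simple_inv]

theorem T_of_swapOp_eq {t : K} {i : Fin m} {p : MvPolynomial (Fin (m + 1)) K}
    (hp : swapOp i p = p) : T t i p = t • p := by
  apply eq_T_of_mul_eq
  rw [hp, smul_eq_C_mul]
  ring

theorem swapOp_eq_of_T {t : K} (ht : t ≠ 0) {i : Fin m} {p : MvPolynomial (Fin (m + 1)) K}
    (hp : T t i p = t • p) : swapOp i p = p := by
  rw [T_apply, smul_eq_C_mul, add_eq_left, mul_eq_zero] at hp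
  have h := divDiff_spec i p
  rcases hp with h1 | h1
  · exfalso
    -- Evaluation at `x_i = 1`, all other variables `0`, turns the factor `t x_i - x_{i+1}` into
    -- `t`.
    have := congrArg (aeval fun j => if j = i.castSucc then (1 : K) else 0) h1
    simp [Fin.castSucc_lt_succ.ne'] at this
    exact ht this
  · rw [h1, mul_zero] at h
    exact sub_eq_zero.mp h.symm

theorem comp_simple_of_eq {ν : Comp (m + 1)} {i : Fin m} (h : ν i.castSucc = ν i.succ) :
    ν ∘ simple i = ν := by
  funext j
  rw [Function.comp, simple, Equiv.swap_apply_def]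
  split_ifs with h1 h2
  · rw [h1, h]
  · rw [h2, h]
  · rfl

theorem T_mono_eq (t : K) {ν : Comp (m + 1)} {i : Fin m} (h : ν i.castSucc = ν i.succ) :
    T t i (mono K ν) = t • mono K ν :=
  T_of_swapOp_eq (by rw [swapOp_mono, comp_simple_of_eq h])

theorem T_X_mul (t : K) (i : Fin m) (f : MvPolynomial (Fin (m + 1)) K) :
    T t i (X i.castSucc * f) = X i.succ * T t i f + (1 - C t) * X i.succ * f := by
  apply eq_T_of_mul_eq
  rw [swapOp_mul, swapOp_X, simple_castSucc]
  linear_combination X i.succ * X_sub_X_mul_T t i f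

theorem T_X_pow_mul (t : K) {i : Fin m} {f : MvPolynomial (Fin (m + 1)) K}
    (hf : swapOp i f = f) (d : ℕ) :
    T t i (X i.castSucc ^ (d + 1) * f) = X i.succ ^ (d + 1) * f +
      (1 - C t) * ∑ k ∈ Finset.range d, X i.castSucc ^ (d - k) * X i.succ ^ (k + 1) * f := by
  induction d with
  | zero =>
    rw [zero_add, pow_one, pow_one, T_X_mul, T_of_swapOp_eq hf, smul_eq_C_mul]
    simp; ring
  | succ d ih =>
    rw [pow_succ' (X i.castSucc), mul_assoc, T_X_mul, ih, Finset.sum_range_succ']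
    have e : ∀ k ∈ Finset.range d,
        X i.castSucc ^ (d + 1 - (k + 1)) * X i.succ ^ (k + 1 + 1) * f =
          X i.succ * (X i.castSucc ^ (d - k) * X i.succ ^ (k + 1) * f) := by
      intro k _
      rw [Nat.add_sub_add_right]; ring
    rw [Finset.sum_congr rfl e, Nat.sub_zero, ← Finset.mul_sum]
    ring

/-- The span of the monomials whose exponents have a sorted rearrangement in `S`. -/
def spanMono (K : Type*) [Field K] (S : Set (Comp n)) : Submodule K (MvPolynomial (Fin n) K) :=
  Submodule.span K {g | ∃ ν, plus ν ∈ S ∧ g = mono K ν}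

/-- The span of the monomials whose exponents lie below `κ`. -/
def lower (K : Type*) [Field K] (κ : Comp n) : Submodule K (MvPolynomial (Fin n) K) :=
  spanMono K {μ | DomLT μ κ}

theorem mono_mem_spanMono {S : Set (Comp n)} {ν : Comp n} (h : plus ν ∈ S) :
    mono K ν ∈ spanMono K S :=
  Submodule.subset_span ⟨ν, h, rfl⟩

theorem lower_le_spanMono {S : Set (Comp n)} (hS : ∀ μ κ, DomLT μ κ → κ ∈ S → μ ∈ S)
    {κ : Comp n} (h : κ ∈ S) : lower K κ ≤ spanMono K S := by
  refine Submodule.span_le.mpr ?_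
  rintro _ ⟨ν, hν, rfl⟩
  exact mono_mem_spanMono (hS _ _ hν h)

theorem mono_mem_lower {ν κ : Comp n} (h : DomLT (plus ν) κ) : mono K ν ∈ lower K κ :=
  Submodule.subset_span ⟨ν, h, rfl⟩

theorem lower_le_lower {μ κ : Comp n} (h : DomLT μ κ) : lower K μ ≤ lower K κ := by
  exact lower_le_spanMono (fun _ _ h1 h2 => h1.trans h2) h

/-- Splits off the excess `d + 1` of position `i` over position `i + 1`; the remaining monomial is
`s_i`-invariant, as `T_X_pow_mul` requires. -/
theorem exists_base_of_lt {ν : Comp (m + 1)} {i : Fin m} (h : ν i.succ < ν i.castSucc) :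
    ∃ (ν₀ : Comp (m + 1)) (d : ℕ), ν₀ i.castSucc = ν₀ i.succ ∧
      ν = ν₀ + Pi.single i.castSucc (d + 1) ∧ ν ∘ simple i = ν₀ + Pi.single i.succ (d + 1) := by
  have hne : i.succ ≠ i.castSucc := Fin.castSucc_lt_succ.ne'
  refine ⟨Function.update ν i.castSucc (ν i.succ), ν i.castSucc - ν i.succ - 1, ?_, ?_, ?_⟩
  · simp [Function.update_of_ne hne]
  · funext j
    by_cases hj : j = i.castSucc
    · subst hj; simp; omega
    · simp [Function.update_of_ne hj, Pi.single_eq_of_ne hj]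
  · funext j
    rw [Function.comp, simple, Equiv.swap_apply_def]
    split_ifs with h1 h2
    · subst h1; simp [Pi.single_eq_of_ne hne.symm]
    · subst h2; simp [Function.update_of_ne hne]; omega
    · simp [Function.update_of_ne h1, Pi.single_eq_of_ne h2]

/-- In `T_X_pow_mul` the remaining monomials share the excess between both positions, so they are
strictly lower by `domLT_plus_add_single`. -/
theorem T_mono_gt (t : K) {ν : Comp (m + 1)} {i : Fin m} (h : ν i.succ < ν i.castSucc) :
    T t i (mono K ν) - mono K (ν ∘ simple i) ∈ lower K (plus ν) := by
  obtain ⟨ν₀, d, h0, h1, h2⟩ := exists_base_of_lt h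
  have hs : swapOp i (mono K ν₀) = mono K ν₀ := by rw [swapOp_mono, comp_simple_of_eq h0]
  rw [h2, h1, mono_add, mono_single, mul_comm, T_X_pow_mul t hs, mono_add, mono_single,
    mul_comm (mono K ν₀), add_sub_cancel_left, ← C_1, ← C_sub, ← smul_eq_C_mul]
  refine Submodule.smul_mem _ _ (Submodule.sum_mem _ fun k hk => ?_)
  rw [Finset.mem_range] at hk
  have e : X i.castSucc ^ (d - k) * X i.succ ^ (k + 1) * mono K ν₀ =
      mono K (ν₀ + Pi.single i.castSucc (d + 1 - (k + 1)) + Pi.single i.succ (k + 1)) := by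
    rw [mono_add, mono_add, mono_single, mono_single, Nat.add_sub_add_right]; ring
  rw [e]
  exact mono_mem_lower
    (domLT_plus_add_single Fin.castSucc_lt_succ.ne h0 (Nat.succ_pos k) (by omega))

theorem T_mono_add (t : K) (ν : Comp (m + 1)) (i : Fin m) :
    T t i (mono K ν) + T t i (mono K (ν ∘ simple i)) =
      t • (mono K ν + mono K (ν ∘ simple i)) := by
  rw [← map_add]
  refine T_of_swapOp_eq ?_
  rw [map_add, swapOp_mono, swapOp_mono, comp_simple_comp_simple, add_comm (mono K _)]

/-- Follows from the opposite case, because `x^ν + x^{s_i ν}` is `s_i`-invariant and so multiplied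
by `t`. -/
theorem T_mono_lt (t : K) {ν : Comp (m + 1)} {i : Fin m} (h : ν i.castSucc < ν i.succ) :
    T t i (mono K ν) - (t • mono K (ν ∘ simple i) + (t - 1) • mono K ν) ∈ lower K (plus ν) := by
  have h1 := T_mono_gt (K := K) t (ν := ν ∘ simple i) (i := i) (by simpa using h)
  rw [comp_simple_comp_simple, plus_comp] at h1
  have h2 := eq_sub_of_add_eq (T_mono_add t ν i)
  rw [h2, ← Submodule.neg_mem_iff]
  convert h1 using 1
  module

theorem T_mem_spanMono (t : K) (i : Fin m) {S : Set (Comp (m + 1))}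
    (hS : ∀ μ κ, DomLT μ κ → κ ∈ S → μ ∈ S) {p : MvPolynomial (Fin (m + 1)) K}
    (hp : p ∈ spanMono K S) : T t i p ∈ spanMono K S := by
  induction hp using Submodule.span_induction with
  | mem x hx =>
    obtain ⟨ν, hν, rfl⟩ := hx
    have h1 : mono K ν ∈ spanMono K S := mono_mem_spanMono hν
    have h2 : mono K (ν ∘ simple i) ∈ spanMono K S := mono_mem_spanMono (by rwa [plus_comp])
    rcases lt_trichotomy (ν i.castSucc) (ν i.succ) with h | h | h
    · have := lower_le_spanMono hS hν (T_mono_lt t h)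
      rw [← Submodule.sub_mem_iff_left _ (Submodule.add_mem _ (Submodule.smul_mem _ t h2)
        (Submodule.smul_mem _ (t - 1) h1))]
      exact this
    · rw [T_mono_eq t h]
      exact Submodule.smul_mem _ _ h1
    · have := lower_le_spanMono hS hν (T_mono_gt t h)
      rwa [← Submodule.sub_mem_iff_left _ h2]
  | zero => rw [map_zero]; exact Submodule.zero_mem _
  | add x y _ _ hx hy => rw [map_add]; exact Submodule.add_mem _ hx hy
  | smul c x _ hx => rw [map_smul]; exact Submodule.smul_mem _ _ hx

theorem T_mem_lower (t : K) (i : Fin m) {κ : Comp (m + 1)} {p : MvPolynomial (Fin (m + 1)) K}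
    (hp : p ∈ lower K κ) : T t i p ∈ lower K κ :=
  T_mem_spanMono t i (fun _ _ h1 h2 => h1.trans h2) hp

theorem Tinv_apply (t : K) (i : Fin m) (p : MvPolynomial (Fin (m + 1)) K) :
    Tinv t i p = (t⁻¹ - 1) • p + t⁻¹ • T t i p := by
  simp [Tinv, sub_smul]

theorem Tinv_mem_lower (t : K) (i : Fin m) {κ : Comp (m + 1)} {p : MvPolynomial (Fin (m + 1)) K}
    (hp : p ∈ lower K κ) : Tinv t i p ∈ lower K κ := by
  rw [Tinv_apply]
  exact Submodule.add_mem _ (Submodule.smul_mem _ _ hp)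
    (Submodule.smul_mem _ _ (T_mem_lower t i hp))

theorem omega_mono (q : K) (ν : Comp (m + 1)) :
    omega m q (mono K ν) = q ^ ν 0 • mono K (ν ∘ finRotate (m + 1)) := by
  rw [omega_apply, omegaHom, AlgHom.comp_apply]
  have : (aeval fun j => if j = 0 then C q * X j else X j :
      MvPolynomial (Fin (m + 1)) K →ₐ[K] _) (mono K ν) = q ^ ν 0 • mono K ν := by
    unfold mono
    rw [map_prod, ← Finset.mul_prod_erase _ _ (Finset.mem_univ 0),
      ← Finset.mul_prod_erase _ (fun i => (X i : MvPolynomial (Fin (m + 1)) K) ^ ν i)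
        (Finset.mem_univ 0), smul_eq_C_mul, C_pow, ← mul_assoc]
    congr 1
    · simp [mul_pow]
    · refine Finset.prod_congr rfl fun i hi => ?_
      simp [(Finset.mem_erase.mp hi).1]
  rw [this, map_smul, rename_mono, Equiv.Perm.inv_def, Equiv.symm_symm]

theorem omega_mem_lower (q : K) {κ : Comp (m + 1)} {p : MvPolynomial (Fin (m + 1)) K}
    (hp : p ∈ lower K κ) : omega m q p ∈ lower K κ := by
  induction hp using Submodule.span_induction with
  | mem x hx =>
    obtain ⟨ν, hν, rfl⟩ := hx
    rw [omega_mono]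
    exact Submodule.smul_mem _ _ (mono_mem_lower (by rwa [plus_comp]))
  | zero => rw [map_zero]; exact Submodule.zero_mem _
  | add x y _ _ hx hy => rw [map_add]; exact Submodule.add_mem _ hx hy
  | smul c x _ hx => rw [map_smul]; exact Submodule.smul_mem _ _ hx

theorem list_prod_mem {V : Type*} [AddCommGroup V] [Module K V] {S : Submodule K V}
    (l : List (Module.End K V)) (h : ∀ f ∈ l, ∀ p ∈ S, f p ∈ S) {p : V} (hp : p ∈ S) :
    l.prod p ∈ S := by
  induction l with
  | nil => simpa using hp
  | cons f l ih =>
    rw [List.prod_cons, Module.End.mul_apply]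
    exact h f (by simp) _ (ih fun g hg => h g (by simp [hg]))

theorem Y_mem_lower (q t : K) (i : Fin (m + 1)) {κ : Comp (m + 1)}
    {p : MvPolynomial (Fin (m + 1)) K} (hp : p ∈ lower K κ) : Y q t i p ∈ lower K κ := by
  unfold Y
  rw [LinearMap.smul_apply, Module.End.mul_apply, Module.End.mul_apply]
  refine Submodule.smul_mem _ _ (list_prod_mem _ ?_ (omega_mem_lower q (list_prod_mem _ ?_ hp)))
  · intro f hf p hp
    obtain ⟨k, -, rfl⟩ := List.mem_map.mp hf
    exact T_mem_lower t k hp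
  · intro f hf p hp
    obtain ⟨k, -, rfl⟩ := List.mem_map.mp hf
    exact Tinv_mem_lower t k hp

theorem Tperm_mem_spanMono (t : K) (σ : Equiv.Perm (Fin (m + 1))) {S : Set (Comp (m + 1))}
    (hS : ∀ μ κ, DomLT μ κ → κ ∈ S → μ ∈ S)
    {p : MvPolynomial (Fin (m + 1)) K} (hp : p ∈ spanMono K S) : Tperm t σ p ∈ spanMono K S := by
  refine list_prod_mem _ ?_ hp
  intro f hf p hp
  obtain ⟨k, -, rfl⟩ := List.mem_map.mp hf
  exact T_mem_spanMono t k hS hp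

theorem Uplus_mem_spanMono (t : K) {S : Set (Comp (m + 1))}
    (hS : ∀ μ κ, DomLT μ κ → κ ∈ S → μ ∈ S)
    {p : MvPolynomial (Fin (m + 1)) K} (hp : p ∈ spanMono K S) : Uplus m t p ∈ spanMono K S := by
  rw [Uplus, LinearMap.sum_apply]
  exact Submodule.sum_mem _ fun σ _ => Tperm_mem_spanMono t σ hS hp

theorem Uminus_mem_lower (t : K) {κ : Comp (m + 1)}
    {p : MvPolynomial (Fin (m + 1)) K} (hp : p ∈ lower K κ) : Uminus m t p ∈ lower K κ := by
  rw [Uminus, LinearMap.sum_apply]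
  exact Submodule.sum_mem _ fun σ _ => Submodule.smul_mem _ _
    (Tperm_mem_spanMono t σ (fun _ _ h1 h2 => h1.trans h2) hp)

end Triangular

end

end NSMacdonald

namespace NSMacdonald

open MvPolynomial

noncomputable section

/-! ### The leading terms of the Cherednik operators -/

section Leading

variable {K : Type*} [Field K] {m : ℕ}

/-- On an increasing pair `T_i` yields two monomials of the orbit, but `T_i⁻¹` only one. With
`T_mono_ge` this lets the letters of `Y_i` act on an increasing exponent as scaled permutations,
modulo lower terms. -/
theorem Tinv_mono_le {t : K} (ht : t ≠ 0) {ν : Comp (m + 1)} {i : Fin m}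
    (h : ν i.castSucc ≤ ν i.succ) :
    Tinv t i (mono K ν) - (if ν i.castSucc = ν i.succ then t⁻¹ else 1) • mono K (ν ∘ simple i) ∈
      lower K (plus ν) := by
  rw [Tinv_apply]
  split_ifs with he
  · rw [T_mono_eq t he, comp_simple_of_eq he, smul_smul, inv_mul_cancel₀ ht, sub_smul,
      sub_add_cancel, sub_self]
    exact Submodule.zero_mem _
  · convert Submodule.smul_mem _ t⁻¹ (T_mono_lt t (lt_of_le_of_ne h he)) using 1
    rw [smul_sub, smul_add, smul_smul, smul_smul, inv_mul_cancel₀ ht, mul_sub, inv_mul_cancel₀ ht]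
    module

theorem T_mono_ge (t : K) {ν : Comp (m + 1)} {i : Fin m} (h : ν i.succ ≤ ν i.castSucc) :
    T t i (mono K ν) - (if ν i.castSucc = ν i.succ then t else 1) • mono K (ν ∘ simple i) ∈
      lower K (plus ν) := by
  split_ifs with he
  · rw [T_mono_eq t he, comp_simple_of_eq he, sub_self]
    exact Submodule.zero_mem _
  · rw [one_smul]
    exact T_mono_gt t (lt_of_le_of_ne h (Ne.symm he))

/-- The simple transpositions indexed by the natural numbers, continued by `1`. -/
def simpleNat (m k : ℕ) : Equiv.Perm (Fin (m + 1)) := if h : k < m then simple ⟨k, h⟩ else 1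

/-- The cycle `s_0 s_1 ⋯ s_{i-1}`. -/
def downPerm (m i : ℕ) : Equiv.Perm (Fin (m + 1)) := ((List.range i).map (simpleNat m)).prod

/-- The cycle `s_i s_{i+1} ⋯ s_{m-1}`. -/
def upPerm (m i : ℕ) : Equiv.Perm (Fin (m + 1)) :=
  ((List.range' i (m - i)).map (simpleNat m)).prod

theorem downPerm_succ {i : ℕ} (h : i < m) :
    downPerm m (i + 1) = downPerm m i * simple ⟨i, h⟩ := by
  simp [downPerm, List.range_succ, simpleNat, h]

theorem upPerm_self : upPerm m m = 1 := by simp [upPerm]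

theorem upPerm_eq {i : ℕ} (h : i < m) : upPerm m i = simple ⟨i, h⟩ * upPerm m (i + 1) := by
  unfold upPerm
  obtain ⟨k, rfl⟩ : ∃ k, m = i + 1 + k := ⟨m - (i + 1), by omega⟩
  have h1 : i + 1 + k - i = k + 1 := by omega
  have h2 : i + 1 + k - (i + 1) = k := by omega
  rw [h1, h2, List.range'_succ, List.map_cons, List.prod_cons, simpleNat, dif_pos h]

theorem downPerm_mul_upPerm {i : ℕ} (h : i ≤ m) :
    downPerm m i * upPerm m i = finRotate (m + 1) := by
  induction i with
  | zero =>
    have := map_filter_finRange (m := m) (fun _ => True) simple (simpleNat m) fun i => by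
      simp [simpleNat]
    simp only [decide_true, List.filter_true] at this
    rw [← prod_map_simple_finRange, this]
    simp [downPerm, upPerm, List.range_eq_range']
  | succ i ih =>
    rw [downPerm_succ h, mul_assoc, ← upPerm_eq h, ih (by omega)]

theorem downPerm_apply {i : ℕ} (h : i ≤ m) :
    downPerm m i ⟨i, Nat.lt_succ_of_le h⟩ = 0 := by
  induction i with
  | zero => simp [downPerm]
  | succ i ih =>
    rw [downPerm_succ h, Equiv.Perm.mul_apply, ← ih (by omega)]
    congr 1
    exact simple_succ (⟨i, h⟩ : Fin m)

theorem card_filter_lt_succ {j : ℕ} (hj : j < m + 1) (p : Fin (m + 1) → Prop) [DecidablePred p] :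
    (Finset.univ.filter fun k : Fin (m + 1) => (k : ℕ) < j + 1 ∧ p k).card =
      (Finset.univ.filter fun k : Fin (m + 1) => (k : ℕ) < j ∧ p k).card +
        if p ⟨j, hj⟩ then 1 else 0 := by
  split_ifs with h
  · rw [← Finset.card_insert_of_notMem (a := ⟨j, hj⟩) (by simp)]
    congr 1
    ext k
    simp only [Finset.mem_filter, Finset.mem_univ, true_and, Finset.mem_insert, Fin.ext_iff]
    constructor
    · rintro ⟨h1, h2⟩; exact or_iff_not_imp_left.mpr fun h3 => ⟨by omega, h2⟩
    · rintro (h1 | ⟨h1, h2⟩)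
      · exact ⟨by omega, by rwa [show k = ⟨j, hj⟩ from Fin.ext h1]⟩
      · exact ⟨by omega, h2⟩
  · rw [add_zero]
    congr 1
    ext k
    simp only [Finset.mem_filter, Finset.mem_univ, true_and]
    refine ⟨fun ⟨h1, h2⟩ => ⟨?_, h2⟩, fun ⟨h1, h2⟩ => ⟨by omega, h2⟩⟩
    by_contra hk
    exact h (by rwa [show k = ⟨j, hj⟩ from Fin.ext (by simp; omega)] at h2)

theorem card_filter_gt_succ {j : ℕ} (hj : j + 1 < m + 1) (p : Fin (m + 1) → Prop)
    [DecidablePred p] :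
    (Finset.univ.filter fun k : Fin (m + 1) => j < (k : ℕ) ∧ p k).card =
      (Finset.univ.filter fun k : Fin (m + 1) => j + 1 < (k : ℕ) ∧ p k).card +
        if p ⟨j + 1, hj⟩ then 1 else 0 := by
  split_ifs with h
  · rw [← Finset.card_insert_of_notMem (a := ⟨j + 1, hj⟩) (by simp)]
    congr 1
    ext k
    simp only [Finset.mem_filter, Finset.mem_univ, true_and, Finset.mem_insert, Fin.ext_iff]
    constructor
    · rintro ⟨h1, h2⟩; exact or_iff_not_imp_left.mpr fun h3 => ⟨by omega, h2⟩
    · rintro (h1 | ⟨h1, h2⟩)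
      · exact ⟨by omega, by rwa [show k = ⟨j + 1, hj⟩ from Fin.ext h1]⟩
      · exact ⟨by omega, h2⟩
  · rw [add_zero]
    congr 1
    ext k
    simp only [Finset.mem_filter, Finset.mem_univ, true_and]
    refine ⟨fun ⟨h1, h2⟩ => ⟨?_, h2⟩, fun ⟨h1, h2⟩ => ⟨by omega, h2⟩⟩
    by_contra hk
    exact h (by rwa [show k = ⟨j + 1, hj⟩ from Fin.ext (by simp; omega)] at h2)

variable {q t : K} (ht : t ≠ 0)

theorem downWord_mem_lower {κ : Comp (m + 1)} {p : MvPolynomial (Fin (m + 1)) K} (j : ℕ)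
    (hj : j ≤ m) (hp : p ∈ lower K κ) :
    (downWord (TNat m ht) j : Module.End K (MvPolynomial (Fin (m + 1)) K)) p ∈ lower K κ := by
  induction j generalizing p with
  | zero => simpa [downWord_zero] using hp
  | succ j ih =>
    rw [downWord_succ, Units.val_mul, Module.End.mul_apply, TNat_inv_val ht ⟨j, hj⟩]
    exact ih (by omega) (Tinv_mem_lower t _ hp)

theorem upWord_mem_lower {κ : Comp (m + 1)} {p : MvPolynomial (Fin (m + 1)) K} {j : ℕ}
    (hj : j ≤ m) (hp : p ∈ lower K κ) :
    (upWord (TNat m ht) m j : Module.End K (MvPolynomial (Fin (m + 1)) K)) p ∈ lower K κ := by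
  induction hj using Nat.decreasingInduction with
  | self => simpa [upWord_self] using hp
  | of_succ j hj ih =>
    rw [upWord_eq _ hj, Units.val_mul, Module.End.mul_apply, TNat_eq ht hj]
    exact T_mem_lower t _ ih

/-- The letters carry the entry at position `j` to the front, past entries that are no larger; each
equal entry costs a factor `t⁻¹`. -/
theorem downWord_mono (j : ℕ) (hj : j < m + 1) (ν : Comp (m + 1))
    (h : ∀ k : Fin (m + 1), (k : ℕ) < j → ν k ≤ ν ⟨j, hj⟩) :
    (downWord (TNat m ht) j : Module.End K (MvPolynomial (Fin (m + 1)) K)) (mono K ν) -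
      t⁻¹ ^ (Finset.univ.filter fun k : Fin (m + 1) => (k : ℕ) < j ∧ ν k = ν ⟨j, hj⟩).card •
        mono K (ν ∘ ⇑(downPerm m j)⁻¹) ∈ lower K (plus ν) := by
  induction j generalizing ν with
  | zero => simp [downWord_zero, downPerm]
  | succ j ih =>
    have hjm : j < m := Nat.lt_of_succ_lt_succ hj
    set i : Fin m := ⟨j, hjm⟩ with hi
    have ec : (⟨j, by omega⟩ : Fin (m + 1)) = i.castSucc := rfl
    have es : (⟨j + 1, hj⟩ : Fin (m + 1)) = i.succ := rfl
    have hs : ∀ k : Fin (m + 1), (k : ℕ) < j → simple i k = k := fun k hk =>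
      simple_apply_of_ne (by simp [hi]; omega) (by simp [hi]; omega)
    rw [es] at h ⊢
    rw [downWord_succ, Units.val_mul, Module.End.mul_apply, TNat_inv_val ht i]
    have h1 := downWord_mem_lower ht j hjm.le
      (Tinv_mono_le ht (h i.castSucc (by simp [hi])))
    have h2 := ih (by omega) (ν ∘ simple i) fun k hk => by
      rw [Function.comp, Function.comp, ec, simple_castSucc, hs k hk]
      exact h k (by omega)
    rw [map_sub, map_smul] at h1
    rw [plus_comp, ec] at h2
    have e1 : (Finset.univ.filter fun k : Fin (m + 1) =>
        (k : ℕ) < j ∧ (ν ∘ simple i) k = (ν ∘ simple i) i.castSucc) =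
        Finset.univ.filter fun k : Fin (m + 1) => (k : ℕ) < j ∧ ν k = ν i.succ := by
      refine Finset.filter_congr fun k _ => and_congr_right fun hk => ?_
      rw [Function.comp, Function.comp, simple_castSucc, hs k hk]
    have e2 : (ν ∘ simple i) ∘ ⇑(downPerm m j)⁻¹ = ν ∘ ⇑(downPerm m (j + 1))⁻¹ := by
      rw [downPerm_succ hjm, mul_inv_rev, simple_inv]
      rfl
    rw [e1, e2] at h2
    rw [card_filter_lt_succ (show j < m + 1 by omega), ec, pow_add, mul_comm, mul_smul]
    have e3 : t⁻¹ ^ (if ν i.castSucc = ν i.succ then 1 else 0) =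
        if ν i.castSucc = ν i.succ then t⁻¹ else 1 := by
      split_ifs <;> simp
    rw [e3]
    have := Submodule.add_mem _ h1 (Submodule.smul_mem _
      (if ν i.castSucc = ν i.succ then t⁻¹ else 1) h2)
    rwa [smul_sub, sub_add_sub_cancel] at this

/-- In `ν ∘ upPerm m j` the entry `ν_j` sits in the last position. The letters carry it back to
position `j` past entries that are no smaller, with a factor `t` for each equal one. -/
theorem upWord_mono {j : ℕ} (hj : j ≤ m) (ν : Comp (m + 1))
    (h : ∀ k : Fin (m + 1), j < (k : ℕ) → ν ⟨j, Nat.lt_succ_of_le hj⟩ ≤ ν k) :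
    (upWord (TNat m ht) m j : Module.End K (MvPolynomial (Fin (m + 1)) K))
        (mono K (ν ∘ upPerm m j)) -
      t ^ (Finset.univ.filter fun k : Fin (m + 1) =>
          j < (k : ℕ) ∧ ν k = ν ⟨j, Nat.lt_succ_of_le hj⟩).card • mono K ν ∈ lower K (plus ν) := by
  induction hj using Nat.decreasingInduction generalizing ν with
  | self =>
    rw [Finset.filter_false_of_mem]
    · simp [upWord_self, upPerm_self]
    · rintro k - ⟨hk, -⟩; omega
  | of_succ j hj ih =>
    set i : Fin m := ⟨j, hj⟩ with hi
    have ec : (⟨j, by omega⟩ : Fin (m + 1)) = i.castSucc := rfl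
    have es : (⟨j + 1, by omega⟩ : Fin (m + 1)) = i.succ := rfl
    have hs : ∀ k : Fin (m + 1), j + 1 < (k : ℕ) → simple i k = k := fun k hk =>
      simple_apply_of_ne (by simp [hi]; omega) (by simp [hi]; omega)
    rw [ec] at h ⊢
    have h2 := ih (ν ∘ simple i) fun k hk => by
      rw [Function.comp, Function.comp, es, simple_succ, hs k hk]
      exact h k (by omega)
    rw [plus_comp, es] at h2
    have e1 : (Finset.univ.filter fun k : Fin (m + 1) =>
        j + 1 < (k : ℕ) ∧ (ν ∘ simple i) k = (ν ∘ simple i) i.succ) =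
        Finset.univ.filter fun k : Fin (m + 1) => j + 1 < (k : ℕ) ∧ ν k = ν i.castSucc := by
      refine Finset.filter_congr fun k _ => and_congr_right fun hk => ?_
      rw [Function.comp, Function.comp, simple_succ, hs k hk]
    have e2 : (ν ∘ simple i) ∘ upPerm m (j + 1) = ν ∘ upPerm m j := by
      rw [upPerm_eq hj, Equiv.Perm.coe_mul]
      rfl
    rw [e1, e2] at h2
    have h1 := T_mono_ge (K := K) t (ν := ν ∘ simple i) (i := i)
      (by simpa using h i.succ (by simp [hi]))
    rw [comp_simple_comp_simple, plus_comp, Function.comp, Function.comp, simple_castSucc,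
      simple_succ] at h1
    have h3 := T_mem_lower t i h2
    rw [map_sub, map_smul] at h3
    rw [upWord_eq _ hj, Units.val_mul, Module.End.mul_apply, TNat_eq ht hj,
      card_filter_gt_succ (show j + 1 < m + 1 by omega), es, pow_add, mul_smul]
    have e3 : t ^ (if ν i.succ = ν i.castSucc then 1 else 0) =
        if ν i.succ = ν i.castSucc then t else 1 := by
      split_ifs <;> simp
    rw [e3]
    have := Submodule.add_mem _ h3 (Submodule.smul_mem _ (t ^ (Finset.univ.filter
      fun k : Fin (m + 1) => j + 1 < (k : ℕ) ∧ ν k = ν i.castSucc).card) h1)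
    rwa [smul_sub, sub_add_sub_cancel] at this

include ht in
-- The down word moves entry `i` to the front, `ω` multiplies by `q^{ν_i}` and rotates it to the
-- end, and the up word returns it to position `i`.
theorem Y_mono_of_monotone {ν : Comp (m + 1)} (hν : Monotone ν) (i : Fin (m + 1)) :
    Y q t i (mono K ν) - spec q t ν i • mono K ν ∈ lower K (plus ν) := by
  have hi : (i : ℕ) ≤ m := Nat.le_of_lt_succ i.2
  rw [Y_eq_cherednik q ht, cherednik, LinearMap.smul_apply, Module.End.mul_apply,
    Module.End.mul_apply]
  have h1 := downWord_mono ht (i : ℕ) i.2 ν fun k hk => hν (Fin.le_def.mpr hk.le)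
  have h2 := upWord_mono ht hi ν fun k hk => hν (Fin.le_def.mpr hk.le)
  have h3 := upWord_mem_lower ht hi (omega_mem_lower q h1)
  simp only [Fin.eta] at h1 h2 h3
  have e1 : (ν ∘ ⇑(downPerm m i)⁻¹) ∘ finRotate (m + 1) = ν ∘ upPerm m i := by
    rw [← downPerm_mul_upPerm hi, Equiv.Perm.coe_mul]
    funext k
    simp [Equiv.Perm.inv_def]
  have e2 : (ν ∘ ⇑(downPerm m i)⁻¹) 0 = ν i := by
    rw [← downPerm_apply hi]
    simp [Equiv.Perm.inv_def]
  rw [map_sub, map_sub, map_smul, map_smul, omega_mono, e1, e2, map_smul] at h3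
  set a := (Finset.univ.filter fun k : Fin (m + 1) => (k : ℕ) < i ∧ ν k = ν i).card with ha
  set b := (Finset.univ.filter fun k : Fin (m + 1) => (i : ℕ) < k ∧ ν k = ν i).card with hb
  have h4 := Submodule.add_mem _ h3 (Submodule.smul_mem _ (t⁻¹ ^ a * q ^ ν i) h2)
  rw [smul_sub, mul_smul, sub_add_sub_cancel] at h4
  have h5 := Submodule.smul_mem _ (t ^ ((i : ℤ) - (m : ℤ))) h4
  rw [smul_sub] at h5
  convert h5 using 2
  rw [smul_smul, smul_smul]
  congr 1
  -- The accumulated power of `t` is `(i - m) - a + b`. For increasing `ν` the leg colength counts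
  -- the `a` equal entries on the left and the `m - i - b` larger entries on the right.
  have hleg : legColength ν i + b = a + (m - i) := by
    unfold legColength
    have e3 : (Finset.univ.filter fun k => k < i ∧ ν i ≤ ν k).card = a := by
      rw [ha]
      congr 1
      refine Finset.filter_congr fun k _ => ?_
      rw [Fin.lt_def]
      exact and_congr_right fun hk =>
        ⟨fun h => le_antisymm (hν (Fin.le_def.mpr hk.le)) h, fun h => h.ge⟩
    have e4 : (Finset.univ.filter fun k => i < k ∧ ν i < ν k).card + b = m - i := by
      rw [hb, ← Finset.card_union_of_disjoint]
      · rw [← Finset.filter_or]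
        have : (Finset.univ.filter fun k : Fin (m + 1) =>
            i < k ∧ ν i < ν k ∨ (i : ℕ) < k ∧ ν k = ν i) = Finset.Ioi i := by
          ext k
          simp only [Finset.mem_filter, Finset.mem_univ, true_and, Finset.mem_Ioi, Fin.lt_def]
          constructor
          · rintro (h | h) <;> exact h.1
          · intro h
            have := hν (Fin.le_def.mpr h.le)
            omega
        rw [this, Fin.card_Ioi]
        omega
      · rw [Finset.disjoint_filter]
        rintro k - ⟨-, h⟩ ⟨-, h'⟩
        omega
    rw [e3, add_assoc, e4]
  have hz : (t : K) ^ ((i : ℤ) - (m : ℤ)) = t⁻¹ ^ (m - (i : ℕ)) := by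
    rw [inv_pow, ← zpow_natCast, ← zpow_neg]
    congr 1
    omega
  have hl : t⁻¹ ^ legColength ν i = t⁻¹ ^ a * t⁻¹ ^ (m - (i : ℕ)) * t ^ b := by
    rw [← pow_add, ← hleg, pow_add, mul_assoc, ← mul_pow, inv_mul_cancel₀ ht, one_pow, mul_one]
  rw [spec, hl, hz]
  ring

include ht in
-- Increasing exponents come from the separate `Y_i`. From `ν` to `s_i ν` the claim is transported
-- by `T_i`, which commutes with the sum and maps `x^ν` to `t x^{s_i ν} + (t - 1) x^ν` modulo lower
-- terms.
theorem sum_Y_mono (ν : Comp (m + 1)) :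
    (∑ i, Y q t i) (mono K ν) - eigen q t (plus ν) • mono K ν ∈ lower K (plus ν) := by
  induction ν using induction_invCount with
  | mono ν hν =>
    rw [← sum_spec, LinearMap.sum_apply, Finset.sum_smul, ← Finset.sum_sub_distrib]
    exact Submodule.sum_mem _ fun i _ => Y_mono_of_monotone ht hν i
  | swap ν i h ih =>
    rw [plus_comp]
    set Z : Module.End K (MvPolynomial (Fin (m + 1)) K) := ∑ i, Y q t i with hZ
    set c := eigen q t (plus ν)
    have hZm : ∀ p ∈ lower K (plus ν), Z p ∈ lower K (plus ν) := by
      intro p hp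
      rw [hZ, LinearMap.sum_apply]
      exact Submodule.sum_mem _ fun i _ => Y_mem_lower q t i hp
    have h1 := T_mono_lt (K := K) t h
    have h2 := hZm _ h1
    have h3 := T_mem_lower t i ih
    have hc : Z (T t i (mono K ν)) = T t i (Z (mono K ν)) :=
      (LinearMap.congr_fun (commute_T_sum_Y ht i).eq (mono K ν)).symm
    simp only [map_sub, map_add, map_smul, hc] at h2 h3
    -- Solves the commutation relation for the image of `x^{s_i ν}`; this is where `t` has to be
    -- inverted.
    have h4 := Submodule.smul_mem _ t⁻¹ (Submodule.add_mem _ (Submodule.sub_mem _ h3 h2)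
      (Submodule.sub_mem _ (Submodule.smul_mem _ c h1) (Submodule.smul_mem _ (t - 1) ih)))
    convert h4 using 1
    rw [eq_inv_smul_iff₀ ht]
    module

end Leading

end

end NSMacdonald

namespace NSMacdonald

noncomputable section

/-! ### Inversion generating functions -/

section Multinomial

variable {n : ℕ}

theorem invCount_eq_sum (ν : Comp n) :
    invCount ν = ∑ i, ∑ j, if i < j ∧ ν j < ν i then 1 else 0 := by
  rw [invCount, Finset.card_filter, ← Finset.univ_product_univ, Finset.sum_product]

theorem invCount_cons (a : ℕ) (ν : Comp n) :
    invCount (Fin.cons a ν : Comp (n + 1)) =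
      (Finset.univ.filter fun x => ν x < a).card + invCount ν := by
  rw [invCount_eq_sum, invCount_eq_sum, Fin.sum_univ_succ, Fin.sum_univ_succ, Finset.card_filter]
  simp only [Fin.sum_univ_succ (n := n), Fin.cons_zero, Fin.cons_succ, Fin.succ_lt_succ_iff,
    Fin.succ_pos, Fin.not_lt_zero, lt_irrefl, false_and, and_self, if_false, true_and, zero_add]

theorem sum_eq_add_sum_swap {M : Type*} [AddCommMonoid M] (f : Fin (n + 1) → M)
    (p : Fin (n + 1)) : ∑ k, f k = f p + ∑ x : Fin n, f (Equiv.swap 0 p x.succ) := by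
  rw [← Equiv.sum_comp (Equiv.swap 0 p), Fin.sum_univ_succ, Equiv.swap_apply_left]

theorem mult_eq_add (η : Comp (n + 1)) (p : Fin (n + 1)) (j : ℕ) :
    mult η j = (if η p = j then 1 else 0) + mult (fun x => η (Equiv.swap 0 p x.succ)) j := by
  simp only [mult, Finset.card_filter]
  exact sum_eq_add_sum_swap _ p

variable {K : Type*} [Field K]

theorem qFactorial_succ (u : K) (k : ℕ) :
    qFactorial u (k + 1) = qFactorial u k * ((1 - u ^ (k + 1)) / (1 - u)) := by
  rw [qFactorial, Finset.prod_range_succ, qFactorial]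

/-- The sum telescopes: the number of entries below `j + 1` is the number below `j` plus the
multiplicity of `j`. -/
theorem sum_pow_below (u : K) (η : Comp n) {N : ℕ} (hN : ∀ i, η i < N) :
    ∑ j ∈ Finset.range N, u ^ (Finset.univ.filter fun k => η k < j).card *
      ((1 - u ^ mult η j) / (1 - u)) = (1 - u ^ n) / (1 - u) := by
  have h : ∀ j, u ^ (Finset.univ.filter fun k => η k < j).card *
      ((1 - u ^ mult η j) / (1 - u)) = (u ^ (Finset.univ.filter fun k => η k < j).card -
        u ^ (Finset.univ.filter fun k => η k < j + 1).card) / (1 - u) := by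
    intro j
    have : (Finset.univ.filter fun k => η k < j + 1).card =
        (Finset.univ.filter fun k => η k < j).card + mult η j := by
      rw [mult, ← Finset.card_union_of_disjoint, ← Finset.filter_or]
      · congr 1
        exact Finset.filter_congr fun k _ => by omega
      · rw [Finset.disjoint_filter]
        intro k _ h1 h2
        omega
    rw [this, pow_add]
    ring
  rw [Finset.sum_congr rfl fun j _ => h j, ← Finset.sum_div,
    Finset.sum_range_sub' (fun j => u ^ (Finset.univ.filter fun k => η k < j).card)]
  congr 2
  · simp
  · rw [Finset.filter_true_of_mem fun k _ => hN k]
    simp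

/-- Each distinct rearrangement is reached by as many permutations as the stabilizer has, namely `∏
f_j!`. Values below `N` that do not occur contribute `0! = 1`. -/
theorem sum_comp_perm (κ : Comp n) {N : ℕ} (hN : ∀ i, κ i < N) (g : Comp n → K) :
    ∑ σ : Equiv.Perm (Fin n), g (κ ∘ σ) = (∏ j ∈ Finset.range N, ((mult κ j).factorial : K)) *
      ∑ ν ∈ Finset.univ.image (fun σ : Equiv.Perm (Fin n) => κ ∘ σ), g ν := by
  rw [Finset.sum_comp g (fun σ : Equiv.Perm (Fin n) => κ ∘ σ), Finset.mul_sum]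
  refine Finset.sum_congr rfl fun ν hν => ?_
  obtain ⟨τ, -, rfl⟩ := Finset.mem_image.mp hν
  rw [nsmul_eq_mul]
  congr 1
  have h1 : (Finset.univ.filter fun σ : Equiv.Perm (Fin n) => κ ∘ σ = κ ∘ τ).card =
      (Finset.univ.filter fun σ : Equiv.Perm (Fin n) => κ ∘ σ = κ).card := by
    refine Finset.card_equiv (Equiv.mulRight τ⁻¹) fun σ => ?_
    simp only [Finset.mem_filter, Finset.mem_univ, true_and, Equiv.coe_mulRight,
      Equiv.Perm.coe_mul, funext_iff, Function.comp]
    constructor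
    · intro h x
      have := h (τ⁻¹ x)
      simpa [Equiv.Perm.inv_def] using this
    · intro h x
      have := h (τ x)
      simpa [Equiv.Perm.inv_def] using this
  rw [h1, ← Fintype.card_subtype, DomMulAct.stabilizer_card']
  rw [← Nat.cast_prod]
  congr 1
  have h2 : ∀ j, Fintype.card {a // κ a = j} = mult κ j := fun j => by
    rw [Fintype.card_subtype]; rfl
  simp only [h2]
  refine Finset.prod_subset ?_ ?_
  · intro j hj
    obtain ⟨i, -, rfl⟩ := Finset.mem_image.mp hj
    exact Finset.mem_range.mpr (hN i)
  · intro j _ hj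
    have : mult κ j = 0 := by
      rw [mult, Finset.card_eq_zero, Finset.filter_eq_empty_iff]
      intro i _ hi
      exact hj (Finset.mem_image.mpr ⟨i, Finset.mem_univ i, hi⟩)
    rw [this]; rfl

variable [CharZero K]

/-- The `q`-multinomial theorem for the inversion statistic on the rearrangements of a tuple. -/
theorem sum_pow_invCount_mul (u : K) (η : Comp n) {N : ℕ} (hN : ∀ i, η i < N) :
    (∑ σ : Equiv.Perm (Fin n), u ^ invCount (η ∘ σ)) *
        ∏ j ∈ Finset.range N, qFactorial u (mult η j) =
      qFactorial u n * ∏ j ∈ Finset.range N, ((mult η j).factorial : K) := by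
  induction n with
  | zero => simp [mult, qFactorial, invCount]
  | succ n ih =>
    set η' : Fin (n + 1) → Comp n := fun p x => η (Equiv.swap 0 p x.succ) with hη'
    -- Permutations are split by the position `p` whose entry comes first. That entry makes one
    -- inversion with each smaller entry, and `η' p` lists the others.
    have hsum : ∑ σ : Equiv.Perm (Fin (n + 1)), u ^ invCount (η ∘ σ) =
        ∑ p, u ^ (Finset.univ.filter fun k => η k < η p).card *
          ∑ e : Equiv.Perm (Fin n), u ^ invCount (η' p ∘ e) := by
      rw [← Equiv.sum_comp Equiv.Perm.decomposeFin.symm, Fintype.sum_prod_type]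
      refine Finset.sum_congr rfl fun p _ => ?_
      rw [Finset.mul_sum]
      refine Finset.sum_congr rfl fun e _ => ?_
      have h1 : η ∘ Equiv.Perm.decomposeFin.symm (p, e) =
          (Fin.cons (η p) (η' p ∘ e) : Comp (n + 1)) := by
        funext x
        refine Fin.cases ?_ (fun x => ?_) x
        · simp
        · simp [hη']
      rw [h1, invCount_cons, pow_add]
      congr 2
      simp only [Finset.card_filter]
      rw [sum_eq_add_sum_swap _ p]
      simp only [lt_irrefl, if_false, zero_add]
      exact Equiv.sum_comp e fun x => if η' p x < η p then 1 else 0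
    -- Removing the entry at `p` lowers one multiplicity by one: a factor `(1 - u^f)/(1 - u)` leaves
    -- the `q`-factorials and a factor `f` leaves the ordinary ones.
    have hp : ∀ p, u ^ (Finset.univ.filter fun k => η k < η p).card *
          (∑ e : Equiv.Perm (Fin n), u ^ invCount (η' p ∘ e)) *
          ∏ j ∈ Finset.range N, qFactorial u (mult η j) =
        (u ^ (Finset.univ.filter fun k => η k < η p).card *
          ((1 - u ^ mult η (η p)) / (1 - u)) / (mult η (η p) : K)) *
          (qFactorial u n * ∏ j ∈ Finset.range N, ((mult η j).factorial : K)) := by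
      intro p
      have hmem := Finset.mem_range.mpr (hN p)
      have h1 := ih (η' p) fun x => hN _
      have hm : mult η (η p) = mult (η' p) (η p) + 1 := by
        rw [mult_eq_add η p, if_pos rfl, add_comm]
      have hne : ∀ j ∈ (Finset.range N).erase (η p), mult η j = mult (η' p) j := by
        intro j hj
        rw [mult_eq_add η p, if_neg (Finset.mem_erase.mp hj).1.symm, zero_add]
      have e1 : ∏ j ∈ Finset.range N, qFactorial u (mult η j) =
          ((1 - u ^ mult η (η p)) / (1 - u)) *
            ∏ j ∈ Finset.range N, qFactorial u (mult (η' p) j) := by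
        rw [← Finset.mul_prod_erase _ _ hmem, ← Finset.mul_prod_erase _ (fun j =>
          qFactorial u (mult (η' p) j)) hmem, hm, qFactorial_succ,
          Finset.prod_congr rfl fun j hj => by rw [hne j hj]]
        ring
      have e2 : ∏ j ∈ Finset.range N, ((mult η j).factorial : K) =
          (mult η (η p) : K) * ∏ j ∈ Finset.range N, ((mult (η' p) j).factorial : K) := by
        rw [← Finset.mul_prod_erase _ _ hmem, ← Finset.mul_prod_erase _ (fun j =>
          ((mult (η' p) j).factorial : K)) hmem, hm, Nat.factorial_succ,
          Finset.prod_congr rfl fun j hj => by rw [hne j hj]]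
        push_cast
        ring
      have h0 : (mult η (η p) : K) ≠ 0 := by rw [hm]; exact Nat.cast_ne_zero.mpr (Nat.succ_ne_zero _)
      have e3 : ∀ a b c : K, a / (mult η (η p) : K) * (b * ((mult η (η p) : K) * c)) =
          a * (b * c) := fun a b c => by field_simp
      rw [e1, e2, e3]
      linear_combination u ^ (Finset.univ.filter fun k => η k < η p).card *
        ((1 - u ^ mult η (η p)) / (1 - u)) * h1
    rw [hsum, Finset.sum_mul, Finset.sum_congr rfl fun p _ => hp p, ← Finset.sum_mul,
      qFactorial_succ, mul_comm (qFactorial u n) (_ / _), mul_assoc]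
    congr 1
    -- The positions are grouped by their value `j`; there are `f_j` of them, which cancels the
    -- division by `f_j`.
    rw [← sum_pow_below u η hN, ← Finset.sum_fiberwise_of_maps_to
      (s := Finset.univ) (t := Finset.range N) (g := η) fun p _ => Finset.mem_range.mpr (hN p)]
    refine Finset.sum_congr rfl fun j _ => ?_
    rw [Finset.sum_congr rfl (g := fun _ => u ^ (Finset.univ.filter fun k => η k < j).card *
      ((1 - u ^ mult η j) / (1 - u)) / (mult η j : K)) fun p hp => by
        rw [(Finset.mem_filter.mp hp).2], Finset.sum_const, nsmul_eq_mul]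
    change (mult η j : K) * _ = _
    rcases Nat.eq_zero_or_pos (mult η j) with h0 | h0
    · simp [h0]
    · have : (mult η j : K) ≠ 0 := Nat.cast_ne_zero.mpr h0.ne'
      field_simp

theorem sum_image_pow_invCount (u : K) (κ : Comp n) {N : ℕ} (hN : ∀ i, κ i < N) :
    (∑ ν ∈ Finset.univ.image (fun σ : Equiv.Perm (Fin n) => κ ∘ σ), u ^ invCount ν) *
      ∏ j ∈ Finset.range N, qFactorial u (mult κ j) = qFactorial u n := by
  have h1 := sum_pow_invCount_mul u κ hN
  rw [sum_comp_perm κ hN fun ν => u ^ invCount ν] at h1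
  have h0 : (∏ j ∈ Finset.range N, ((mult κ j).factorial : K)) ≠ 0 :=
    Finset.prod_ne_zero_iff.mpr fun j _ => Nat.cast_ne_zero.mpr (Nat.factorial_ne_zero _)
  apply mul_left_cancel₀ h0
  linear_combination h1

theorem invCount_add_invCount_rev {κ : Fin n → ℕ} (h : Function.Injective κ) :
    invCount κ + invCount (fun i => OrderDual.toDual (κ i)) = n * (n - 1) / 2 := by
  unfold invCount
  rw [← Finset.card_union_of_disjoint, ← Finset.filter_or]
  · have : (Finset.univ.filter fun p : Fin n × Fin n => (p.1 < p.2 ∧ κ p.2 < κ p.1) ∨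
        (p.1 < p.2 ∧ OrderDual.toDual (κ p.2) < OrderDual.toDual (κ p.1))) =
        Finset.univ.filter fun p : Fin n × Fin n => p.1 < p.2 := by
      refine Finset.filter_congr fun p _ => ?_
      rw [← and_or_left, OrderDual.toDual_lt_toDual]
      refine and_iff_left_of_imp fun hp => ?_
      exact lt_or_gt_of_ne fun he => hp.ne' (h he)
    rw [this, Finset.card_filter, ← Finset.univ_product_univ, Finset.sum_product_right,
      ← Finset.sum_range_id, ← Fin.sum_univ_eq_sum_range]
    refine Finset.sum_congr rfl fun j _ => ?_
    rw [← Finset.card_filter]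
    have : (Finset.univ.filter fun i : Fin n => i < j) = Finset.Iio j := by ext; simp
    rw [this, Fin.card_Iio]
  · rw [Finset.disjoint_filter]
    rintro p - ⟨-, h1⟩ ⟨-, h2⟩
    exact lt_asymm h1 (OrderDual.toDual_lt_toDual.mp h2)

theorem mult_le_one {κ : Comp n} (h : Function.Injective κ) (j : ℕ) : mult κ j ≤ 1 :=
  Finset.card_le_one.mpr fun _ ha _ hb => h
    ((Finset.mem_filter.mp ha).2.trans (Finset.mem_filter.mp hb).2.symm)

/-- The multinomial theorem at `u = t⁻¹` for a strictly decreasing tuple `κ`: the inversions of `κ ∘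
σ` are the non-inversions of `σ`, whence the factor `t^{n(n-1)/2}`. -/
theorem sum_pow_permLength {t : K} (ht : t ≠ 0) (ht1 : t ≠ 1) :
    ∑ σ : Equiv.Perm (Fin n), t ^ permLength σ =
      t ^ (n * (n - 1) / 2) * qFactorial t⁻¹ n := by
  set κ : Comp n := fun i => (Fin.rev i : ℕ) with hκ
  have hinj : Function.Injective κ := fun i j h => Fin.rev_injective (Fin.ext h)
  have hu : 1 - t⁻¹ ≠ 0 := by
    rw [sub_ne_zero]
    intro h
    exact ht1 (inv_eq_one.mp h.symm)
  have h1 := sum_pow_invCount_mul t⁻¹ κ (N := n) fun i => (Fin.rev i).2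
  have hq : ∀ j, qFactorial t⁻¹ (mult κ j) = 1 ∧ ((mult κ j).factorial : K) = 1 := by
    intro j
    have := mult_le_one hinj j
    interval_cases h : mult κ j
    · simp [qFactorial]
    · simp [qFactorial, hu]
  rw [Finset.prod_congr rfl fun j _ => (hq j).1, Finset.prod_congr rfl fun j _ => (hq j).2,
    Finset.prod_const_one, mul_one, mul_one] at h1
  rw [← h1, Finset.mul_sum]
  refine Finset.sum_congr rfl fun σ _ => ?_
  have h2 := invCount_add_invCount_rev (hinj.comp σ.injective)
  have h3 : invCount (fun i => OrderDual.toDual ((κ ∘ σ) i)) = permLength σ := by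
    unfold invCount permLength
    congr 1
    refine Finset.filter_congr fun p _ => and_congr_right fun _ => ?_
    rw [OrderDual.toDual_lt_toDual]
    exact Fin.rev_lt_rev
  rw [h3] at h2
  rw [← h2, pow_add, mul_assoc, mul_comm (t ^ permLength σ), ← mul_assoc, ← mul_pow,
    mul_inv_cancel₀ ht, one_pow, one_mul]

end Multinomial

end

end NSMacdonald

namespace NSMacdonald

open MvPolynomial

noncomputable section

/-! ### Separation of the eigenvalues -/

section Admissible

variable {n : ℕ}

/-- Abel summation; dominance is information about partial sums. -/
theorem sum_mul_eq_sum_partial_mul (d c : ℕ → ℝ) (n : ℕ) :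
    ∑ i ∈ Finset.range (n + 1), d i * c i = (∑ i ∈ Finset.range (n + 1), d i) * c n +
      ∑ p ∈ Finset.range n, (∑ i ∈ Finset.range (p + 1), d i) * (c p - c (p + 1)) := by
  induction n with
  | zero => simp
  | succ n ih =>
    rw [Finset.sum_range_succ, ih, Finset.sum_range_succ d (n + 1),
      Finset.sum_range_succ (fun p => (∑ i ∈ Finset.range (p + 1), d i) * (c p - c (p + 1)))]
    ring

theorem sum_mul_pos_of_partial {d c : ℕ → ℝ} {n : ℕ} (hc : ∀ p < n, c (p + 1) < c p)
    (h0 : ∑ i ∈ Finset.range (n + 1), d i = 0)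
    (hd : ∀ p ≤ n, 0 ≤ ∑ i ∈ Finset.range (p + 1), d i)
    (hpos : ∃ p ≤ n, 0 < ∑ i ∈ Finset.range (p + 1), d i) :
    0 < ∑ i ∈ Finset.range (n + 1), d i * c i := by
  rw [sum_mul_eq_sum_partial_mul, h0, zero_mul, zero_add]
  obtain ⟨p, hp, hpp⟩ := hpos
  have hpn : p < n := lt_of_le_of_ne hp fun h => by rw [h, h0] at hpp; exact lt_irrefl _ hpp
  refine Finset.sum_pos' (fun i hi => ?_) ⟨p, Finset.mem_range.mpr hpn, ?_⟩
  · rw [Finset.mem_range] at hi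
    exact mul_nonneg (hd i hi.le) (sub_nonneg.mpr (hc i hi).le)
  · exact mul_pos hpp (sub_pos.mpr (hc p hpn))

/-- Convexity of `k ↦ q^k`: at integers it lies above its chord through `l` and `l + 1`, of slope
`-(1 - q) q^l`. Bernoulli's inequality gives `k ≥ l`, a geometric sum gives `k ≤ l`. -/
theorem pow_sub_pow_ge {q : ℝ} (hq : 0 < q) (hq1 : q < 1) (k l : ℕ) :
    ((k : ℝ) - l) * (-(1 - q) * q ^ l) ≤ q ^ k - q ^ l := by
  rcases le_total l k with h | h
  · obtain ⟨d, rfl⟩ := Nat.exists_eq_add_of_le h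
    have h1 := one_add_mul_sub_le_pow (show (-1 : ℝ) ≤ q by linarith) d
    have h2 : 0 < q ^ l := pow_pos hq l
    rw [pow_add]
    push_cast
    nlinarith
  · obtain ⟨d, rfl⟩ := Nat.exists_eq_add_of_le h
    have h1 : (d : ℝ) * (1 - q) * q ^ d ≤ 1 - q ^ d := by
      have h2 := Finset.sum_le_sum (s := Finset.range d) (f := fun _ => q ^ d)
        (g := fun i => q ^ i) fun i hi =>
          pow_le_pow_of_le_one hq.le hq1.le (Finset.mem_range.mp hi).le
      rw [Finset.sum_const, Finset.card_range, nsmul_eq_mul] at h2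
      have h3 := mul_neg_geom_sum q d
      nlinarith
    have h2 : 0 < q ^ k := pow_pos hq k
    rw [pow_add]
    push_cast
    nlinarith

/-- For real parameters in `(0, 1)` the eigenvalues are strictly monotone in the dominance
order. -/
theorem eigen_lt_eigen {q t : ℝ} (hq : 0 < q) (hq1 : q < 1) (ht : 0 < t) (ht1 : t < 1)
    {μ κ : Comp n} (hμ : Antitone μ) (h : DomLT μ κ) : eigen q t μ < eigen q t κ := by
  obtain ⟨p₀, hp₀⟩ := h.exists_lt
  obtain ⟨n, rfl⟩ : ∃ k, n = k + 1 := ⟨n - 1, by have := p₀.2; omega⟩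
  set M : ℕ → ℕ := fun i => if h : i < n + 1 then μ ⟨i, h⟩ else 0 with hM
  set L : ℕ → ℕ := fun i => if h : i < n + 1 then κ ⟨i, h⟩ else 0 with hL
  have eM : ∀ i : Fin (n + 1), M i = μ i := fun i => by simp only [hM, dif_pos i.2]
  have eL : ∀ i : Fin (n + 1), L i = κ i := fun i => by simp only [hL, dif_pos i.2]
  have hpart : ∀ p : Fin (n + 1), ∑ i ∈ Finset.range ((p : ℕ) + 1), ((L i : ℝ) - M i) =
      (∑ i ∈ Finset.Iic p, κ i : ℕ) - (∑ i ∈ Finset.Iic p, μ i : ℕ) := by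
    intro p
    have : Finset.range ((p : ℕ) + 1) = (Finset.Iic p).map Fin.valEmbedding := by
      rw [Fin.map_valEmbedding_Iic]; ext; simp
    rw [this, Finset.sum_map, Finset.sum_sub_distrib]
    push_cast
    simp only [Fin.valEmbedding_apply, eM, eL]
  have htot : ∑ i ∈ Finset.range (n + 1), ((L i : ℝ) - M i) = 0 := by
    rw [Finset.sum_range]
    simp only [eM, eL, Finset.sum_sub_distrib]
    have := h.2.1
    rw [sub_eq_zero]
    exact_mod_cast this.symm
  have hti : 1 < t⁻¹ := (one_lt_inv₀ ht).mpr ht1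
  -- The weights are the chord slopes at `μ_i` times `t⁻ⁱ`. They decrease strictly because `μ` is
  -- decreasing and `t⁻¹ > 1`.
  have key := sum_mul_pos_of_partial (d := fun i => (L i : ℝ) - M i)
    (c := fun i => -((1 - q) * q ^ M i * t⁻¹ ^ i)) (n := n) (fun p hp => ?_) htot (fun p hp => ?_)
    ⟨p₀, Nat.le_of_lt_succ p₀.2, ?_⟩
  · rw [Finset.sum_range] at key
    have hle : ∀ i : Fin (n + 1), ((κ i : ℝ) - μ i) * -((1 - q) * q ^ μ i * t⁻¹ ^ (i : ℕ)) ≤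
        q ^ κ i * t⁻¹ ^ (i : ℕ) - q ^ μ i * t⁻¹ ^ (i : ℕ) := by
      intro i
      have h1 := mul_le_mul_of_nonneg_right (pow_sub_pow_ge hq hq1 (κ i) (μ i))
        (pow_nonneg (inv_nonneg.mpr ht.le) (i : ℕ))
      linarith
    simp only [eM, eL] at key
    have h2 := key.trans_le (Finset.sum_le_sum fun i _ => hle i)
    rw [Finset.sum_sub_distrib] at h2
    exact sub_pos.mp h2
  · have h1 : M (p + 1) ≤ M p := by
      simp only [hM, dif_pos (show p + 1 < n + 1 by omega), dif_pos (show p < n + 1 by omega)]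
      exact hμ (Fin.le_def.mpr (by simp))
    have h2 : q ^ M p ≤ q ^ M (p + 1) := pow_le_pow_of_le_one hq.le hq1.le h1
    have h3 : t⁻¹ ^ p < t⁻¹ ^ (p + 1) := pow_lt_pow_right₀ hti (Nat.lt_succ_self p)
    have h4 : 0 < t⁻¹ ^ p := pow_pos (by linarith) p
    have h5 : 0 < q ^ M (p + 1) := pow_pos hq _
    have h6 : q ^ M p * t⁻¹ ^ p < q ^ M (p + 1) * t⁻¹ ^ (p + 1) :=
      mul_lt_mul' h2 h3 h4.le h5
    have h7 := mul_lt_mul_of_pos_left h6 (sub_pos.mpr hq1)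
    linarith
  · have := hpart ⟨p, Nat.lt_succ_of_le hp⟩
    rw [this, sub_nonneg]
    exact_mod_cast h.2.2 _
  · rw [hpart, sub_pos]
    exact_mod_cast hp₀

variable {K : Type*} [Field K] [CharZero K] {q t : K}

/-- Polynomial identities with rational coefficients between admissible parameters hold for some
real parameters in `(0, 1)`. -/
theorem Admissible.exists_real (h : Admissible q t) :
    ∃ q' t' : ℝ, (0 < q' ∧ q' < 1) ∧ (0 < t' ∧ t' < 1) ∧
      ∀ p : MvPolynomial (Fin 2) ℚ, aeval ![q, t] p = 0 → aeval ![q', t'] p = 0 := by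
  rcases h with h | ⟨φ, h1, h2⟩
  -- Any point of the open square serves: algebraic independence leaves only the zero polynomial.
  · refine ⟨1 / 2, 1 / 2, by norm_num, by norm_num, fun p hp => ?_⟩
    rw [h (hp.trans (map_zero _).symm), map_zero]
  · refine ⟨φ q, φ t, h1, h2, fun p hp => ?_⟩
    have := congrArg φ.toRatAlgHom hp
    rw [map_zero, ← AlgHom.comp_apply, MvPolynomial.comp_aeval] at this
    convert this using 3
    funext i
    fin_cases i <;> rfl

theorem Admissible.q_ne_zero (h : Admissible q t) : q ≠ 0 := by
  obtain ⟨q', t', hq, -, hp⟩ := h.exists_real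
  intro h0
  have := hp (X 0) (by simp [h0])
  simp at this
  exact hq.1.ne' this

theorem Admissible.t_ne_zero (h : Admissible q t) : t ≠ 0 := by
  obtain ⟨q', t', -, ht, hp⟩ := h.exists_real
  intro h0
  have := hp (X 1) (by simp [h0])
  simp at this
  exact ht.1.ne' this

theorem Admissible.t_pow_ne_one (h : Admissible q t) (k : ℕ) : t ^ (k + 1) ≠ 1 := by
  obtain ⟨q', t', -, ht, hp⟩ := h.exists_real
  intro h0
  have := hp (X 1 ^ (k + 1) - 1) (by simp [h0])
  simp [sub_eq_zero] at this
  exact (pow_lt_one₀ ht.1.le ht.2 (Nat.succ_ne_zero k)).ne this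

theorem Admissible.one_add_t_ne_zero (h : Admissible q t) : 1 + t ≠ 0 := by
  obtain ⟨q', t', -, ht, hp⟩ := h.exists_real
  intro h0
  have := hp (1 + X 1) (by simp [h0])
  simp at this
  linarith [ht.1]

/-- The eigenvalue of a partition as a polynomial, after clearing denominators. -/
def eigenPoly (κ : Comp n) : MvPolynomial (Fin 2) ℚ :=
  ∑ i : Fin n, X 0 ^ κ i * X 1 ^ (n - (i : ℕ))

theorem aeval_eigenPoly (ht : t ≠ 0) (κ : Comp n) :
    aeval ![q, t] (eigenPoly κ) = t ^ n * eigen q t κ := by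
  simp only [eigenPoly, map_sum, map_mul, map_pow, aeval_X, eigen, Finset.mul_sum]
  refine Finset.sum_congr rfl fun i _ => ?_
  have : t ^ n = t ^ (n - (i : ℕ)) * t ^ (i : ℕ) := by
    rw [← pow_add, Nat.sub_add_cancel i.2.le]
  have hi : t ^ (i : ℕ) ≠ 0 := pow_ne_zero _ ht
  simp only [Matrix.cons_val_zero, Matrix.cons_val_one]
  rw [this, inv_pow]
  field_simp

theorem Admissible.eigen_ne (h : Admissible q t) {μ κ : Comp n} (hμ : Antitone μ)
    (hμκ : DomLT μ κ) : eigen q t μ ≠ eigen q t κ := by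
  have ht0 := h.t_ne_zero
  obtain ⟨q', t', hq, ht, hp⟩ := h.exists_real
  intro he
  have h1 := hp (eigenPoly μ - eigenPoly κ)
    (by rw [map_sub, aeval_eigenPoly ht0, aeval_eigenPoly ht0, he, sub_self])
  rw [map_sub, aeval_eigenPoly ht.1.ne', aeval_eigenPoly ht.1.ne', ← mul_sub] at h1
  have h2 := eigen_lt_eigen hq.1 hq.2 ht.1 ht.2 hμ hμκ
  rcases mul_eq_zero.mp h1 with h3 | h3
  · exact pow_ne_zero _ ht.1.ne' h3
  · linarith

theorem Admissible.qFactorial_ne_zero (h : Admissible q t) (k : ℕ) : qFactorial t⁻¹ k ≠ 0 := by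
  have h1 : ∀ k : ℕ, 1 - t⁻¹ ^ (k + 1) ≠ 0 := by
    intro k h0
    rw [sub_eq_zero, inv_pow] at h0
    exact h.t_pow_ne_one k (inv_eq_one.mp h0.symm)
  refine Finset.prod_ne_zero_iff.mpr fun i _ => div_ne_zero (h1 i) ?_
  simpa using h1 0

end Admissible

end

end NSMacdonald

namespace NSMacdonald

open MvPolynomial

noncomputable section

/-! ### Existence and uniqueness -/

section Existence

variable {K : Type*} [Field K] {m n : ℕ}

theorem finiteDimensional_lower (κ : Comp n) : FiniteDimensional K (lower K κ) := by
  refine FiniteDimensional.span_of_finite K ?_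
  have hf : {ν : Comp n | DomLT (plus ν) κ}.Finite := by
    refine (Set.finite_Icc (0 : Comp n) fun _ => ∑ i, κ i).subset fun ν hν => ⟨fun _ => Nat.zero_le _,
      fun i => ?_⟩
    have h : ∑ i, ν i = ∑ i, κ i := by rw [← hν.2.1, sum_plus ν fun x => x]
    exact (Finset.single_le_sum (fun _ _ => Nat.zero_le _) (Finset.mem_univ i)).trans h.le
  refine (hf.image (mono K)).subset ?_
  rintro _ ⟨ν, hν, rfl⟩
  exact ⟨ν, hν, rfl⟩

theorem sum_Y_mem_lower (q t : K) {κ : Comp (m + 1)} {p : MvPolynomial (Fin (m + 1)) K}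
    (hp : p ∈ lower K κ) : (∑ i, Y q t i) p ∈ lower K κ := by
  rw [LinearMap.sum_apply]
  exact Submodule.sum_mem _ fun i _ => Y_mem_lower q t i hp

/-- Triangularity with nonzero diagonal makes the operator minus `e` surjective on `lower K κ`: it
maps `x^ν` to a nonzero multiple of itself plus an element of `lower K (plus ν)`, whose preimage
comes from induction on the dominance rank. -/
theorem exists_sum_Y_sub_smul_eq {q t : K} (ht : t ≠ 0) {e : K} (κ : Comp (m + 1))
    (he : ∀ μ : Comp (m + 1), Antitone μ → DomLT μ κ → eigen q t μ ≠ e)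
    {p : MvPolynomial (Fin (m + 1)) K} (hp : p ∈ lower K κ) :
    ∃ r ∈ lower K κ, (∑ i, Y q t i) r - e • r = p := by
  induction hk : domRank κ using Nat.strong_induction_on generalizing κ p with
  | _ k ih =>
  induction hp using Submodule.span_induction with
  | mem x hx =>
    obtain ⟨ν, hν, rfl⟩ := hx
    have hc := sub_ne_zero.mpr (he _ (antitone_plus ν) hν)
    obtain ⟨r, hr, hr'⟩ := ih _ (hk ▸ hν.domRank_lt) (plus ν)
      (fun μ h1 h2 => he μ h1 (h2.trans hν)) (sum_Y_mono (q := q) ht ν) rfl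
    refine ⟨(eigen q t (plus ν) - e)⁻¹ • (mono K ν - r),
      Submodule.smul_mem _ _ (Submodule.sub_mem _ (mono_mem_lower hν) (lower_le_lower hν hr)), ?_⟩
    rw [map_smul, map_sub, smul_comm e, ← smul_sub, inv_smul_eq_iff₀ hc]
    have h1 : (∑ i, Y q t i) (mono K ν) =
        (∑ i, Y q t i) r - e • r + eigen q t (plus ν) • mono K ν := by rw [hr', sub_add_cancel]
    rw [h1]
    module
  | zero => exact ⟨0, Submodule.zero_mem _, by simp⟩
  | add x y _ _ hx hy =>
    obtain ⟨a, ha, rfl⟩ := hx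
    obtain ⟨b, hb, rfl⟩ := hy
    exact ⟨a + b, Submodule.add_mem _ ha hb, by rw [map_add]; module⟩
  | smul c x _ hx =>
    obtain ⟨a, ha, rfl⟩ := hx
    exact ⟨c • a, Submodule.smul_mem _ _ ha, by rw [map_smul]; module⟩

/-- A surjective endomorphism of a finite-dimensional space is injective. -/
theorem eq_zero_of_sum_Y_eq {q t : K} (ht : t ≠ 0) {e : K} {κ : Comp (m + 1)}
    (he : ∀ μ : Comp (m + 1), Antitone μ → DomLT μ κ → eigen q t μ ≠ e)
    {p : MvPolynomial (Fin (m + 1)) K} (hp : p ∈ lower K κ)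
    (h : (∑ i, Y q t i) p = e • p) : p = 0 := by
  have := finiteDimensional_lower (K := K) κ
  set A : Module.End K (MvPolynomial (Fin (m + 1)) K) := (∑ i, Y q t i) - e • 1 with hA
  have hAp : ∀ p, A p = (∑ i, Y q t i) p - e • p := fun p => by simp [hA]
  have hm : ∀ p ∈ lower K κ, A p ∈ lower K κ := fun p hp => by
    rw [hAp]
    exact Submodule.sub_mem _ (sum_Y_mem_lower q t hp) (Submodule.smul_mem _ _ hp)
  have hs : Function.Surjective (A.restrict hm) := by
    rintro ⟨p, hp⟩
    obtain ⟨r, hr, hr'⟩ := exists_sum_Y_sub_smul_eq ht κ he hp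
    exact ⟨⟨r, hr⟩, Subtype.ext (by rw [LinearMap.coe_restrict_apply, hAp, hr'])⟩
  have hi := LinearMap.injective_iff_surjective.mpr hs
  have h0 : A.restrict hm ⟨p, hp⟩ = A.restrict hm 0 := by
    refine Subtype.ext ?_
    rw [LinearMap.coe_restrict_apply, hAp, map_zero, h, sub_self]
    rfl
  exact congrArg Subtype.val (hi h0)

variable {q t : K}

theorem isNonsym_incr_iff {η : Comp (m + 1)} {f : MvPolynomial (Fin (m + 1)) K} :
    IsNonsym q t (incr η) f ↔ f - mono K (incr η) ∈ lower K (plus η) ∧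
      ∀ i, Y q t i f = spec q t (incr η) i • f := by
  unfold IsNonsym
  simp only [prec_incr_iff]
  rfl

theorem IsNonsym.sum_Y_eq {η : Comp (m + 1)} {f : MvPolynomial (Fin (m + 1)) K}
    (hf : IsNonsym q t (incr η) f) : (∑ i, Y q t i) f = eigen q t (plus η) • f := by
  rw [LinearMap.sum_apply, Finset.sum_congr rfl fun i _ => hf.2 i, ← Finset.sum_smul, sum_spec,
    plus_incr]

variable [CharZero K] (h : Admissible q t)

include h in
theorem Admissible.eq_zero_of_sum_Y_eq {κ : Comp (m + 1)} {p : MvPolynomial (Fin (m + 1)) K}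
    (hp : p ∈ lower K κ) (hZ : (∑ i, Y q t i) p = eigen q t κ • p) : p = 0 :=
  NSMacdonald.eq_zero_of_sum_Y_eq h.t_ne_zero (fun _ h1 h2 => h.eigen_ne h1 h2) hp hZ

include h in
theorem existsUnique_isNonsym (η : Comp (m + 1)) : ∃! f, IsNonsym q t (incr η) f := by
  refine existsUnique_of_exists_of_unique ?_ ?_
  · have h1 := sum_Y_mono (q := q) h.t_ne_zero (incr η)
    rw [plus_incr] at h1
    obtain ⟨r, hr, hr'⟩ := exists_sum_Y_sub_smul_eq h.t_ne_zero (plus η)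
      (fun _ h1 h2 => h.eigen_ne h1 h2) h1
    set f := mono K (incr η) - r with hf
    have hZ : (∑ i, Y q t i) f = eigen q t (plus η) • f := by
      rw [hf, map_sub, smul_sub, ← sub_eq_zero]
      rw [← sub_eq_zero] at hr'
      rw [← neg_eq_zero, ← hr']
      abel
    refine ⟨f, isNonsym_incr_iff.mpr ⟨?_, fun i => ?_⟩⟩
    · rw [hf, sub_sub_cancel_left]
      exact Submodule.neg_mem _ hr
    -- The defect `Y_i f - spec f` loses its leading term by `Y_mono_of_monotone` and inherits the
    -- eigenvalue of `f` because `Y_i` commutes with the sum, so it vanishes.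
    · rw [← sub_eq_zero]
      refine h.eq_zero_of_sum_Y_eq (κ := plus η) ?_ ?_
      · have h2 := Y_mono_of_monotone (q := q) h.t_ne_zero (monotone_incr η) i
        rw [plus_incr] at h2
        rw [hf, map_sub, smul_sub, sub_sub_sub_comm]
        exact Submodule.sub_mem _ h2
          (Submodule.sub_mem _ (Y_mem_lower q t i hr) (Submodule.smul_mem _ _ hr))
      · have hc := LinearMap.congr_fun (commute_Y_sum_Y h.q_ne_zero h.t_ne_zero i).eq f
        rw [Module.End.mul_apply, Module.End.mul_apply] at hc
        rw [map_sub, ← hc, map_smul _ (spec q t (incr η) i), hZ, map_smul]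
        module
  · intro f g hf hg
    rw [← sub_eq_zero]
    refine h.eq_zero_of_sum_Y_eq (κ := plus η) ?_ ?_
    · have := Submodule.sub_mem _ (isNonsym_incr_iff.mp hf).1 (isNonsym_incr_iff.mp hg).1
      rwa [sub_sub_sub_cancel_right] at this
    · rw [map_sub, hf.sum_Y_eq, hg.sum_Y_eq, smul_sub]

end Existence

/-! ### The antisymmetric case -/

section Antisymmetric

variable {K : Type*} [Field K] {m : ℕ} {q t : K}

/-- The span of the `q`-antisymmetric monomials below `κ`. -/
def lowerAnti (t : K) (κ : Comp (m + 1)) : Submodule K (MvPolynomial (Fin (m + 1)) K) :=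
  Submodule.span K {g | ∃ μ, StrictAnti μ ∧ DomLT μ κ ∧ g = monoAnti t μ}

theorem lowerAnti_mono {μ κ : Comp (m + 1)} (h : DomLT μ κ) : lowerAnti t μ ≤ lowerAnti t κ := by
  refine Submodule.span_le.mpr ?_
  rintro _ ⟨ν, h1, h2, rfl⟩
  exact Submodule.subset_span ⟨ν, h1, h2.trans h, rfl⟩

theorem lowerAnti_le_lower (κ : Comp (m + 1)) : lowerAnti t κ ≤ lower K κ := by
  refine Submodule.span_le.mpr ?_
  rintro _ ⟨ν, h1, h2, rfl⟩
  exact Uminus_mem_lower t (mono_mem_lower (by rwa [plus_of_antitone h1.antitone]))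

theorem Uminus_T_apply (ht : t ≠ 0) (i : Fin m) (p : MvPolynomial (Fin (m + 1)) K) :
    Uminus m t (T t i p) = -Uminus m t p :=
  LinearMap.congr_fun (Uminus_mul_T ht i) p

/-- Up to lower terms, `U⁻` sends a monomial to the `q`-antisymmetric monomial of its sorted
exponent, with a sign. -/
theorem exists_Uminus_mono (ht : t ≠ 0) (ν : Comp (m + 1)) :
    ∃ p ∈ lower K (plus ν), Uminus m t (mono K ν) =
      (-1 : K) ^ invCount (fun i => OrderDual.toDual (ν i)) • monoAnti t (plus ν) +
        Uminus m t p := by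
  -- Sorting is to end at a decreasing tuple, so the induction from increasing tuples is run in the
  -- dual order.
  suffices H : ∀ ν' : Fin (m + 1) → ℕᵒᵈ,
      ∃ p ∈ lower K (plus fun i => OrderDual.ofDual (ν' i)),
        Uminus m t (mono K fun i => OrderDual.ofDual (ν' i)) =
          (-1 : K) ^ invCount ν' • monoAnti t (plus fun i => OrderDual.ofDual (ν' i)) +
            Uminus m t p from H fun i => OrderDual.toDual (ν i)
  intro ν'
  induction ν' using induction_invCount with
  | mono ν' hν =>
    refine ⟨0, Submodule.zero_mem _, ?_⟩
    have ha : Antitone fun i => OrderDual.ofDual (ν' i) := fun _ _ hij => hν hij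
    rw [invCount_eq_zero_of_monotone hν, plus_of_antitone ha, map_zero, pow_zero, one_smul,
      add_zero, monoAnti]
  | swap ν' i hi ih =>
    obtain ⟨p, hp, hp'⟩ := ih
    set ν : Comp (m + 1) := fun i => OrderDual.ofDual (ν' i) with hν
    have e : (fun j => OrderDual.ofDual ((ν' ∘ simple i) j)) = ν ∘ simple i := rfl
    rw [e, plus_comp, invCount_comp_simple hi]
    have h1 := T_mono_gt (K := K) t (ν := ν) (i := i) hi
    -- Up to the lower error, `x^{s_i ν}` is `T_i x^ν`, and `U⁻ T_i = -U⁻` produces the sign.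
    refine ⟨-p - (T t i (mono K ν) - mono K (ν ∘ simple i)),
      Submodule.sub_mem _ (Submodule.neg_mem _ hp) h1, ?_⟩
    rw [map_sub, map_sub, map_neg, Uminus_T_apply ht, hp', pow_succ]
    module

/-- At equal neighbours `T_i` multiplies the monomial by `t`, while `U⁻ T_i = -U⁻`; hence `1 + t`
annihilates the result. -/
theorem monoAnti_eq_zero (ht : t ≠ 0) (ht1 : 1 + t ≠ 0) {μ : Comp (m + 1)} (h : Antitone μ)
    (hs : ¬ StrictAnti μ) : monoAnti t μ = 0 := by
  obtain ⟨i, hi⟩ := exists_eq_castSucc_succ h hs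
  have h1 := Uminus_T_apply ht i (mono K μ)
  rw [T_mono_eq t hi, map_smul, ← add_eq_zero_iff_eq_neg] at h1
  have h2 : (1 + t) • monoAnti t μ = 0 := by
    rw [add_comm (1 : K), add_smul, one_smul]; exact h1
  exact (smul_eq_zero.mp h2).resolve_left ht1

/-- The error in `exists_Uminus_mono` lies strictly below, so induction on the rank rewrites
everything in antisymmetric monomials; those with repeated parts vanish. -/
theorem Uminus_mem_lowerAnti (ht : t ≠ 0) (ht1 : 1 + t ≠ 0) (κ : Comp (m + 1))
    {p : MvPolynomial (Fin (m + 1)) K} (hp : p ∈ lower K κ) : Uminus m t p ∈ lowerAnti t κ := by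
  induction hk : domRank κ using Nat.strong_induction_on generalizing κ p with
  | _ k ih =>
  induction hp using Submodule.span_induction with
  | mem x hx =>
    obtain ⟨ν, hν, rfl⟩ := hx
    obtain ⟨r, hr, hr'⟩ := exists_Uminus_mono ht ν
    rw [hr']
    refine Submodule.add_mem _ (Submodule.smul_mem _ _ ?_)
      (lowerAnti_mono hν (ih _ (hk ▸ hν.domRank_lt) (plus ν) hr rfl))
    by_cases hs : StrictAnti (plus ν)
    · exact Submodule.subset_span ⟨plus ν, hs, hν, rfl⟩
    · rw [monoAnti_eq_zero ht ht1 (antitone_plus ν) hs]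
      exact Submodule.zero_mem _
  | zero => rw [map_zero]; exact Submodule.zero_mem _
  | add x y _ _ hx hy => rw [map_add]; exact Submodule.add_mem _ hx hy
  | smul c x _ hx => rw [map_smul]; exact Submodule.smul_mem _ _ hx

variable [CharZero K] (h : Admissible q t)

include h in
-- An increasing tuple of distinct parts has all `n(n-1)/2` pairs in the wrong order, which fixes
-- the sign of the leading term; the prefactor squares it to `1`.
theorem isAnti_Uminus {η : Comp (m + 1)} (hη : Function.Injective η)
    {f : MvPolynomial (Fin (m + 1)) K} (hf : IsNonsym q t (incr η) f) :
    IsAnti q t (plus η) (((-1 : K) ^ ((m + 1) * m / 2)) • Uminus m t f) := by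
  have hinj : Function.Injective (incr η) := by
    obtain ⟨σ, hσ⟩ := incr_eq_comp η
    rw [hσ]
    exact hη.comp σ.injective
  have hN := invCount_add_invCount_rev hinj
  rw [invCount_eq_zero_of_monotone (monotone_incr η), zero_add, Nat.add_sub_cancel] at hN
  constructor
  · obtain ⟨p, hp, hp'⟩ := exists_Uminus_mono h.t_ne_zero (incr η)
    rw [plus_incr, hN] at hp'
    rw [plus_incr] at hp
    have hw := (isNonsym_incr_iff.mp hf).1
    have e : Uminus m t f = (-1 : K) ^ ((m + 1) * m / 2) • monoAnti t (plus η) +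
        Uminus m t (p + (f - mono K (incr η))) := by
      rw [map_add, map_sub, hp']
      abel
    rw [e, smul_add, smul_smul, ← mul_pow, neg_one_mul, neg_neg, one_pow, one_smul,
      add_sub_cancel_left]
    exact Submodule.smul_mem _ _
      (Uminus_mem_lowerAnti h.t_ne_zero h.one_add_t_ne_zero _ (Submodule.add_mem _ hp hw))
  · have hc := LinearMap.congr_fun (commute_Uminus_sum_Y (m := m) (q := q) h.t_ne_zero).eq f
    rw [Module.End.mul_apply, Module.End.mul_apply] at hc
    rw [map_smul, ← hc, hf.sum_Y_eq, sum_spec, plus_plus, map_smul, smul_comm]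

include h in
theorem IsAnti.unique {κ : Comp (m + 1)} (hκ : Antitone κ) {f g : MvPolynomial (Fin (m + 1)) K}
    (hf : IsAnti q t κ f) (hg : IsAnti q t κ g) : f = g := by
  rw [← sub_eq_zero]
  refine h.eq_zero_of_sum_Y_eq (κ := κ) (lowerAnti_le_lower (t := t) κ ?_) ?_
  · have := Submodule.sub_mem _ hf.1 hg.1
    rwa [sub_sub_sub_cancel_right] at this
  · rw [map_sub, hf.2, hg.2, sum_spec, plus_of_antitone hκ, smul_sub]

end Antisymmetric

end

end NSMacdonald

namespace NSMacdonald

open MvPolynomial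

noncomputable section

/-! ### The symmetric case -/

section Symmetric

variable {K : Type*} [Field K] {m n : ℕ}

/-- The coefficient of `x^ν`. -/
def coeffAt (ν : Comp n) (p : MvPolynomial (Fin n) K) : K :=
  coeff (Finsupp.equivFunOnFinite.symm ν) p

theorem mono_eq_monomial (ν : Comp n) :
    mono K ν = monomial (Finsupp.equivFunOnFinite.symm ν) 1 := by
  rw [monomial_eq, C_1, one_mul, Finsupp.prod_fintype _ _ fun i => pow_zero _]
  rfl

theorem coeffAt_mono (ν μ : Comp n) : coeffAt ν (mono K μ) = if μ = ν then 1 else 0 := by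
  rw [coeffAt, mono_eq_monomial, coeff_monomial]
  simp only [EmbeddingLike.apply_eq_iff_eq]

theorem coeffAt_add (ν : Comp n) (p r : MvPolynomial (Fin n) K) :
    coeffAt ν (p + r) = coeffAt ν p + coeffAt ν r := coeff_add _ _ _

theorem coeffAt_smul (ν : Comp n) (c : K) (p : MvPolynomial (Fin n) K) :
    coeffAt ν (c • p) = c * coeffAt ν p := coeff_smul _ _ _

theorem coeffAt_zero (ν : Comp n) : coeffAt ν (0 : MvPolynomial (Fin n) K) = 0 := coeff_zero _

theorem coeffAt_sum {ι : Type*} (ν : Comp n) (s : Finset ι) (f : ι → MvPolynomial (Fin n) K) :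
    coeffAt ν (∑ i ∈ s, f i) = ∑ i ∈ s, coeffAt ν (f i) := coeff_sum _ _ _

theorem ext_coeffAt {p r : MvPolynomial (Fin n) K} (h : ∀ ν, coeffAt ν p = coeffAt ν r) :
    p = r := by
  refine MvPolynomial.ext _ _ fun d => ?_
  have := h (Finsupp.equivFunOnFinite d)
  rwa [coeffAt, coeffAt, Equiv.symm_apply_apply] at this

theorem coeffAt_rename (σ : Equiv.Perm (Fin n)) (ν : Comp n) (p : MvPolynomial (Fin n) K) :
    coeffAt ν (rename σ p) = coeffAt (ν ∘ σ) p := by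
  have e : Finsupp.equivFunOnFinite.symm ν =
      (Finsupp.equivFunOnFinite.symm (ν ∘ σ)).mapDomain σ := by
    ext i
    obtain ⟨j, rfl⟩ := σ.surjective i
    rw [Finsupp.mapDomain_apply σ.injective]
    rfl
  rw [coeffAt, e, coeff_rename_mapDomain _ σ.injective, coeffAt]

theorem mem_of_coeffAt_ne_zero {S : Set (Comp n)} {p : MvPolynomial (Fin n) K}
    (hp : p ∈ spanMono K S) {ν : Comp n} (hν : coeffAt ν p ≠ 0) : plus ν ∈ S := by
  contrapose! hν
  induction hp using Submodule.span_induction with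
  | mem x hx =>
    obtain ⟨μ, hμ, rfl⟩ := hx
    rw [coeffAt_mono, if_neg]
    rintro rfl
    exact hν hμ
  | zero => exact coeffAt_zero ν
  | add x y _ _ hx hy => rw [coeffAt_add, hx, hy, add_zero]
  | smul c x _ hx => rw [coeffAt_smul, hx, mul_zero]

theorem mem_image_comp_iff {μ ν : Comp n} :
    ν ∈ Finset.univ.image (fun σ : Equiv.Perm (Fin n) => μ ∘ σ) ↔ plus ν = plus μ := by
  constructor
  · intro h
    obtain ⟨σ, -, rfl⟩ := Finset.mem_image.mp h
    exact plus_comp μ σ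
  · intro h
    obtain ⟨σ, hσ⟩ := exists_comp_of_plus_eq h
    exact Finset.mem_image.mpr ⟨σ, Finset.mem_univ σ, hσ.symm⟩

theorem coeffAt_monoSymm (μ ν : Comp n) :
    coeffAt ν (monoSymm K μ) = if plus ν = plus μ then 1 else 0 := by
  rw [monoSymm, coeffAt_sum]
  simp only [coeffAt_mono]
  rw [Finset.sum_ite_eq']
  simp only [mem_image_comp_iff]

theorem monoSymm_mem_lower {μ κ : Comp n} (hμ : Antitone μ) (h : DomLT μ κ) :
    monoSymm K μ ∈ lower K κ := by
  refine Submodule.sum_mem _ fun ν hν => mono_mem_lower ?_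
  rwa [mem_image_comp_iff.mp hν, plus_of_antitone hμ]

/-- The span of the monomial symmetric polynomials below `κ`. -/
def lowerSymm (K : Type*) [Field K] (κ : Comp n) : Submodule K (MvPolynomial (Fin n) K) :=
  Submodule.span K {g | ∃ μ, Antitone μ ∧ DomLT μ κ ∧ g = monoSymm K μ}

theorem lowerSymm_le_lower (κ : Comp n) : lowerSymm K κ ≤ lower K κ := by
  refine Submodule.span_le.mpr ?_
  rintro _ ⟨μ, h1, h2, rfl⟩
  exact monoSymm_mem_lower h1 h2

/-- The partitions below or equal to `κ`. -/
def upTo (κ : Comp n) : Set (Comp n) := {μ | μ = κ ∨ DomLT μ κ}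

theorem upTo_closed (κ : Comp n) : ∀ μ ν, DomLT μ ν → ν ∈ upTo κ → μ ∈ upTo κ := by
  rintro μ ν h (rfl | h')
  · exact Or.inr h
  · exact Or.inr (h.trans h')

/-- The coefficients of a symmetric polynomial are constant on orbits, so it is the sum of `m_μ`
over the sorted exponents of its support, with the corresponding coefficients. -/
theorem sub_smul_monoSymm_mem {κ : Comp n} (hκ : Antitone κ) {f : MvPolynomial (Fin n) K}
    (hf : f ∈ spanMono K (upTo κ)) (hs : ∀ σ : Equiv.Perm (Fin n), rename σ f = f) :
    f - coeffAt κ f • monoSymm K κ ∈ lowerSymm K κ := by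
  have hc : ∀ ν, coeffAt (plus ν) f = coeffAt ν f := by
    intro ν
    obtain ⟨σ, hσ⟩ := plus_eq_comp ν
    rw [hσ, ← coeffAt_rename, hs]
  set A : Finset (Comp n) := f.support.image fun d : Fin n →₀ ℕ => plus ⇑d with hA
  have hmem : ∀ ν, coeffAt ν f ≠ 0 → plus ν ∈ A := fun ν hν =>
    Finset.mem_image.mpr ⟨Finsupp.equivFunOnFinite.symm ν, mem_support_iff.mpr hν, rfl⟩
  have hAp : ∀ μ ∈ A, Antitone μ ∧ μ ∈ upTo κ := by
    intro μ hμ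
    obtain ⟨d, hd, rfl⟩ := Finset.mem_image.mp hμ
    refine ⟨antitone_plus _, mem_of_coeffAt_ne_zero hf ?_⟩
    rw [coeffAt, show Finsupp.equivFunOnFinite.symm ⇑d = d from Equiv.symm_apply_apply _ d]
    exact mem_support_iff.mp hd
  have hsum : f = ∑ μ ∈ A, coeffAt μ f • monoSymm K μ := by
    refine ext_coeffAt fun ν => ?_
    rw [coeffAt_sum]
    have : ∀ μ ∈ A, coeffAt ν (coeffAt μ f • monoSymm K μ) =
        if plus ν = μ then coeffAt ν f else 0 := by
      intro μ hμ
      rw [coeffAt_smul, coeffAt_monoSymm, plus_of_antitone (hAp μ hμ).1]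
      split_ifs with h
      · rw [← h, hc, mul_one]
      · rw [mul_zero]
    rw [Finset.sum_congr rfl this, Finset.sum_ite_eq]
    split_ifs with h
    · rfl
    · by_contra h0
      exact h (hmem ν h0)
  have hlow : ∑ μ ∈ A.erase κ, coeffAt μ f • monoSymm K μ ∈ lowerSymm K κ := by
    refine Submodule.sum_mem _ fun μ hμ => Submodule.smul_mem _ _ ?_
    obtain ⟨h1, h2⟩ := Finset.mem_erase.mp hμ
    obtain ⟨h3, h4⟩ := hAp μ h2
    exact Submodule.subset_span ⟨μ, h3, h4.resolve_left h1, rfl⟩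
  by_cases hκA : κ ∈ A
  · rw [← Finset.add_sum_erase _ _ hκA] at hsum
    nth_rw 1 [hsum]
    rwa [add_sub_cancel_left]
  · rw [Finset.erase_eq_of_notMem hκA, ← hsum] at hlow
    have h0 : coeffAt κ f = 0 := by
      by_contra h0
      have := hmem κ h0
      rw [plus_of_antitone hκ] at this
      exact hκA this
    rwa [h0, zero_smul, sub_zero]

theorem rename_eq_of_swapOp_eq {f : MvPolynomial (Fin (m + 1)) K}
    (hf : ∀ i, swapOp i f = f) (σ : Equiv.Perm (Fin (m + 1))) : rename σ f = f := by
  obtain ⟨w, rfl, -⟩ := exists_word_permLength σ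
  induction w with
  | nil => simp
  | cons i w ih =>
    rw [List.map_cons, List.prod_cons, Equiv.Perm.coe_mul, ← rename_rename, ih]
    exact hf i

/-- A functional on the span of the rearrangements of `κ` that is an eigenvector of the transposed
Demazure-Lustig operators. -/
def invFunctional (u : K) (κ : Comp n) (p : MvPolynomial (Fin n) K) : K :=
  ∑ ν ∈ Finset.univ.image (fun σ : Equiv.Perm (Fin n) => κ ∘ σ), u ^ invCount ν * coeffAt ν p

theorem invFunctional_add (u : K) (κ : Comp n) (p r : MvPolynomial (Fin n) K) :
    invFunctional u κ (p + r) = invFunctional u κ p + invFunctional u κ r := by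
  simp only [invFunctional, coeffAt_add, mul_add, Finset.sum_add_distrib]

theorem invFunctional_smul (u : K) (κ : Comp n) (c : K) (p : MvPolynomial (Fin n) K) :
    invFunctional u κ (c • p) = c * invFunctional u κ p := by
  rw [invFunctional, invFunctional, Finset.mul_sum]
  exact Finset.sum_congr rfl fun ν _ => by rw [coeffAt_smul, mul_left_comm]

theorem invFunctional_sum {ι : Type*} (u : K) (κ : Comp n) (s : Finset ι)
    (f : ι → MvPolynomial (Fin n) K) :
    invFunctional u κ (∑ i ∈ s, f i) = ∑ i ∈ s, invFunctional u κ (f i) := by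
  simp only [invFunctional, coeffAt_sum, Finset.mul_sum]
  exact Finset.sum_comm

theorem invFunctional_mono (u : K) (κ ν : Comp n) :
    invFunctional u κ (mono K ν) = if plus ν = plus κ then u ^ invCount ν else 0 := by
  simp only [invFunctional, coeffAt_mono, mul_ite, mul_one, mul_zero]
  rw [Finset.sum_ite_eq]
  simp only [mem_image_comp_iff]

theorem invFunctional_eq_zero (u : K) {κ : Comp n} (hκ : Antitone κ)
    {p : MvPolynomial (Fin n) K} (hp : p ∈ lower K κ) : invFunctional u κ p = 0 := by
  refine Finset.sum_eq_zero fun ν hν => ?_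
  have : coeffAt ν p = 0 := by
    by_contra h0
    have := mem_of_coeffAt_ne_zero hp h0
    rw [mem_image_comp_iff.mp hν, plus_of_antitone hκ] at this
    exact not_domLT_self κ this
  rw [this, mul_zero]

theorem invFunctional_monoSymm (u : K) (κ : Comp n) :
    invFunctional u κ (monoSymm K κ) =
      ∑ ν ∈ Finset.univ.image (fun σ : Equiv.Perm (Fin n) => κ ∘ σ), u ^ invCount ν := by
  rw [monoSymm, invFunctional_sum]
  refine Finset.sum_congr rfl fun ν hν => ?_
  rw [invFunctional_mono, if_pos (mem_image_comp_iff.mp hν)]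

/-- Lower terms are invisible. An exchange of increasing neighbours multiplies the weight by `t⁻¹`,
and `t · t⁻¹ + (t - 1) = t`; an exchange of decreasing neighbours multiplies it by `t`. -/
theorem invFunctional_T {t : K} (ht : t ≠ 0) (i : Fin m) {κ : Comp (m + 1)} (hκ : Antitone κ)
    {p : MvPolynomial (Fin (m + 1)) K} (hp : p ∈ spanMono K (upTo κ)) :
    invFunctional t⁻¹ κ (T t i p) = t * invFunctional t⁻¹ κ p := by
  induction hp using Submodule.span_induction with
  | mem x hx =>
    obtain ⟨ν, hν | hν, rfl⟩ := hx
    · have hz : ∀ {r}, r ∈ lower K (plus ν) → invFunctional t⁻¹ κ r = 0 := fun hr =>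
        invFunctional_eq_zero _ hκ (hν ▸ hr)
      have e1 : invFunctional t⁻¹ κ (mono K ν) = t⁻¹ ^ invCount ν := by
        rw [invFunctional_mono, if_pos (by rw [hν, plus_of_antitone hκ])]
      have e2 : invFunctional t⁻¹ κ (mono K (ν ∘ simple i)) = t⁻¹ ^ invCount (ν ∘ simple i) := by
        rw [invFunctional_mono, if_pos (by rw [plus_comp, hν, plus_of_antitone hκ])]
      rcases lt_trichotomy (ν i.castSucc) (ν i.succ) with h | h | h
      · rw [← sub_add_cancel (T t i (mono K ν))
          (t • mono K (ν ∘ simple i) + (t - 1) • mono K ν), invFunctional_add,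
          hz (T_mono_lt t h), invFunctional_add, invFunctional_smul, invFunctional_smul, e1, e2,
          invCount_comp_simple h, pow_succ]
        field_simp
        ring
      · rw [T_mono_eq t h, invFunctional_smul]
      · rw [← sub_add_cancel (T t i (mono K ν)) (mono K (ν ∘ simple i)), invFunctional_add,
          hz (T_mono_gt t h), zero_add, e1, e2, ← invCount_comp_simple' h, pow_succ]
        field_simp
    · rw [invFunctional_eq_zero _ hκ (mono_mem_lower hν),
        invFunctional_eq_zero _ hκ (T_mem_lower t i (mono_mem_lower hν)), mul_zero]
  | zero =>
    rw [map_zero, invFunctional_eq_zero _ hκ (Submodule.zero_mem _), mul_zero]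
  | add x y _ _ hx hy => rw [map_add, invFunctional_add, invFunctional_add, hx, hy, mul_add]
  | smul c x _ hx =>
    rw [map_smul, invFunctional_smul, invFunctional_smul, hx, mul_left_comm]

theorem invFunctional_list_prod {t : K} (ht : t ≠ 0) {κ : Comp (m + 1)} (hκ : Antitone κ)
    (w : List (Fin m)) {p : MvPolynomial (Fin (m + 1)) K} (hp : p ∈ spanMono K (upTo κ)) :
    (w.map (T t)).prod p ∈ spanMono K (upTo κ) ∧
      invFunctional t⁻¹ κ ((w.map (T t)).prod p) = t ^ w.length * invFunctional t⁻¹ κ p := by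
  induction w with
  | nil => simpa using hp
  | cons i w ih =>
    rw [List.map_cons, List.prod_cons, Module.End.mul_apply, List.length_cons]
    refine ⟨T_mem_spanMono t i (upTo_closed κ) ih.1, ?_⟩
    rw [invFunctional_T ht i hκ ih.1, ih.2, pow_succ]
    ring

theorem invFunctional_Uplus {t : K} (ht : t ≠ 0) {κ : Comp (m + 1)} (hκ : Antitone κ)
    {p : MvPolynomial (Fin (m + 1)) K} (hp : p ∈ spanMono K (upTo κ)) :
    invFunctional t⁻¹ κ (Uplus m t p) =
      (∑ σ : Equiv.Perm (Fin (m + 1)), t ^ permLength σ) * invFunctional t⁻¹ κ p := by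
  rw [Uplus, LinearMap.sum_apply, invFunctional_sum, Finset.sum_mul]
  refine Finset.sum_congr rfl fun σ _ => ?_
  rw [Tperm, (invFunctional_list_prod ht hκ _ hp).2,
    (isReducedWord_iff.mp (exists_reducedWord σ).choose_spec).2]

theorem mult_plus (η : Comp n) (j : ℕ) : mult (plus η) j = mult η j := by
  simp only [mult, Finset.card_filter]
  exact sum_plus η fun x => if x = j then 1 else 0

variable [CharZero K] {q t : K} (h : Admissible q t)

include h in
-- The functional is evaluated on `U⁺ f` twice: through `f`, where it is `1` because `η^R` has no
-- inversions, and through the expansion of `U⁺ f`, where only the `m_κ` term counts.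
theorem coeffAt_Uplus {η : Comp (m + 1)} {f : MvPolynomial (Fin (m + 1)) K}
    (hf : IsNonsym q t (incr η) f)
    (hc : Uplus m t f - coeffAt (plus η) (Uplus m t f) • monoSymm K (plus η) ∈
      lowerSymm K (plus η)) :
    coeffAt (plus η) (Uplus m t f) = t ^ ((m + 1) * m / 2) *
      ∏ j ∈ Finset.range (plus η 0 + 1), qFactorial t⁻¹ (mult η j) := by
  have ht := h.t_ne_zero
  have hκ := antitone_plus η
  have hw := (isNonsym_incr_iff.mp hf).1
  have hx : mono K (incr η) ∈ spanMono K (upTo (plus η)) :=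
    mono_mem_spanMono (Or.inl (plus_incr η))
  have hfm : f ∈ spanMono K (upTo (plus η)) := by
    rw [← sub_add_cancel f (mono K (incr η))]
    exact Submodule.add_mem _ (lower_le_spanMono (upTo_closed _) (Or.inl rfl) hw) hx
  have e1 : invFunctional t⁻¹ (plus η) f = 1 := by
    rw [← sub_add_cancel f (mono K (incr η)), invFunctional_add, invFunctional_eq_zero _ hκ hw,
      invFunctional_mono, if_pos (by rw [plus_incr, plus_plus]),
      invCount_eq_zero_of_monotone (monotone_incr η), pow_zero, zero_add]
  have e2 := invFunctional_Uplus ht hκ hfm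
  have ht1 : t ≠ 1 := by simpa using h.t_pow_ne_one 0
  rw [e1, mul_one, sum_pow_permLength ht ht1, Nat.add_sub_cancel,
    ← sub_add_cancel (Uplus m t f) (coeffAt (plus η) (Uplus m t f) • monoSymm K (plus η)),
    invFunctional_add, invFunctional_eq_zero _ hκ (lowerSymm_le_lower _ hc), zero_add,
    invFunctional_smul, invFunctional_monoSymm] at e2
  have e3 := sum_image_pow_invCount t⁻¹ (plus η) (N := plus η 0 + 1)
    fun i => Nat.lt_succ_of_le (hκ (Fin.zero_le i))
  simp only [mult_plus] at e3
  -- Being a factor of `[n]_{1/t}!`, the inversion sum over rearrangements is nonzero and may be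
  -- cancelled.
  have h0 : qFactorial t⁻¹ (m + 1) ≠ 0 := h.qFactorial_ne_zero _
  rw [← e3] at e2 h0
  apply mul_left_cancel₀ (left_ne_zero_of_mul h0)
  linear_combination e2

include h in
-- Symmetry comes from `T_i U⁺ = t U⁺`, the eigenvalue from commutation with the sum, and the scalar
-- is the inverse of the coefficient found in `coeffAt_Uplus`.
theorem isSym_Uplus {η : Comp (m + 1)} {f : MvPolynomial (Fin (m + 1)) K}
    (hf : IsNonsym q t (incr η) f) :
    IsSym q t (plus η) (((t⁻¹) ^ ((m + 1) * m / 2) *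
      ∏ j ∈ Finset.range (plus η 0 + 1), 1 / qFactorial t⁻¹ (mult η j)) • Uplus m t f) := by
  have ht := h.t_ne_zero
  have hs : ∀ σ : Equiv.Perm (Fin (m + 1)), rename σ (Uplus m t f) = Uplus m t f :=
    rename_eq_of_swapOp_eq fun i => swapOp_eq_of_T ht (LinearMap.congr_fun (T_mul_Uplus t i) f)
  have hfm : f ∈ spanMono K (upTo (plus η)) := by
    rw [← sub_add_cancel f (mono K (incr η))]
    exact Submodule.add_mem _
      (lower_le_spanMono (upTo_closed _) (Or.inl rfl) (isNonsym_incr_iff.mp hf).1)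
      (mono_mem_spanMono (Or.inl (plus_incr η)))
  have hc := sub_smul_monoSymm_mem (antitone_plus η)
    (Uplus_mem_spanMono t (upTo_closed _) hfm) hs
  constructor
  · have hl := coeffAt_Uplus h hf hc
    set c := coeffAt (plus η) (Uplus m t f) with hcd
    set a := (t⁻¹) ^ ((m + 1) * m / 2) *
      ∏ j ∈ Finset.range (plus η 0 + 1), 1 / qFactorial t⁻¹ (mult η j) with ha
    have hac : a * c = 1 := by
      rw [ha, hl, mul_mul_mul_comm, ← mul_pow, inv_mul_cancel₀ ht, one_pow, one_mul,
        ← Finset.prod_mul_distrib]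
      exact Finset.prod_eq_one fun j _ => one_div_mul_cancel (h.qFactorial_ne_zero _)
    have := Submodule.smul_mem _ a hc
    rwa [smul_sub, smul_smul, hac, one_smul] at this
  · have hcomm := LinearMap.congr_fun (commute_Uplus_sum_Y (m := m) (q := q) ht).eq f
    rw [Module.End.mul_apply, Module.End.mul_apply] at hcomm
    rw [map_smul, ← hcomm, hf.sum_Y_eq, sum_spec, plus_plus, map_smul, smul_comm]

include h in
theorem IsSym.unique {κ : Comp (m + 1)} (hκ : Antitone κ) {f g : MvPolynomial (Fin (m + 1)) K}
    (hf : IsSym q t κ f) (hg : IsSym q t κ g) : f = g := by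
  rw [← sub_eq_zero]
  refine h.eq_zero_of_sum_Y_eq (κ := κ) (lowerSymm_le_lower κ ?_) ?_
  · have := Submodule.sub_mem _ hf.1 hg.1
    rwa [sub_sub_sub_cancel_right] at this
  · rw [map_sub, hf.2, hg.2, sum_spec, plus_of_antitone hκ, smul_sub]

end Symmetric

end

end NSMacdonald

/-! ### The main theorem -/

theorem mainTheorem6 {K : Type*} [Field K] [CharZero K] (q t : K)
    (hqt : NSMacdonald.Admissible q t) (m : ℕ) (η : NSMacdonald.Comp (m + 1)) :
    ((∃! f, NSMacdonald.IsNonsym q t (NSMacdonald.incr η) f) ∧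
      (∃! f, NSMacdonald.IsSym q t (NSMacdonald.plus η) f) ∧
      NSMacdonald.P q t (NSMacdonald.plus η) =
        ((t⁻¹) ^ ((m + 1) * m / 2) *
          ∏ j ∈ Finset.range (NSMacdonald.plus η 0 + 1),
            1 / NSMacdonald.qFactorial t⁻¹ (NSMacdonald.mult η j)) •
          NSMacdonald.Uplus m t (NSMacdonald.E q t (NSMacdonald.incr η))) ∧
    (Function.Injective η →
      (∃! f, NSMacdonald.IsAnti q t (NSMacdonald.plus η) f) ∧
      NSMacdonald.S q t (NSMacdonald.plus η) =
        ((-1 : K) ^ ((m + 1) * m / 2)) •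
          NSMacdonald.Uminus m t (NSMacdonald.E q t (NSMacdonald.incr η))) := by
  have hE := NSMacdonald.existsUnique_isNonsym hqt η
  -- The polynomials are epsilon choices, so they satisfy their defining conditions only once
  -- existence is known.
  have hE' : NSMacdonald.IsNonsym q t (NSMacdonald.incr η)
      (NSMacdonald.E q t (NSMacdonald.incr η)) := Classical.epsilon_spec hE.exists
  have hκ := NSMacdonald.antitone_plus η
  refine ⟨⟨hE, ?_⟩, fun hη => ?_⟩
  · have hP := NSMacdonald.isSym_Uplus hqt hE'
    exact ⟨⟨_, hP, fun g hg => NSMacdonald.IsSym.unique hqt hκ hg hP⟩,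
      NSMacdonald.IsSym.unique hqt hκ (Classical.epsilon_spec ⟨_, hP⟩) hP⟩
  · have hS := NSMacdonald.isAnti_Uminus hqt hη hE'
    exact ⟨⟨_, hS, fun g hg => NSMacdonald.IsAnti.unique hqt hκ hg hS⟩,
      NSMacdonald.IsAnti.unique hqt hκ (Classical.epsilon_spec ⟨_, hS⟩) hS⟩
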